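/- Let $n\ge 3$ be an odd integer and $0\le b<n$ an integer. Let $U_{1,b}(\mathbb Z_2)$ be the set of monic polynomials $f=x^n+bx^{n-1}+a_{n-2}x^{n-2}+\dots+a_0$ with $a_i\in\mathbb Z_2$, equipped with the Haar probability measure $df$ in the coordinates $(a_0,\dots,a_{n-2})\in\mathbb Z_2^{n-1}$. Let $S_2\subset U_{1,b}(\mathbb Z_2)$ be a subset defined by conditions modulo $2$ (membership depends only on $f \bmod 2$), and write $\mathrm{Vol}(S_2)$ for its measure. Let $\mathfrak M_1,\mathfrak M_{-1}$ be the following diagonal $n\times n$ matrices, which represent the two $\mathrm{SL}_n(\mathbb Z_2)$-classes of symmetric matrices over $\mathbb Z_2$ of determinant $(-1)^{(n-1)/2}$: if $n\equiv 1 \pmod 4$, $\mathfrak M_1=\mathrm{diag}(1,\dots,1)$ and $\mathfrak M_{-1}=\mathrm{diag}(1,\dots,1,-1,-1)$; if $n\equiv 3\pmod 4$, $\mathfrak M_1=\mathrm{diag}(1,\dots,1,-1)$ and $\mathfrak M_{-1}=\mathrm{diag}(1,\dots,1,-1,-1,-1)$. For $A\in\{\mathfrak M_1,\mathfrak M_{-1}\}$,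 let $\mathrm{SO}_A(\mathbb Z_2)=\{g\in\mathrm{SL}_n(\mathbb Z_2): g^tAg=A\}$. For $f\in U_{1,b}(\mathbb Z_2)$, let $V_A(f)$ be the set of symmetric $n\times n$ matrices $B$ over $\mathbb Z_2$ such that $(-1)^{\frac{n-1}{2}}\det(Ax-B)=f(x)$ and the pair $(A,B)$ is projective, i.e. $\mathbb Z_2^n$, with $x$ acting by $A^{-1}B$, is a projective module over $R_f=\mathbb Z_2[x]/(f)$. The group $\mathrm{SO}_A(\mathbb Z_2)$ acts on $V_A(f)$ by $B\mapsto g^tBg$; put $$m_2(f,A)=\sum_{B\in V_A(f)/\mathrm{SO}_A(\mathbb Z_2)}\frac{1}{\#\mathrm{Stab}_{\mathrm{SO}_A(\mathbb Z_2)}(B)},\qquad c_2(A)=\int_{f\in S_2}m_2(f,A)\,df .$$ Then $f\mapsto m_2(f,A)$ is (almost everywhere) measurable on $S_2$ with finite integral for $A=\mathfrak M_{\pm1}$, and $$c_2(\mathfrak M_1)+c_2(\mathfrak M_{-1})=2^{n-1}\,\mathrm{Vol}(S_2),\qquad c_2(\mathfrak M_1)-c_2(\mathfrak M_{-1})=\pm_8\,2^{\frac{n-1}{2}}\,\mathrm{Vol}(S_2),$$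 where $\pm_8$ is $+$ if $n\equiv 1$ or $3\pmod 8$ and $-$ otherwise. In particular $$c_2(\mathfrak M_1)=\tfrac12\left(2^{n-1}\pm_8 2^{\frac{n-1}{2}}\right)\mathrm{Vol}(S_2),\qquad c_2(\mathfrak M_{-1})=\tfrac12\left(2^{n-1}\mp_8 2^{\frac{n-1}{2}}\right)\mathrm{Vol}(S_2).$$ -/

import Mathlib

open scoped ENNReal Matrix

namespace TwoAdicMass

open Polynomial MeasureTheory

noncomputable section

/-- The Borel sigma-algebra on the 2-adic integers. -/
instance instMeasurableSpacePadicIntTwo : MeasurableSpace ℤ_[2] := borel ℤ_[2]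

instance instBorelSpacePadicIntTwo : BorelSpace ℤ_[2] := ⟨rfl⟩

/-- The monic polynomial `x ^ n + b x ^ (n - 1) + ∑ i < n - 1, a i x ^ i`. For fixed `b`, the
coefficient vectors `a` are coordinates on the space `U_{1,b}(ℤ_2)` of monic polynomials of degree
`n` whose `x ^ (n - 1)`-coefficient is `b`. -/
def monicPoly (n b : ℕ) (a : Fin (n - 1) → ℤ_[2]) : ℤ_[2][X] :=
  X ^ n + C (b : ℤ_[2]) * X ^ (n - 1) + ∑ i : Fin (n - 1), C (a i) * X ^ (i : ℕ)

/-- The Haar measure on `U_{1,b}(ℤ_2)`, in coefficient coordinates, of total mass one. -/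
def coeffMeasure (n : ℕ) : Measure (Fin (n - 1) → ℤ_[2]) :=
  Measure.pi fun _ => Measure.addHaarMeasure (⊤ : TopologicalSpace.PositiveCompacts ℤ_[2])

/-- A set of polynomials (given by their coefficients) that is defined by conditions modulo 2. -/
def DefinedModTwo {n : ℕ} (S : Set (Fin (n - 1) → ℤ_[2])) : Prop :=
  ∀ a a' : Fin (n - 1) → ℤ_[2], (∀ i, (2 : ℤ_[2]) ∣ a i - a' i) → (a ∈ S ↔ a' ∈ S)

/-- The resolvent `(-1) ^ ((n - 1) / 2) det (A x - B)` of a pair of matrices. -/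
def resolvent {n : ℕ} (A B : Matrix (Fin n) (Fin n) ℤ_[2]) : ℤ_[2][X] :=
  (-1) ^ ((n - 1) / 2) * ((X : ℤ_[2][X]) • A.map C - B.map C).det

/-- For `det A = (-1) ^ ((n - 1) / 2)`, the resolvent of `(A, B)` is the characteristic polynomial
of `A⁻¹ B`. -/
theorem resolvent_eq_charpoly {n : ℕ} (A B : Matrix (Fin n) (Fin n) ℤ_[2])
    (hA : A.det = (-1) ^ ((n - 1) / 2)) : resolvent A B = (A⁻¹ * B).charpoly := by
  have hu : IsUnit A.det := by rw [hA]; exact (isUnit_one.neg).pow _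
  have hB : A * (A⁻¹ * B) = B := by
    rw [← Matrix.mul_assoc, Matrix.mul_nonsing_inv A hu, Matrix.one_mul]
  have h1 : (X : ℤ_[2][X]) • A.map C - B.map C = A.map C * (A⁻¹ * B).charmatrix := by
    conv_lhs => rw [← hB]
    rw [Matrix.charmatrix, Matrix.mul_sub, Matrix.map_mul]
    congr 1
    rw [Matrix.scalar_apply, ← Matrix.smul_one_eq_diagonal, Matrix.mul_smul, Matrix.mul_one]
  have h2 : (A.map C).det = (-1 : ℤ_[2][X]) ^ ((n - 1) / 2) := by
    rw [← RingHom.mapMatrix_apply, ← RingHom.map_det, hA]; simp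
  rw [resolvent, h1, Matrix.det_mul, h2, ← mul_assoc, ← mul_pow, Matrix.charpoly]
  simp

/-- The ring `ℤ_2[x] / (charpoly M)` acts on `ℤ_2 ^ n`, with `x` acting through `M`. -/
def quotientAction {n : ℕ} (M : Matrix (Fin n) (Fin n) ℤ_[2]) :
    (ℤ_[2][X] ⧸ Ideal.span {M.charpoly}) →+* Module.End ℤ_[2] (Fin n → ℤ_[2]) :=
  (Matrix.toLinAlgEquiv' : Matrix (Fin n) (Fin n) ℤ_[2] ≃ₐ[ℤ_[2]] _).toAlgHom.toRingHom.comp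
    (Ideal.Quotient.lift (Ideal.span {M.charpoly}) (aeval M).toRingHom (by
      intro q hq
      obtain ⟨c, rfl⟩ := Ideal.mem_span_singleton'.mp hq
      simp [Matrix.aeval_self_charpoly]))

/-- The pair `(A, B)`, with `A` unimodular of determinant `(-1) ^ ((n - 1) / 2)` and resolvent `f`,
is projective: `ℤ_2 ^ n`, on which `x` acts through `A⁻¹ B`, is a projective module over
`R_f = ℤ_2[x] / (f)`. (This module is the fractional ideal of `R_f` attached to the pair.) -/
def IsProjectivePair {n : ℕ} (A B : Matrix (Fin n) (Fin n) ℤ_[2]) : Prop :=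
  letI : Module (ℤ_[2][X] ⧸ Ideal.span {(A⁻¹ * B).charpoly}) (Fin n → ℤ_[2]) :=
    Module.compHom (Fin n → ℤ_[2]) (quotientAction (A⁻¹ * B))
  Module.Projective (ℤ_[2][X] ⧸ Ideal.span {(A⁻¹ * B).charpoly}) (Fin n → ℤ_[2])

/-- If `g` carries `Y` to `Z` then `g⁻¹` carries `Z` to `Y`. -/
theorem inv_congr {n : ℕ} (g : Matrix.SpecialLinearGroup (Fin n) ℤ_[2])
    {Y Z : Matrix (Fin n) (Fin n) ℤ_[2]} (h : g.1ᵀ * Y * g.1 = Z) :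
    (g⁻¹).1ᵀ * Z * (g⁻¹).1 = Y := by
  have h1 : g.1 * (g⁻¹).1 = 1 := by
    rw [← Matrix.SpecialLinearGroup.coe_mul]; simp
  have h2 : (g⁻¹).1ᵀ * g.1ᵀ = 1 := by
    rw [← Matrix.transpose_mul, h1, Matrix.transpose_one]
  rw [← h]
  calc (g⁻¹).1ᵀ * (g.1ᵀ * Y * g.1) * (g⁻¹).1
      = ((g⁻¹).1ᵀ * g.1ᵀ) * Y * (g.1 * (g⁻¹).1) := by simp only [Matrix.mul_assoc]
    _ = Y := by rw [h1, h2]; simp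

/-- The special orthogonal group `SO_A(ℤ_2)`. -/
def specialOrthogonal {n : ℕ} (A : Matrix (Fin n) (Fin n) ℤ_[2]) :
    Subgroup (Matrix.SpecialLinearGroup (Fin n) ℤ_[2]) where
  carrier := {g | (g : Matrix (Fin n) (Fin n) ℤ_[2])ᵀ * A * g = A}
  one_mem' := by simp
  mul_mem' := by
    intro g h hg hh
    simp only [Set.mem_ofPred_eq, Matrix.SpecialLinearGroup.coe_mul, Matrix.transpose_mul] at *
    conv_rhs => rw [← hh, ← hg]
    simp only [Matrix.mul_assoc]
  inv_mem' := fun {g} hg => inv_congr g hg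

/-- The symmetric matrices `B` over `ℤ_2` for which the pair `(A, B)` is projective with
resolvent `f`. -/
def Fibre {n : ℕ} (A : Matrix (Fin n) (Fin n) ℤ_[2]) (f : ℤ_[2][X]) : Type :=
  {B : Matrix (Fin n) (Fin n) ℤ_[2] // B.IsSymm ∧ resolvent A B = f ∧ IsProjectivePair A B}

/-- Two elements of the fibre are equivalent if they lie in one orbit of `SO_A(ℤ_2)`, where
`g` sends `B` to `gᵀ B g`. -/
def orbitSetoid {n : ℕ} (A : Matrix (Fin n) (Fin n) ℤ_[2]) (f : ℤ_[2][X]) :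
    Setoid (Fibre A f) where
  r B B' := ∃ g ∈ specialOrthogonal A, (g : Matrix (Fin n) (Fin n) ℤ_[2])ᵀ * B.1 * g = B'.1
  iseqv := by
    refine ⟨fun B => ⟨1, one_mem _, by simp⟩, ?_, ?_⟩
    · rintro B B' ⟨g, hg, h⟩
      exact ⟨g⁻¹, inv_mem hg, inv_congr g h⟩
    · rintro B B' B'' ⟨g, hg, h⟩ ⟨k, hk, h'⟩
      refine ⟨g * k, mul_mem hg hk, ?_⟩
      rw [← h', ← h]
      simp only [Matrix.SpecialLinearGroup.coe_mul, Matrix.transpose_mul, Matrix.mul_assoc]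

/-- The stabiliser of `B` in `SO_A(ℤ_2)`. -/
def Stab {n : ℕ} (A B : Matrix (Fin n) (Fin n) ℤ_[2]) : Type :=
  {g : specialOrthogonal A //
    ((g : Matrix.SpecialLinearGroup (Fin n) ℤ_[2]) : Matrix (Fin n) (Fin n) ℤ_[2])ᵀ * B *
      ((g : Matrix.SpecialLinearGroup (Fin n) ℤ_[2]) : Matrix (Fin n) (Fin n) ℤ_[2]) = B}

/-- The 2-adic mass `m_2(f, A)`: the sum of `1 / #Stab(B)` over representatives `B` of the
`SO_A(ℤ_2)`-orbits in the fibre over `f`. -/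
def localMass {n : ℕ} (A : Matrix (Fin n) (Fin n) ℤ_[2]) (f : ℤ_[2][X]) : ℝ≥0∞ :=
  ∑' O : Quotient (orbitSetoid A f), ((ENat.card (Stab A O.out.1) : ℕ∞) : ℝ≥0∞)⁻¹

/-- The integral `c_2(A)` of the 2-adic mass over `S`. -/
def integratedMass {n : ℕ} (b : ℕ) (S : Set (Fin (n - 1) → ℤ_[2]))
    (A : Matrix (Fin n) (Fin n) ℤ_[2]) : ℝ≥0∞ :=
  ∫⁻ a in S, localMass A (monicPoly n b a) ∂(coeffMeasure n)

/-- The diagonal matrix whose last `k` diagonal entries are `-1` and whose others are `1`. -/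
def signDiagonal (n k : ℕ) : Matrix (Fin n) (Fin n) ℤ_[2] :=
  Matrix.diagonal fun i => if (i : ℕ) + k < n then 1 else -1

/-- The unimodular form of determinant `(-1) ^ ((n - 1) / 2)` and Hasse-Witt symbol `1`
(`n` odd). -/
def formPos (n : ℕ) : Matrix (Fin n) (Fin n) ℤ_[2] :=
  if n % 4 = 1 then signDiagonal n 0 else signDiagonal n 1

/-- The unimodular form of determinant `(-1) ^ ((n - 1) / 2)` and Hasse-Witt symbol `-1`
(`n` odd, `n ≥ 3`). -/
def formNeg (n : ℕ) : Matrix (Fin n) (Fin n) ℤ_[2] :=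
  if n % 4 = 1 then signDiagonal n 2 else signDiagonal n 3

/-- The sign that is `1` for `n ≡ 1, 3` modulo `8` and `-1` otherwise. -/
def octantSign (n : ℕ) : ℝ := if n % 8 = 1 ∨ n % 8 = 3 then 1 else -1

end

end TwoAdicMass

/-! For monic `f` of degree `n` put R = ℤ_2[x]/(f). Since R is semilocal, a projective pair is free
of rank one over R. A generator turns `A` into the form φ(rs) and `B` into φ(xrs) for a functional φ
: R → ℤ_2, and changing the generator by a unit u replaces φ by u²φ (`exists_isFrame`,
`IsFrame.exists_unit`). The unimodular functionals are the unit multiples of any one of them, φ₀.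
Orbits are therefore the square classes of units δ for which δφ₀ has Gram matrix congruent to `A`.
Each stabiliser is the group of u with u² = 1 and norm one, which is half of the group of all square
roots of 1, as `n` is odd.

All of this is visible modulo 8: units 1 + 8r are squares (`exists_add_two_mul_sq`), and congruence
of unimodular forms can be tested modulo 8 (`congruent_iff_map_redEight`). On the finite group of
units modulo 1 + 8R, squaring has a kernel of order 2^n times the number of square roots of 1 in R.
That number cancels against the stabilisers, so the mass is 2^(n+1) times the proportion of
unimodular functionals modulo 8 whose Gram matrix is congruent to `A` (`localMass_mul_card`).

This proportion varies with `f`, but its average over a residue class modulo 2 is computable. A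
polynomial together with a functional is a linear recurrence sequence, and its Gram matrix is a
Hankel matrix. In the nonsingular case the first 2n terms determine both, so pairs modulo 8 become
Hankel sequences (`card_pairs_eq_card_hankel`). A nonsingular Hankel matrix of odd size over 𝔽₂ is
not alternating, hence has an orthonormal basis. In a lift of that basis, the isomorphism class of a
lift of the form to ℤ/8 is recognised by its determinant and by the number modulo 4 of diagonal
entries that are 3 modulo 4 (`signForm_congruent_iff_of_map_redTwo`). Perturbing the sequence by
multiples of 2 makes those diagonal bits equidistributed in 𝔽₂^n. Perturbing it by a multiple of 4
multiplies the determinant by 5 and keeps the bits. Hence the average mass of the form with k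
entries -1 is the number of vectors in 𝔽₂^n of weight k modulo 4 (`card_hankel_congruent_signForm`,
`sum_massEight`).

Fixing the second coefficient does not change the average: translations of x preserve the mass and,
`n` being odd, permute the admissible values of that coefficient. The weight counts are read off
from (1 + 1)^n, (1 - 1)^n and (1 + i)^n, the last of which produces the sign modulo 8. -/

open scoped ENNReal Matrix

/-! ### Congruence and diagonalisation of symmetric matrices over ℤ/8. -/

namespace TwoAdicMass

/-- Two square matrices are congruent if an invertible change of basis carries the bilinear form of
the first to that of the second. -/
def Congruent {ι R : Type*} [Fintype ι] [DecidableEq ι] [CommRing R] (A H : Matrix ι ι R) : Prop :=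
  ∃ K : Matrix ι ι R, IsUnit K.det ∧ Kᵀ * A * K = H

namespace Congruent

variable {ι κ R : Type*} [Fintype ι] [DecidableEq ι] [Fintype κ] [DecidableEq κ] [CommRing R]
  {A B C : Matrix ι ι R}

theorem refl (A : Matrix ι ι R) : Congruent A A := ⟨1, by simp, by simp⟩

theorem symm (h : Congruent A B) : Congruent B A := by
  obtain ⟨K, hK, rfl⟩ := h
  refine ⟨K⁻¹, by rwa [Matrix.isUnit_nonsing_inv_det_iff], ?_⟩
  rw [Matrix.transpose_nonsing_inv]
  have h1 : (Kᵀ)⁻¹ * Kᵀ = 1 := Matrix.nonsing_inv_mul _ (by rwa [Matrix.det_transpose])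
  have h2 : K * K⁻¹ = 1 := Matrix.mul_nonsing_inv _ hK
  calc (Kᵀ)⁻¹ * (Kᵀ * A * K) * K⁻¹ = ((Kᵀ)⁻¹ * Kᵀ) * A * (K * K⁻¹) := by
        simp only [Matrix.mul_assoc]
    _ = A := by rw [h1, h2]; simp

theorem trans (h : Congruent A B) (h' : Congruent B C) : Congruent A C := by
  obtain ⟨K, hK, rfl⟩ := h
  obtain ⟨L, hL, rfl⟩ := h'
  exact ⟨K * L, by rw [Matrix.det_mul]; exact hK.mul hL, by
    simp only [Matrix.transpose_mul, Matrix.mul_assoc]⟩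

theorem map {S : Type*} [CommRing S] (φ : R →+* S) (h : Congruent A B) :
    Congruent (A.map φ) (B.map φ) := by
  obtain ⟨K, hK, rfl⟩ := h
  refine ⟨K.map φ, ?_, by simp [Matrix.map_mul, Matrix.transpose_map]⟩
  have : (K.map φ).det = φ K.det := (RingHom.map_det φ K).symm
  rw [this]
  exact hK.map φ

theorem submatrix (e : κ ≃ ι) (h : Congruent A B) :
    Congruent (A.submatrix e e) (B.submatrix e e) := by
  obtain ⟨K, hK, rfl⟩ := h
  refine ⟨K.submatrix e e, by rwa [Matrix.det_submatrix_equiv_self], ?_⟩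
  rw [Matrix.transpose_submatrix, Matrix.submatrix_mul_equiv, Matrix.submatrix_mul_equiv]

theorem submatrix_iff (e : κ ≃ ι) :
    Congruent (A.submatrix e e) (B.submatrix e e) ↔ Congruent A B := by
  refine ⟨fun h => ?_, submatrix e⟩
  simpa using h.submatrix e.symm

theorem fromBlocks {D : Matrix κ κ R} (h : Congruent A B) :
    Congruent (Matrix.fromBlocks A 0 0 D) (Matrix.fromBlocks B 0 0 D) := by
  obtain ⟨K, hK, rfl⟩ := h
  refine ⟨Matrix.fromBlocks K 0 0 1, by simpa using hK, ?_⟩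
  simp [Matrix.fromBlocks_transpose, Matrix.fromBlocks_multiply]

theorem perm (A : Matrix ι ι R) (σ : Equiv.Perm ι) : Congruent A (A.submatrix σ σ) := by
  refine ⟨(1 : Matrix ι ι R).submatrix id σ, ?_, ?_⟩
  · rw [Matrix.det_permute', Matrix.det_one, mul_one]
    exact ((Equiv.Perm.sign σ).isUnit.map (Int.castRingHom R))
  · rw [Matrix.transpose_submatrix, Matrix.transpose_one]
    ext i j
    simp [Matrix.mul_apply, Matrix.one_apply]

theorem det_eq (h : Congruent A B) : ∃ u : R, IsUnit u ∧ B.det = u * u * A.det := by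
  obtain ⟨K, hK, rfl⟩ := h
  exact ⟨K.det, hK, by rw [Matrix.det_mul, Matrix.det_mul, Matrix.det_transpose]; ring⟩

end Congruent

/-- Reduction from `ℤ/8` to `ℤ/2`. -/
def redTwo : ZMod 8 →+* ZMod 2 := ZMod.castHom (by norm_num) (ZMod 2)

theorem isUnit_iff_redTwo (z : ZMod 8) : IsUnit z ↔ redTwo z = 1 := by
  have h : ∀ z : ZMod 8, (∃ y, z * y = 1) ↔ redTwo z = 1 := by decide
  rw [isUnit_iff_exists_inv, h]

theorem mul_self_of_redTwo : ∀ z : ZMod 8, redTwo z = 1 → z * z = 1 := by decide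

theorem isUnit_det_iff_redTwo {ι : Type*} [Fintype ι] [DecidableEq ι] (K : Matrix ι ι (ZMod 8)) :
    IsUnit K.det ↔ (K.map redTwo).det = 1 := by
  rw [isUnit_iff_redTwo, RingHom.map_det, RingHom.mapMatrix_apply]

theorem Congruent.det_eq_of_zmod_eight {ι : Type*} [Fintype ι] [DecidableEq ι]
    {A B : Matrix ι ι (ZMod 8)} (h : Congruent A B) : B.det = A.det := by
  obtain ⟨u, hu, h⟩ := h.det_eq
  rw [h, mul_self_of_redTwo u ((isUnit_iff_redTwo u).1 hu), one_mul]

/-- The indicator of the residue class of `3` modulo `4`. -/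
def bitFour (z : ZMod 8) : ZMod 2 := if z = 3 ∨ z = 7 then 1 else 0

theorem bitFour_add_two_mul : ∀ z y : ZMod 8, redTwo z = 1 →
    bitFour (z + 2 * y) = bitFour z + redTwo y := by decide

theorem bitFour_add_four_mul : ∀ z y : ZMod 8, redTwo z = 1 →
    bitFour (z + 4 * y) = bitFour z := by decide

section

variable {ι : Type*} [Fintype ι] [DecidableEq ι]

theorem isUnit_det_one_add_two_smul (X : Matrix ι ι (ZMod 8)) :
    IsUnit (1 + (2 : ZMod 8) • X).det := by
  rw [isUnit_det_iff_redTwo]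
  have : (1 + (2 : ZMod 8) • X).map redTwo = 1 := by
    ext i j
    have h2 : redTwo 2 = 0 := by decide
    simp [Matrix.one_apply, h2, apply_ite redTwo]
  rw [this, Matrix.det_one]

theorem redTwo_diagonal_mul_self (d : ι → ZMod 8) (hd : ∀ i, redTwo (d i) = 1) :
    Matrix.diagonal d * Matrix.diagonal d = 1 := by
  rw [Matrix.diagonal_mul_diagonal, ← Matrix.diagonal_one]
  congr 1
  ext i
  exact mul_self_of_redTwo _ (hd i)

/-- One step of the diagonalisation of a symmetric matrix over `ℤ/8` that is diagonal modulo an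
even number. -/
theorem congruent_diagonal_add_sq [LinearOrder ι] (d : ι → ZMod 8) (hd : ∀ i, redTwo (d i) = 1)
    (c : ZMod 8) (hc : ∃ c', c = 2 * c') (F : Matrix ι ι (ZMod 8)) (hF : F.IsSymm)
    (hF0 : ∀ i, F i i = 0) :
    ∃ Y : Matrix ι ι (ZMod 8), Y.IsSymm ∧
      Congruent (Matrix.diagonal d + c • F) (Matrix.diagonal d + (c * c) • Y) := by
  obtain ⟨c', hc⟩ := hc
  set D := Matrix.diagonal d with hD
  have hDD : D * D = 1 := redTwo_diagonal_mul_self d hd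
  have hDt : Dᵀ = D := Matrix.diagonal_transpose d
  -- Halving `F` is impossible, so it is split as Uᵀ + U with `U` strictly upper triangular. As `D`
  -- is its own inverse (odd squares are 1 modulo 8), X = -DU solves XᵀD + DX = -F, and this kills
  -- the term linear in `c`.
  set U : Matrix ι ι (ZMod 8) := Matrix.of fun i j => if i < j then F i j else 0 with hU
  have hUF : Uᵀ + U = F := by
    ext i j
    simp only [hU, Matrix.add_apply, Matrix.transpose_apply, Matrix.of_apply]
    rcases lt_trichotomy i j with h | h | h
    · simp [h, h.not_gt]
    · subst h; simp [hF0]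
    · simp [h, h.not_gt, hF.apply i j]
  set X := -(D * U) with hX
  have hXt : Xᵀ = -(Uᵀ * D) := by rw [hX, Matrix.transpose_neg, Matrix.transpose_mul, hDt]
  have hDX : D * X = -U := by
    rw [hX, Matrix.mul_neg, ← Matrix.mul_assoc, hDD, Matrix.one_mul]
  have hXD : Xᵀ * D = -Uᵀ := by
    rw [hXt, Matrix.neg_mul, Matrix.mul_assoc, hDD, Matrix.mul_one]
  refine ⟨Xᵀ * F + F * X + Xᵀ * (D + c • F) * X, ?_, 1 + c • X, ?_, ?_⟩
  · simp only [Matrix.IsSymm, Matrix.transpose_add, Matrix.transpose_mul,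
      Matrix.transpose_transpose, Matrix.transpose_smul, hF.eq, hDt, Matrix.mul_assoc]
    abel
  · rw [hc, mul_smul]
    exact isUnit_det_one_add_two_smul _
  · calc (1 + c • X)ᵀ * (D + c • F) * (1 + c • X)
        = D + c • F + c • (Xᵀ * D + D * X) + (c * c) • (Xᵀ * F + F * X)
            + (c * c) • (Xᵀ * (D + c • F) * X) := by
          simp only [Matrix.transpose_add, Matrix.transpose_smul, Matrix.transpose_one,
            Matrix.add_mul, Matrix.mul_add, Matrix.smul_mul, Matrix.mul_smul, Matrix.one_mul,
            Matrix.mul_one, smul_add, mul_smul]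
          abel
      _ = _ := by
          rw [hDX, hXD, ← hUF]
          simp only [smul_add, smul_neg]
          abel

/-- A symmetric matrix over `ℤ/8` that is the identity modulo `2` can be diagonalised without
changing the diagonal modulo `4`. -/
theorem exists_congruent_diagonal [LinearOrder ι] (G : Matrix ι ι (ZMod 8)) (hG : G.IsSymm)
    (h1 : G.map redTwo = 1) :
    ∃ u : ι → ZMod 8, (∀ i, redTwo (u i) = 1) ∧ (∀ i, bitFour (u i) = bitFour (G i i)) ∧
      Congruent G (Matrix.diagonal u) := by
  have hdiag : ∀ i, redTwo (G i i) = 1 := fun i => by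
    have := congrFun (congrFun h1 i) i
    simpa using this
  have hoff : ∀ i j, i ≠ j → redTwo (G i j) = 0 := fun i j hij => by
    have := congrFun (congrFun h1 i) j
    simpa [Matrix.one_apply, hij] using this
  have hhalf : ∀ z : ZMod 8, redTwo z = 0 → 2 * ((z.val / 2 : ℕ) : ZMod 8) = z := by decide
  let F : Matrix ι ι (ZMod 8) := Matrix.of fun i j =>
    if i = j then 0 else (((G i j).val / 2 : ℕ) : ZMod 8)
  have hF : F.IsSymm := by
    ext i j
    simp only [F, Matrix.transpose_apply, Matrix.of_apply, hG.apply i j, eq_comm]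
  have hGF : G = Matrix.diagonal (fun i => G i i) + (2 : ZMod 8) • F := by
    ext i j
    by_cases hij : i = j
    · subst hij; simp [F]
    · simp [F, hij, hhalf _ (hoff i j hij)]
  -- Newton iteration: an off-diagonal error of order 2 becomes an error of order 4, whose diagonal
  -- part is absorbed into `d`. The next step leaves an error of order 16 = 0.
  obtain ⟨Y, hY, hGY⟩ := congruent_diagonal_add_sq (fun i => G i i) hdiag 2 ⟨1, by simp⟩ F hF
    (by simp [F])
  rw [← hGF] at hGY
  let d : ι → ZMod 8 := fun i => G i i + 4 * Y i i
  have hred4 : ∀ z y : ZMod 8, redTwo (z + 4 * y) = redTwo z := by decide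
  have hd : ∀ i, redTwo (d i) = 1 := fun i => by simp only [d, hred4, hdiag]
  let F' : Matrix ι ι (ZMod 8) := Matrix.of fun i j => if i = j then 0 else Y i j
  have hF' : F'.IsSymm := by
    ext i j
    simp only [F', Matrix.transpose_apply, Matrix.of_apply, hY.apply i j, eq_comm]
  have hYF : Matrix.diagonal (fun i => G i i) + ((2 : ZMod 8) * 2) • Y
      = Matrix.diagonal d + (4 : ZMod 8) • F' := by
    have h4 : (2 : ZMod 8) * 2 = 4 := by decide
    ext i j
    by_cases hij : i = j
    · subst hij; simp [F', d, h4]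
    · simp [F', hij, h4]
  obtain ⟨Z, -, hZ⟩ := congruent_diagonal_add_sq d hd 4 ⟨2, by decide⟩ F' hF' (by simp [F'])
  have h0 : (4 : ZMod 8) * 4 = 0 := by decide
  rw [h0, zero_smul, add_zero, ← hYF] at hZ
  exact ⟨d, hd, fun i => bitFour_add_four_mul _ _ (hdiag i), hGY.trans hZ⟩

/-- Over `ℤ/8`, an even number of entries of a diagonal form may be multiplied by `5`. -/
theorem congruent_diagonal_mul_five [LinearOrder ι] (u : ι → ZMod 8) (hu : ∀ i, redTwo (u i) = 1)
    (T : Finset ι) (hT : Even T.card) :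
    Congruent (Matrix.diagonal u) (Matrix.diagonal fun i => if i ∈ T then u i * 5 else u i) := by
  set D := Matrix.diagonal u with hD
  have hDD : D * D = 1 := redTwo_diagonal_mul_self u hu
  have hDt : Dᵀ = D := Matrix.diagonal_transpose u
  -- The change of basis is 1 + 2DJ. Antisymmetry of `J` removes the linear term, leaving D + 4JᵀDJ.
  -- Only JᵀDJ modulo 2 matters: its (i, j) entry on `T` counts the k in `T` different from i and j.
  -- That is |T| - 1 (odd) on the diagonal and |T| - 2 (even) off it, so exactly the entries in `T`
  -- gain 4.
  let J : Matrix ι ι (ZMod 8) := Matrix.of fun i j =>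
    if i ∈ T ∧ j ∈ T then (if i < j then 1 else if j < i then -1 else 0) else 0
  have hJ : Jᵀ + J = 0 := by
    ext i j
    simp only [J, Matrix.add_apply, Matrix.transpose_apply, Matrix.of_apply, Matrix.zero_apply]
    rcases lt_trichotomy i j with h | h | h
    · by_cases hi : i ∈ T <;> by_cases hj : j ∈ T <;> simp [hi, hj, h, h.not_gt]
    · subst h; simp
    · by_cases hi : i ∈ T <;> by_cases hj : j ∈ T <;> simp [hi, hj, h, h.not_gt]
  refine ⟨1 + (2 : ZMod 8) • (D * J), isUnit_det_one_add_two_smul _, ?_⟩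
  have hexp : (1 + (2 : ZMod 8) • (D * J))ᵀ * D * (1 + (2 : ZMod 8) • (D * J))
      = D + (4 : ZMod 8) • (Jᵀ * D * J) := by
    have h4 : (4 : ZMod 8) = 2 * 2 := by decide
    have hL : Jᵀ * D * D = Jᵀ := by rw [Matrix.mul_assoc, hDD, Matrix.mul_one]
    have hR : D * (D * J) = J := by rw [← Matrix.mul_assoc, hDD, Matrix.one_mul]
    calc _ = D + (2 : ZMod 8) • (Jᵀ * D * D + D * (D * J))
          + ((2 : ZMod 8) * 2) • ((Jᵀ * D * D) * (D * J)) := by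
          simp only [Matrix.transpose_add, Matrix.transpose_smul, Matrix.transpose_one,
            Matrix.transpose_mul, hDt, Matrix.add_mul, Matrix.mul_add, Matrix.smul_mul,
            Matrix.mul_smul, Matrix.one_mul, Matrix.mul_one, smul_add, mul_smul]
          abel
      _ = _ := by rw [hL, hR, hJ, smul_zero, add_zero, h4, Matrix.mul_assoc]
  rw [hexp]
  have h4red : ∀ z y : ZMod 8, redTwo z = redTwo y → 4 * z = 4 * y := by decide
  have hu5 : ∀ z : ZMod 8, redTwo z = 1 → z + 4 * 1 = z * 5 := by decide
  have hent : ∀ i j, redTwo ((Jᵀ * D * J) i j) = if i = j ∧ i ∈ T then 1 else 0 := by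
    intro i j
    have hJr : ∀ a b, redTwo (J a b) = if a ∈ T ∧ b ∈ T ∧ a ≠ b then 1 else 0 := by
      intro a b
      have hm : redTwo (-1) = 1 := by decide
      simp only [J, Matrix.of_apply]
      by_cases ha : a ∈ T <;> by_cases hb : b ∈ T <;> simp only [ha, hb, true_and, and_true,
        false_and, and_false, if_true, if_false, map_zero]
      rcases lt_trichotomy a b with h | h | h
      · simp [h, h.ne]
      · subst h; simp
      · simp [h, h.not_gt, h.ne', hm]
    rw [Matrix.mul_apply, map_sum]
    simp only [hD, Matrix.mul_diagonal, map_mul, hu, mul_one, Matrix.transpose_apply, hJr]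
    have hc : ∀ k, ((if k ∈ T ∧ i ∈ T ∧ k ≠ i then (1 : ZMod 2) else 0) *
        if k ∈ T ∧ j ∈ T ∧ k ≠ j then 1 else 0)
        = if k ∈ T then (if i ∈ T ∧ j ∈ T then (if k ≠ i ∧ k ≠ j then 1 else 0) else 0) else 0 := by
      intro k
      by_cases hk : k ∈ T <;> by_cases hi : i ∈ T <;> by_cases hj : j ∈ T <;>
        by_cases hki : k = i <;> by_cases hkj : k = j <;> simp [*]
    simp only [hc]
    rw [← Finset.sum_filter]
    simp only [Finset.filter_mem_eq_inter, Finset.univ_inter]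
    by_cases hi : i ∈ T
    swap; · simp [hi]
    by_cases hj : j ∈ T
    swap
    · have : i ≠ j := fun h => hj (h ▸ hi)
      simp [hj, this]
    simp only [hi, hj, and_self, if_true, and_true]
    rw [← Finset.sum_filter, Finset.sum_const, nsmul_one]
    obtain ⟨m, hm⟩ := hT
    by_cases hij : i = j
    · subst hij
      have : (T.filter fun k => k ≠ i ∧ k ≠ i) = T.erase i := by
        ext k; simp [and_comm]
      rw [this, Finset.card_erase_of_mem hi]
      have hpos : 0 < T.card := Finset.card_pos.2 ⟨i, hi⟩
      have h1 : T.card - 1 = 2 * (m - 1) + 1 := by omega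
      rw [h1]
      have h2 : (2 : ZMod 2) = 0 := by decide
      push_cast
      simp [h2]
    · have : (T.filter fun k => k ≠ i ∧ k ≠ j) = (T.erase i).erase j := by
        ext k; simp; tauto
      rw [this, Finset.card_erase_of_mem (by simp [hj, Ne.symm hij]),
        Finset.card_erase_of_mem hi]
      have h1 : T.card - 1 - 1 = 2 * (m - 1) := by omega
      rw [h1]
      have h2 : (2 : ZMod 2) = 0 := by decide
      push_cast
      simp [h2, hij]
  ext i j
  rw [Matrix.add_apply, Matrix.smul_apply, smul_eq_mul]
  by_cases hij : i = j
  · subst hij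
    by_cases hi : i ∈ T
    · rw [h4red _ 1 (by rw [hent]; simp [hi])]
      simp only [hD, Matrix.diagonal_apply_eq, hi, if_true]
      exact hu5 _ (hu i)
    · rw [h4red _ 0 (by rw [hent]; simp [hi])]
      simp [hD, hi]
  · rw [h4red _ 0 (by rw [hent]; simp [hij])]
    simp [hD, hij]

end

end TwoAdicMass

/-! ### Classification of the forms with entries ±1 over ℤ/8. -/

namespace TwoAdicMass

section

variable {ι : Type*} [Fintype ι] [DecidableEq ι]

/-- The diagonal form over `ℤ/8` with entries `-1` on `T` and `1` elsewhere. -/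
def signForm (T : Finset ι) : Matrix ι ι (ZMod 8) :=
  Matrix.diagonal fun i => if i ∈ T then -1 else 1

theorem det_signForm (T : Finset ι) : (signForm T).det = (-1) ^ T.card := by
  rw [signForm, Matrix.det_diagonal, Finset.prod_ite_mem, Finset.univ_inter, Finset.prod_const]

theorem signForm_congruent_of_card_eq {T T' : Finset ι} (h : T.card = T'.card) :
    Congruent (signForm T) (signForm T') := by
  let e : {x // x ∈ T'} ≃ {x // x ∈ T} := Finset.equivOfCardEq h.symm
  have hσ : ∀ i, e.extendSubtype i ∈ T ↔ i ∈ T' := fun i => by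
    by_cases hi : i ∈ T'
    · simp [hi, e.extendSubtype_mem i hi]
    · simp [hi, e.extendSubtype_not_mem i hi]
  have := Congruent.perm (signForm T) e.extendSubtype
  convert this using 1
  rw [signForm, signForm, Matrix.submatrix_diagonal_equiv]
  congr 1
  ext i
  simp [hσ]

/-- The witness has integer columns that are pairwise orthogonal of norm 7 = 1 + 1 + 1 + 4, and -7 =
1 modulo 8. -/
theorem congruent_one_neg_one_fin_four :
    Congruent (Matrix.diagonal fun _ : Fin 4 => (-1 : ZMod 8)) (Matrix.diagonal fun _ => 1) := by
  refine ⟨!![1, 1, 1, 2; -1, 1, -2, 1; -1, 2, 1, -1; -2, -1, 1, 1], ?_, ?_⟩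
  · rw [isUnit_det_iff_redTwo]
    decide
  · decide

/-- Together with permutations of the basis, this shows that only the number of negative entries
modulo 4 can matter. -/
theorem signForm_sdiff_congruent (T Q : Finset ι) (hQ : Q ⊆ T) (h4 : Q.card = 4) :
    Congruent (signForm T) (signForm (T \ Q)) := by
  let e₀ : Fin 4 ≃ {x // x ∈ Q} := (Finset.equivFinOfCardEq h4).symm
  let e : Fin 4 ⊕ {x // x ∉ Q} ≃ ι :=
    (Equiv.sumCongr e₀ (Equiv.refl _)).trans (Equiv.sumCompl (· ∈ Q))
  rw [← Congruent.submatrix_iff e]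
  have key := Congruent.fromBlocks (D := Matrix.diagonal fun i : {x // x ∉ Q} =>
    if (i : ι) ∈ T then (-1 : ZMod 8) else 1) congruent_one_neg_one_fin_four
  rw [Matrix.fromBlocks_diagonal, Matrix.fromBlocks_diagonal] at key
  convert key using 1
  · rw [signForm, Matrix.submatrix_diagonal_equiv]
    congr 1
    ext i
    rcases i with i | i
    · simp [e, hQ (e₀ i).2]
    · simp [e]
  · rw [signForm, Matrix.submatrix_diagonal_equiv]
    congr 1
    ext i
    rcases i with i | i
    · simp [e]
    · simp [e, i.2]

theorem exists_signForm_congruent_lt_four (T : Finset ι) :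
    ∃ T' : Finset ι, T'.card = T.card % 4 ∧ Congruent (signForm T) (signForm T') := by
  induction h : T.card using Nat.strong_induction_on generalizing T with
  | _ m ih =>
    by_cases h4 : m < 4
    · exact ⟨T, by rw [Nat.mod_eq_of_lt h4, h], .refl _⟩
    · obtain ⟨Q, hQ, hQ4⟩ := Finset.exists_subset_card_eq (s := T) (n := 4) (by omega)
      have hc : (T \ Q).card = m - 4 := by rw [Finset.card_sdiff_of_subset hQ, h, hQ4]
      obtain ⟨T', h1, h2⟩ := ih (m - 4) (by omega) _ hc
      exact ⟨T', by omega, (signForm_sdiff_congruent T Q hQ hQ4).trans h2⟩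

theorem signForm_congruent_of_modEq {T T' : Finset ι} (h : T.card ≡ T'.card [MOD 4]) :
    Congruent (signForm T) (signForm T') := by
  obtain ⟨S, h1, h2⟩ := exists_signForm_congruent_lt_four T
  obtain ⟨S', h1', h2'⟩ := exists_signForm_congruent_lt_four T'
  exact (h2.trans (signForm_congruent_of_card_eq (h1.trans (Eq.trans h h1'.symm)))).trans h2'.symm

theorem sum_sign (T : Finset ι) :
    ∑ i, (if i ∈ T then (-1 : ZMod 8) else 1) = Fintype.card ι - 2 * T.card := by
  have : ∀ i, (if i ∈ T then (-1 : ZMod 8) else 1) = 1 - 2 * (if i ∈ T then 1 else 0) := by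
    intro i; split_ifs <;> norm_num
  simp only [this, Finset.sum_sub_distrib, ← Finset.mul_sum]
  simp

/-- The invariant is the value of the form modulo 8 at a characteristic vector. Odd squares are 1
modulo 8, so every vector with odd coordinates has the same value n - 2|T|, and a congruence carries
the all-ones vector to such a vector. -/
theorem modEq_of_signForm_congruent {T T' : Finset ι}
    (h : Congruent (signForm T) (signForm T')) : T.card ≡ T'.card [MOD 4] := by
  obtain ⟨K, hK, hKT⟩ := h
  -- the image of the all-ones vector is characteristic, hence has odd coordinates
  have hdet := (isUnit_det_iff_redTwo K).1 hK
  have hs : ∀ T : Finset ι, (signForm T).map redTwo = 1 := fun T => by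
    have hm : redTwo (-1) = 1 := by decide
    ext i j
    by_cases hij : i = j
    · subst hij; by_cases hi : i ∈ T <;> simp [signForm, hi, hm]
    · simp [signForm, hij]
  set k := K.map redTwo with hk
  have hkk : kᵀ * k = 1 := by
    have := congrArg (fun M : Matrix ι ι (ZMod 8) => M.map redTwo) hKT
    simpa only [Matrix.map_mul, Matrix.transpose_map, hs, Matrix.mul_one] using this
  have hkk' : k * kᵀ = 1 := mul_eq_one_comm.1 hkk
  have hrow : ∀ i, ∑ j, k i j = 1 := fun i => by
    have := congrFun (congrFun hkk' i) i
    rw [Matrix.mul_apply, Matrix.one_apply_eq] at this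
    rw [← this]
    refine Finset.sum_congr rfl fun j _ => ?_
    have : ∀ z : ZMod 2, z = z * z := by decide
    exact this _
  have hodd : ∀ i, (∑ j, K i j) * (∑ j, K i j) = 1 := fun i => by
    refine mul_self_of_redTwo _ ?_
    rw [map_sum]
    exact hrow i
  have hone : ∀ M : Matrix ι ι (ZMod 8), (fun _ => 1) ⬝ᵥ (Mᵀ * signForm T * M) *ᵥ (fun _ => 1)
      = ∑ i, (if i ∈ T then -1 else 1) * ((∑ j, M i j) * (∑ j, M i j)) := by
    intro M
    rw [← Matrix.mulVec_mulVec, ← Matrix.mulVec_mulVec, Matrix.dotProduct_mulVec,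
      Matrix.vecMul_transpose]
    simp only [signForm, Matrix.mulVec_diagonal, dotProduct]
    refine Finset.sum_congr rfl fun i _ => ?_
    simp only [Matrix.mulVec, dotProduct, mul_one]
    ring
  have h1 := hone K
  rw [hKT] at h1
  simp only [hodd, mul_one] at h1
  have h2 : (fun _ => 1) ⬝ᵥ (signForm T') *ᵥ (fun _ => (1 : ZMod 8))
      = ∑ i, (if i ∈ T' then -1 else 1) := by
    simp [signForm, Matrix.mulVec_diagonal, dotProduct]
  rw [h2, sum_sign, sum_sign, sub_right_inj] at h1
  have h3 : ((2 * T'.card : ℕ) : ZMod 8) = ((2 * T.card : ℕ) : ZMod 8) := by push_cast; exact h1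
  rw [ZMod.natCast_eq_natCast_iff] at h3
  unfold Nat.ModEq at *
  omega

variable [LinearOrder ι]

/-- The set of diagonal entries that are `3` modulo `4`. -/
def negSet (G : Matrix ι ι (ZMod 8)) : Finset ι := {i | bitFour (G i i) = 1}

/-- The determinant and the isomorphism class of a symmetric matrix over `ℤ/8` that is the identity
modulo `2`, in terms of its diagonal. -/
theorem det_and_congruent_of_map_redTwo (G : Matrix ι ι (ZMod 8)) (hG : G.IsSymm)
    (h1 : G.map redTwo = 1) :
    (G.det = (-1) ^ (negSet G).card ∨ G.det = 5 * (-1) ^ (negSet G).card) ∧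
      (G.det = (-1) ^ (negSet G).card → Congruent G (signForm (negSet G))) := by
  obtain ⟨u, hu, hbit, hGu⟩ := exists_congruent_diagonal G hG h1
  -- Each odd class is ±1 or ±5, the sign being detected by `bitFour`, and `T` collects the entries
  -- ±5. The determinant sees the parity of |T|. When it is even, `congruent_diagonal_mul_five`
  -- removes all the factors 5 at once.
  let T : Finset ι := {i | u i = 5 ∨ u i = 3}
  have hdec : ∀ z : ZMod 8, redTwo z = 1 →
      (if z = 5 ∨ z = 3 then z * 5 else z) = if bitFour z = 1 then -1 else 1 := by decide
  have hdec' : ∀ z : ZMod 8, redTwo z = 1 →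
      z = (if bitFour z = 1 then -1 else 1) * if z = 5 ∨ z = 3 then 5 else 1 := by decide
  have hmem : ∀ i, bitFour (u i) = 1 ↔ i ∈ negSet G := fun i => by simp [negSet, hbit]
  have hdet : G.det = (-1) ^ (negSet G).card * 5 ^ T.card := by
    rw [← hGu.det_eq_of_zmod_eight, Matrix.det_diagonal]
    calc ∏ i, u i = ∏ i, ((if i ∈ negSet G then (-1 : ZMod 8) else 1)
          * if i ∈ T then 5 else 1) := by
          refine Finset.prod_congr rfl fun i _ => ?_
          conv_lhs => rw [hdec' (u i) (hu i)]
          simp only [hmem, T, Finset.mem_filter, Finset.mem_univ, true_and]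
      _ = _ := by
          rw [Finset.prod_mul_distrib, Finset.prod_ite_mem, Finset.prod_ite_mem,
            Finset.univ_inter, Finset.univ_inter, Finset.prod_const, Finset.prod_const]
  have h5 : ∀ m, Even m → (5 : ZMod 8) ^ m = 1 := by
    rintro m ⟨l, rfl⟩
    rw [← two_mul, pow_mul]
    have : (5 : ZMod 8) ^ 2 = 1 := by decide
    rw [this, one_pow]
  have h5' : ∀ m, ¬ Even m → (5 : ZMod 8) ^ m = 5 := by
    intro m hm
    obtain ⟨l, rfl⟩ := Nat.not_even_iff_odd.1 hm
    rw [pow_succ, h5 _ ⟨l, by ring⟩, one_mul]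
  by_cases hT : Even T.card
  · rw [h5 _ hT, mul_one] at hdet
    refine ⟨Or.inl hdet, fun _ => hGu.trans ?_⟩
    convert congruent_diagonal_mul_five u hu T hT using 1
    rw [signForm]
    congr 1
    ext i
    have := hdec (u i) (hu i)
    simp only [hmem] at this
    rw [← this]
    simp [T]
  · rw [h5' _ hT, mul_comm] at hdet
    refine ⟨Or.inr hdet, fun h => ?_⟩
    rw [h] at hdet
    have : ∀ z : ZMod 8, z * z = 1 → z ≠ 5 * z := by decide
    refine absurd hdet (this _ ?_)
    rw [← mul_pow]
    simp

/-- Recognition of the form `signForm T` over `ℤ/8`. -/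
theorem signForm_congruent_iff_of_map_redTwo (H P : Matrix ι ι (ZMod 8)) (hH : H.IsSymm)
    (hP : (Pᵀ * H * P).map redTwo = 1) (T : Finset ι) :
    Congruent (signForm T) H ↔
      H.det = (-1) ^ T.card ∧ (negSet (Pᵀ * H * P)).card ≡ T.card [MOD 4] := by
  have hPu : IsUnit P.det := by
    have h : ((Pᵀ * H * P).map redTwo).det = 1 := by rw [hP, Matrix.det_one]
    have h2 := (isUnit_det_iff_redTwo _).2 h
    rw [Matrix.det_mul] at h2
    exact isUnit_of_mul_isUnit_right h2
  set G := Pᵀ * H * P with hGdef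
  have hHG : Congruent H G := ⟨P, hPu, rfl⟩
  have hG : G.IsSymm := by
    simp only [hGdef, Matrix.IsSymm, Matrix.transpose_mul, Matrix.transpose_transpose, hH.eq,
      Matrix.mul_assoc]
  obtain ⟨h1, h2⟩ := det_and_congruent_of_map_redTwo G hG hP
  rw [hHG.det_eq_of_zmod_eight] at h1 h2
  have hcancel : ∀ m l : ℕ, ((-1 : ZMod 8) ^ m = (-1) ^ l ∨ (-1 : ZMod 8) ^ m = 5 * (-1) ^ l) →
      (-1 : ZMod 8) ^ m = (-1) ^ l := by
    intro m l
    rcases neg_one_pow_eq_or (ZMod 8) m with h | h <;>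
      rcases neg_one_pow_eq_or (ZMod 8) l with h' | h' <;> rw [h, h'] <;> decide
  constructor
  · intro h
    have hd : H.det = (-1) ^ T.card := by rw [h.det_eq_of_zmod_eight, det_signForm]
    refine ⟨hd, ?_⟩
    have := h2 (hd.trans (hcancel _ _ (by rwa [← hd])))
    exact (modEq_of_signForm_congruent ((h.trans hHG).trans this)).symm
  · rintro ⟨hd, hw⟩
    have := h2 (hd.trans (hcancel _ _ (by rwa [← hd])))
    exact ((hHG.trans this).trans (signForm_congruent_of_modEq hw)).symm

end

end TwoAdicMass

/-! ### Symmetric bilinear forms over 𝔽₂. -/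

namespace TwoAdicMass

section

variable {ι : Type*} [Fintype ι] [DecidableEq ι]

theorem zmod_two_eq_one_of_ne_zero : ∀ z : ZMod 2, z ≠ 0 → z = 1 := by decide

theorem zmod_two_add_self : ∀ z : ZMod 2, z + z = 0 := by decide

/-- A nondegenerate symmetric bilinear form over `𝔽₂` that is not alternating has an orthonormal
basis. -/
theorem exists_orthonormal_basis_zmod_two {d : ℕ} {V : Type*} [AddCommGroup V]
    [Module (ZMod 2) V] [FiniteDimensional (ZMod 2) V] (hd : Module.finrank (ZMod 2) V = d)
    (B : V →ₗ[ZMod 2] V →ₗ[ZMod 2] ZMod 2) (hs : ∀ x y, B x y = B y x)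
    (hn : ∀ x, (∀ y, B x y = 0) → x = 0) (ha : d = 0 ∨ ∃ x, B x x = 1) :
    ∃ v : Module.Basis (Fin d) (ZMod 2) V, ∀ i j, B (v i) (v j) = if i = j then 1 else 0 := by
  induction d generalizing V with
  | zero => exact ⟨Module.finBasisOfFinrankEq _ _ hd, fun i => i.elim0⟩
  | succ d ih =>
    -- For the induction the complement of `x` must again be non-alternating or zero. If the
    -- complement of the first choice is alternating, that choice has to be modified.
    obtain ⟨x, hx, hW⟩ : ∃ x, B x x = 1 ∧ (d = 0 ∨ ∃ y, B x y = 0 ∧ B y y = 1) := by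
      obtain ⟨x, hx⟩ := ha.resolve_left (Nat.succ_ne_zero d)
      by_cases hxW : ∃ y, B x y = 0 ∧ B y y = 1
      · exact ⟨x, hx, Or.inr hxW⟩
      push Not at hxW
      by_cases hd0 : d = 0
      · exact ⟨x, hx, Or.inl hd0⟩
      have halt : ∀ y, B x y = 0 → B y y = 0 := fun y hy => by
        by_contra h
        exact hxW y hy (zmod_two_eq_one_of_ne_zero _ h)
      obtain ⟨y, hy0, hy⟩ : ∃ y, y ≠ 0 ∧ B x y = 0 := by
        by_contra h
        push Not at h
        have hker : LinearMap.ker (B x) = ⊥ := by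
          rw [LinearMap.ker_eq_bot']
          intro m hm
          by_contra hm0
          exact h m hm0 hm
        have := LinearMap.finrank_le_finrank_of_injective (LinearMap.ker_eq_bot.1 hker)
        rw [hd, Module.finrank_self] at this
        omega
      obtain ⟨z, hz⟩ : ∃ z, B y z ≠ 0 := by
        by_contra h
        push Not at h
        exact hy0 (hn y h)
      have hz1 := zmod_two_eq_one_of_ne_zero _ hz
      -- replace `z` by its projection to the complement of `x`
      obtain ⟨w, hw, hyw⟩ : ∃ w, B x w = 0 ∧ B y w = 1 := by
        refine ⟨z + B x z • x, ?_, ?_⟩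
        · rw [map_add, map_smul, hx, smul_eq_mul, mul_one, zmod_two_add_self]
        · rw [map_add, map_smul, hs y x, hy, hz1]; simp
      -- With `y`, `w` a hyperbolic pair in the alternating complement of `x`, both x + y and x + w
      -- have norm 1, and their product is 1 + B(y, w) = 0.
      refine ⟨x + y, ?_, Or.inr ⟨x + w, ?_, ?_⟩⟩
      · simp only [map_add, LinearMap.add_apply, hx, hy, hs y x, halt y hy]; simp
      · simp only [map_add, LinearMap.add_apply, hx, hw, hs y x, hy, hyw]; decide
      · simp only [map_add, LinearMap.add_apply, hx, hw, hs w x, halt w hw]; simp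
    let W := LinearMap.ker (B x)
    have hproj : ∀ z, z + B x z • x ∈ W := fun z => by
      rw [LinearMap.mem_ker, map_add, map_smul, hx, smul_eq_mul, mul_one, zmod_two_add_self]
    have hWd : Module.finrank (ZMod 2) W = d := by
      have h1 := LinearMap.finrank_range_add_finrank_ker (B x)
      have h2 : LinearMap.range (B x) = ⊤ :=
        LinearMap.range_eq_top.2 fun c => ⟨c • x, by rw [map_smul, hx]; simp⟩
      rw [h2, finrank_top, Module.finrank_self, hd] at h1
      change Module.finrank (ZMod 2) (LinearMap.ker (B x)) = d
      omega
    obtain ⟨v, hv⟩ := ih hWd (B.domRestrict₁₂ W W) (fun a b => hs _ _)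
      (fun a h => by
        refine Subtype.ext (hn _ fun y => ?_)
        have h1 := h ⟨_, hproj y⟩
        simp only [LinearMap.domRestrict₁₂_apply, map_add, map_smul] at h1
        rwa [hs a.1 x, LinearMap.mem_ker.1 a.2, smul_zero, add_zero] at h1)
      (hW.imp id fun ⟨y, h1, h2⟩ => ⟨⟨y, h1⟩, h2⟩)
    refine ⟨Module.Basis.mkFinCons x v ?_ fun z => ⟨_, hproj z⟩, ?_⟩
    · intro c y hy hc
      have := congrArg (B x) hc
      rwa [map_add, map_smul, hx, LinearMap.mem_ker.1 hy, map_zero, smul_eq_mul, mul_one,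
        add_zero] at this
    · rw [Module.Basis.coe_mkFinCons]
      intro i j
      refine Fin.cases ?_ (fun i => ?_) i <;> refine Fin.cases ?_ (fun j => ?_) j
      · simp [hx]
      · simp [(Fin.succ_ne_zero j).symm]
      · simp [Fin.succ_ne_zero, hs _ x]
      · simpa [LinearMap.domRestrict₁₂_apply] using hv i j

/-- A symmetric bilinear form over `𝔽₂` is additive on the diagonal. -/
theorem dotProduct_mulVec_self_zmod_two (E : Matrix ι ι (ZMod 2)) (hE : E.IsSymm)
    (x : ι → ZMod 2) : x ⬝ᵥ E *ᵥ x = ∑ j, x j * E j j := by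
  have hadd : ∀ x y : ι → ZMod 2, (x + y) ⬝ᵥ E *ᵥ (x + y) = x ⬝ᵥ E *ᵥ x + y ⬝ᵥ E *ᵥ y := by
    intro x y
    have hxy : y ⬝ᵥ E *ᵥ x = x ⬝ᵥ E *ᵥ y := by
      rw [Matrix.dotProduct_mulVec, ← Matrix.mulVec_transpose, hE.eq, dotProduct_comm]
    rw [Matrix.mulVec_add, add_dotProduct, dotProduct_add, dotProduct_add, hxy]
    linear_combination zmod_two_add_self (x ⬝ᵥ E *ᵥ y)
  let q : (ι → ZMod 2) →+ ZMod 2 := AddMonoidHom.mk' (fun x => x ⬝ᵥ E *ᵥ x) hadd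
  let l : (ι → ZMod 2) →+ ZMod 2 := AddMonoidHom.mk' (fun x => ∑ j, x j * E j j) (by
    intro a b; simp [add_mul, Finset.sum_add_distrib])
  have : q = l := by
    refine AddMonoidHom.functions_ext _ _ _ fun i c => ?_
    simp only [q, l, AddMonoidHom.mk'_apply]
    have hc : c * c = c := by revert c; decide
    rw [Finset.sum_eq_single i (by intro j _ hj; simp [hj]) (by simp)]
    simp only [single_dotProduct, Matrix.mulVec_single, Pi.single_eq_same]
    simp only [Matrix.col_apply, MulOpposite.smul_eq_mul_unop, Pi.smul_apply, MulOpposite.unop_op]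
    linear_combination E i i * hc
  exact DFunLike.congr_fun this x

/-- Over `𝔽₂` the trace form of two symmetric matrices only sees the diagonals. -/
theorem trace_mul_zmod_two [LinearOrder ι] (A E : Matrix ι ι (ZMod 2)) (hA : A.IsSymm)
    (hE : E.IsSymm) : (A * E).trace = ∑ j, A j j * E j j := by
  have h1 : (A * E).trace = ∑ p : ι × ι, A p.1 p.2 * E p.2 p.1 := by
    simp [Matrix.trace, Matrix.mul_apply, Fintype.sum_prod_type]
  rw [h1, ← Finset.sum_filter_add_sum_filter_not Finset.univ fun p : ι × ι => p.1 = p.2]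
  have h2 : ∑ p : ι × ι with ¬ p.1 = p.2, A p.1 p.2 * E p.2 p.1 = 0 := by
    refine Finset.sum_involution (fun p _ => p.swap) ?_ ?_ ?_ ?_
    · rintro ⟨i, j⟩ -
      simp only [Prod.swap]
      rw [hA.apply i j, hE.apply i j]
      exact zmod_two_add_self _
    · rintro ⟨i, j⟩ hp - h
      simp only [Finset.mem_filter, Finset.mem_univ, true_and] at hp
      exact hp (congrArg Prod.snd h)
    · rintro ⟨i, j⟩ hp
      simpa [eq_comm] using hp
    · rintro ⟨i, j⟩ -
      rfl
  rw [h2, add_zero]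
  refine (Finset.sum_nbij (fun j => (j, j)) ?_ ?_ ?_ ?_).symm
  · simp
  · intro a _ b _ h; exact congrArg Prod.fst h
  · rintro ⟨i, j⟩ h
    simp only [Finset.coe_filter, Finset.mem_univ, true_and, Set.mem_ofPred_eq] at h
    subst h
    exact ⟨i, by simp, rfl⟩
  · simp

/-- A symmetric matrix of odd size over `𝔽₂` with zero diagonal is singular. -/
theorem exists_diag_eq_one [LinearOrder ι] (hodd : Odd (Fintype.card ι))
    (H : Matrix ι ι (ZMod 2)) (hH : H.IsSymm) (hdet : H.det ≠ 0) : ∃ i, H i i = 1 := by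
  by_contra h0
  push Not at h0
  have h0 : ∀ i, H i i = 0 := fun i => by
    by_contra h
    exact h0 i (zmod_two_eq_one_of_ne_zero _ h)
  -- The argument det J = det Jᵀ = -det J says nothing in characteristic 2, so the matrix is lifted
  -- to an antisymmetric integer matrix, whose determinant does vanish.
  let J : Matrix ι ι ℤ := Matrix.of fun i j =>
    if i < j then ((H i j).val : ℤ) else if j < i then -((H i j).val : ℤ) else 0
  have hJt : Jᵀ = -J := by
    ext i j
    simp only [J, Matrix.transpose_apply, Matrix.of_apply, Matrix.neg_apply, hH.apply i j]
    rcases lt_trichotomy i j with h | h | h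
    · simp [h, h.not_gt]
    · subst h; simp
    · simp [h, h.not_gt]
  have hJ0 : J.det = 0 := by
    have h1 := Matrix.det_transpose J
    rw [hJt, Matrix.det_neg, hodd.neg_one_pow] at h1
    linarith
  have hJH : J.map (Int.castRingHom (ZMod 2)) = H := by
    have hv : ∀ z : ZMod 2, ((z.val : ℕ) : ZMod 2) = z := by decide
    have hneg : ∀ z : ZMod 2, -z = z := by decide
    ext i j
    simp only [J, Matrix.map_apply, Matrix.of_apply]
    rcases lt_trichotomy i j with h | h | h
    · simp [h]
    · subst h; simp [h0]
    · simp [h, h.not_gt, hneg]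
  apply hdet
  rw [← hJH, ← RingHom.mapMatrix_apply, ← RingHom.map_det, hJ0, map_zero]

end

/-- Odd size excludes the alternating case, so an orthonormal basis exists. Its vectors are the
columns of `P`. -/
theorem congruent_one_zmod_two {n : ℕ} (hodd : Odd n) (H : Matrix (Fin n) (Fin n) (ZMod 2))
    (hH : H.IsSymm) (hdet : H.det ≠ 0) :
    ∃ P : Matrix (Fin n) (Fin n) (ZMod 2), Pᵀ * H * P = 1 := by
  obtain ⟨i, hi⟩ := exists_diag_eq_one (by simpa using hodd) H hH hdet
  have happ : ∀ x y, Matrix.toBilin' H x y = x ⬝ᵥ H *ᵥ y := Matrix.toBilin'_apply' H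
  obtain ⟨v, hv⟩ := exists_orthonormal_basis_zmod_two (d := n) (V := Fin n → ZMod 2) (by simp)
    (Matrix.toBilin' H) (fun x y => by
      rw [happ, happ, Matrix.dotProduct_mulVec, ← Matrix.mulVec_transpose, hH.eq,
        dotProduct_comm])
    (fun x hx => by
      have h1 : Matrix.vecMul x H = 0 := by
        refine dotProduct_eq_zero _ fun w => ?_
        rw [← Matrix.dotProduct_mulVec, ← happ, hx]
      exact Matrix.eq_zero_of_vecMul_eq_zero hdet h1)
    (Or.inr ⟨Pi.single i 1, by rw [Matrix.toBilin'_single, hi]⟩)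
  refine ⟨Matrix.of fun i j => v j i, ?_⟩
  ext i j
  have h1 := hv i j
  rw [happ] at h1
  rw [Matrix.one_apply, ← h1, Matrix.mul_assoc, Matrix.mul_apply]
  simp [dotProduct, Matrix.mul_apply, Matrix.mulVec]

end TwoAdicMass

/-! ### Counting lifts of Hankel matrices from 𝔽₂ to ℤ/8. -/

namespace TwoAdicMass

section

variable {n : ℕ} {R : Type*}

/-- The Hankel matrix of a finite sequence. -/
def hankel (t : Fin (2 * n) → R) : Matrix (Fin n) (Fin n) R :=
  Matrix.of fun i j => t ⟨i + j, by omega⟩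

theorem hankel_isSymm (t : Fin (2 * n) → R) : (hankel t).IsSymm := by
  ext i j
  simp [hankel, add_comm]

theorem hankel_map {S : Type*} (φ : R → S) (t : Fin (2 * n) → R) :
    (hankel t).map φ = hankel (φ ∘ t) := rfl

theorem hankel_add_smul [CommRing R] (c : R) (t e : Fin (2 * n) → R) :
    hankel (t + c • e) = hankel t + c • hankel e := rfl

/-- The number of nonzero coordinates of a vector over `𝔽₂`. -/
def weight (β : Fin n → ZMod 2) : ℕ := ({i | β i = 1} : Finset (Fin n)).card

/-- The number of vectors over `𝔽₂` whose weight is `k` modulo `4`. -/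
def weightCount (n k : ℕ) : ℕ :=
  ({β | weight β ≡ k [MOD 4]} : Finset (Fin n → ZMod 2)).card

theorem card_filter_eq_of_equiv {α : Type*} [Fintype α] (e : α ≃ α) (p q : α → Prop)
    [DecidablePred p] [DecidablePred q] (h : ∀ a, p a ↔ q (e a)) :
    (Finset.univ.filter p).card = (Finset.univ.filter q).card :=
  Finset.card_equiv e fun a => by simp [h a]

theorem redTwo_two : redTwo 2 = 0 := by decide

theorem redTwo_four : redTwo 4 = 0 := by decide

theorem redTwo_comp_add_two_smul {m : ℕ} (t e : Fin m → ZMod 8) :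
    redTwo ∘ (t + (2 : ZMod 8) • e) = redTwo ∘ t := by
  ext i; simp [redTwo_two]

theorem redTwo_comp_add_four_smul {m : ℕ} (t e : Fin m → ZMod 8) :
    redTwo ∘ (t + (4 : ZMod 8) • e) = redTwo ∘ t := by
  ext i; simp [redTwo_four]

theorem card_redTwo_fibre {m : ℕ} (t' : Fin m → ZMod 2) :
    (Finset.univ.filter fun t : Fin m → ZMod 8 => redTwo ∘ t = t').card = 4 ^ m := by
  have h : (Finset.univ.filter fun t : Fin m → ZMod 8 => redTwo ∘ t = t')
      = Fintype.piFinset fun i => Finset.univ.filter fun z => redTwo z = t' i := by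
    ext t
    simp [funext_iff]
  have h4 : ∀ z : ZMod 2, (Finset.univ.filter fun y => redTwo y = z).card = 4 := by decide
  rw [h, Fintype.card_piFinset]
  simp [h4]

/-- The sequence supported on the even indices with given values modulo `2`. -/
def evenSeq (c : Fin n → ZMod 2) : Fin (2 * n) → ZMod 8 := fun m =>
  if Even (m : ℕ) then ((c ⟨m / 2, by omega⟩).val : ZMod 8) else 0

theorem redTwo_natCast_val : ∀ z : ZMod 2, redTwo (z.val : ZMod 8) = z := by decide

theorem redTwo_hankel_evenSeq (c : Fin n → ZMod 2) (j : Fin n) :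
    ((hankel (evenSeq c)).map redTwo) j j = c j := by
  have h : ((j : ℕ) + j) / 2 = j := by omega
  simp only [hankel, evenSeq, Matrix.map_apply, Matrix.of_apply, Even.add_self, if_true,
    redTwo_natCast_val, h]

/-- The classes modulo `4` of the diagonal entries in a given basis. -/
def diagBits (P : Matrix (Fin n) (Fin n) (ZMod 8)) (t : Fin (2 * n) → ZMod 8) : Fin n → ZMod 2 :=
  fun i => bitFour ((Pᵀ * hankel t * P) i i)

theorem weight_diagBits (P : Matrix (Fin n) (Fin n) (ZMod 8)) (t : Fin (2 * n) → ZMod 8) :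
    weight (diagBits P t) = (negSet (Pᵀ * hankel t * P)).card := rfl

theorem map_redTwo_diag {M : Matrix (Fin n) (Fin n) (ZMod 8)} (h : M.map redTwo = 1) (i : Fin n) :
    redTwo (M i i) = 1 := by
  have := congrFun (congrFun h i) i
  simpa using this

theorem diagBits_add_four_smul (P : Matrix (Fin n) (Fin n) (ZMod 8)) (t e : Fin (2 * n) → ZMod 8)
    (h1 : (Pᵀ * hankel t * P).map redTwo = 1) :
    diagBits P (t + (4 : ZMod 8) • e) = diagBits P t := by
  ext i
  simp only [diagBits, hankel_add_smul, Matrix.mul_add, Matrix.add_mul, Matrix.mul_smul,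
    Matrix.smul_mul, Matrix.add_apply, Matrix.smul_apply, smul_eq_mul]
  rw [bitFour_add_four_mul _ _ (map_redTwo_diag h1 i)]

/-- Modulo 2 a symmetric form takes the value ∑ x_j E_jj at x, so only the diagonal of the
perturbation counts, and for `evenSeq c` this diagonal is `c`. Since `P` is invertible modulo 2, any
shift of the bits can be realised. -/
theorem diagBits_add_evenSeq (P : Matrix (Fin n) (Fin n) (ZMod 8)) (t : Fin (2 * n) → ZMod 8)
    (c : Fin n → ZMod 2) (h1 : (Pᵀ * hankel t * P).map redTwo = 1) :
    diagBits P (t + (2 : ZMod 8) • evenSeq c) = diagBits P t + (P.map redTwo)ᵀ *ᵥ c := by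
  ext i
  simp only [diagBits, hankel_add_smul, Matrix.mul_add, Matrix.add_mul, Matrix.mul_smul,
    Matrix.smul_mul, Matrix.add_apply, Matrix.smul_apply, smul_eq_mul, Pi.add_apply]
  rw [bitFour_add_two_mul _ _ (map_redTwo_diag h1 i)]
  congr 1
  have h2 := dotProduct_mulVec_self_zmod_two ((hankel (evenSeq c)).map redTwo)
    (by rw [hankel_map]; exact hankel_isSymm _) (fun j => redTwo (P j i))
  simp only [redTwo_hankel_evenSeq] at h2
  have h3 : redTwo ((Pᵀ * hankel (evenSeq c) * P) i i)
      = (fun j => redTwo (P j i)) ⬝ᵥ ((hankel (evenSeq c)).map redTwo) *ᵥ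
        (fun j => redTwo (P j i)) := by
    rw [Matrix.mul_assoc]
    simp [Matrix.mul_apply, dotProduct, Matrix.mulVec, map_sum]
  rw [h3, h2]
  simp [Matrix.mulVec, dotProduct]

/-- As 16 = 0, det(H + 4E) = det H · (1 + 4 tr(H⁻¹E)). The trace modulo 2 only pairs the diagonals,
so here it is the entry (H⁻¹)_jj = 1. -/
theorem det_hankel_add_four_smul (hH : Fin (2 * n) → ZMod 8) (j : Fin n)
    (hdet : IsUnit (hankel hH).det) (hj : ((hankel hH).map redTwo)⁻¹ j j = 1) :
    (hankel (hH + (4 : ZMod 8) • evenSeq (Pi.single j 1))).det = 5 * (hankel hH).det := by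
  set H := hankel hH
  set E := hankel (evenSeq (Pi.single j 1))
  have hmul : H * (1 + (4 : ZMod 8) • (H⁻¹ * E)) = H + (4 : ZMod 8) • E := by
    rw [Matrix.mul_add, Matrix.mul_one, Matrix.mul_smul, ← Matrix.mul_assoc,
      Matrix.mul_nonsing_inv _ hdet, Matrix.one_mul]
  have htr : redTwo (H⁻¹ * E).trace = 1 := by
    have hinv : H⁻¹.map redTwo = (H.map redTwo)⁻¹ := by
      refine (Matrix.inv_eq_left_inv ?_).symm
      rw [← Matrix.map_mul, Matrix.nonsing_inv_mul _ hdet]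
      simp
    have hHs : (H.map redTwo).IsSymm := hankel_isSymm (redTwo ∘ hH)
    have hEs : (E.map redTwo).IsSymm := hankel_isSymm (redTwo ∘ evenSeq (Pi.single j 1))
    rw [AddMonoidHom.map_trace redTwo, Matrix.map_mul, hinv, trace_mul_zmod_two _ _
      (by rw [Matrix.IsSymm, Matrix.transpose_nonsing_inv, hHs.eq])
      hEs]
    have : ∀ i, (E.map redTwo) i i = (Pi.single j 1 : Fin n → ZMod 2) i :=
      redTwo_hankel_evenSeq _
    simp only [this]
    rw [Finset.sum_eq_single j (by intro b _ hb; simp [hb]) (by simp)]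
    simp [hj]
  have h16 : (4 : ZMod 8) ^ 2 = 0 := by decide
  have h5 : ∀ z : ZMod 8, redTwo z = 1 → 1 + z * 4 = 5 := by decide
  rw [hankel_add_smul, ← hmul, Matrix.det_mul, Matrix.det_one_add_smul, h16, mul_zero, add_zero,
    h5 _ htr, mul_comm]

/-- The number of lifts to `ℤ/8` of a nonsingular Hankel matrix over `𝔽₂` that lie in the
isomorphism class of `signForm T`. -/
theorem card_hankel_congruent_signForm (hodd : Odd n) (t' : Fin (2 * n) → ZMod 2)
    (hdet' : (hankel t').det ≠ 0) (T : Finset (Fin n)) [DecidablePred fun t : Fin (2 * n) → ZMod 8 =>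
      redTwo ∘ t = t' ∧ Congruent (signForm T) (hankel t)] :
    2 * 2 ^ n * (Finset.univ.filter fun t : Fin (2 * n) → ZMod 8 =>
      redTwo ∘ t = t' ∧ Congruent (signForm T) (hankel t)).card
      = 4 ^ (2 * n) * weightCount n T.card := by
  obtain ⟨P', hP'⟩ := congruent_one_zmod_two hodd _ (hankel_isSymm t') hdet'
  let P : Matrix (Fin n) (Fin n) (ZMod 8) := P'.map fun z => (z.val : ZMod 8)
  have hPP : P.map redTwo = P' := by
    ext i j; simp only [P, Matrix.map_apply, redTwo_natCast_val]
  have hPt : Pᵀ.map redTwo = P'ᵀ := by rw [← hPP]; rfl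
  have hred : ∀ t : Fin (2 * n) → ZMod 8, redTwo ∘ t = t' → (hankel t).map redTwo = hankel t' :=
    fun t ht => by rw [hankel_map, ht]
  have hP : ∀ t : Fin (2 * n) → ZMod 8, redTwo ∘ t = t' →
      (Pᵀ * hankel t * P).map redTwo = 1 := fun t ht => by
    rw [Matrix.map_mul, Matrix.map_mul, hPt, hPP, hred t ht, hP']
  have hunit : ∀ t : Fin (2 * n) → ZMod 8, redTwo ∘ t = t' → IsUnit (hankel t).det := fun t ht => by
    rw [isUnit_det_iff_redTwo, hred t ht]
    exact zmod_two_eq_one_of_ne_zero _ hdet'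
  -- all fibres of `diagBits` have the same size
  let N : (Fin n → ZMod 2) → ℕ := fun β =>
    (Finset.univ.filter fun t : Fin (2 * n) → ZMod 8 => redTwo ∘ t = t' ∧ diagBits P t = β).card
  have hN : ∀ β γ, N β = N γ := fun β γ => by
    -- P'ᵀ H P' = 1 makes H P' a right inverse of P'ᵀ, so this `c` produces exactly the shift from β
    -- to γ.
    let c := (hankel t' * P') *ᵥ (γ - β)
    have hc : P'ᵀ *ᵥ c = γ - β := by
      rw [Matrix.mulVec_mulVec, ← Matrix.mul_assoc, hP', Matrix.one_mulVec]
    refine card_filter_eq_of_equiv (Equiv.addRight ((2 : ZMod 8) • evenSeq c)) _ _ fun t => ?_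
    simp only [Equiv.coe_addRight, redTwo_comp_add_two_smul]
    refine and_congr_right fun ht => ?_
    rw [diagBits_add_evenSeq _ _ _ (hP t ht), hPP, hc]
    constructor
    · rintro rfl; simp
    · intro h
      have := congrArg (· - (γ - β)) h
      simpa using this
  have hNsum : ∀ β, 2 ^ n * N β = 4 ^ (2 * n) := fun β => by
    rw [← card_redTwo_fibre t', Finset.card_eq_sum_card_fiberwise (f := diagBits P)
      (t := Finset.univ) (by simp)]
    simp only [Finset.filter_filter]
    rw [Finset.sum_congr rfl fun γ _ => hN γ β]
    simp [ZMod.card]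
  -- half of each relevant fibre has the right determinant
  obtain ⟨j, hj⟩ := exists_diag_eq_one (by simpa using hodd) (hankel t')⁻¹
    (by rw [Matrix.IsSymm, Matrix.transpose_nonsing_inv, (hankel_isSymm t').eq])
    (by
      have := Matrix.isUnit_nonsing_inv_det (hankel t') (isUnit_iff_ne_zero.2 hdet')
      exact this.ne_zero)
  let M : ZMod 8 → (Fin n → ZMod 2) → ℕ := fun d β =>
    (Finset.univ.filter fun t : Fin (2 * n) → ZMod 8 =>
      (redTwo ∘ t = t' ∧ diagBits P t = β) ∧ (hankel t).det = d).card
  have h55 : ∀ d z : ZMod 8, z = d ↔ 5 * z = 5 * d := by decide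
  have hM : ∀ β d, M d β = M (5 * d) β := fun β d => by
    refine card_filter_eq_of_equiv
      (Equiv.addRight ((4 : ZMod 8) • evenSeq (Pi.single j 1))) _ _ fun t => ?_
    simp only [Equiv.coe_addRight, redTwo_comp_add_four_smul, and_assoc]
    refine and_congr_right fun ht => ?_
    rw [diagBits_add_four_smul _ _ _ (hP t ht), det_hankel_add_four_smul _ _ (hunit t ht)
      (by rw [hred t ht]; exact hj), ← h55]
  have hMN : ∀ β, weight β ≡ T.card [MOD 4] → 2 * M ((-1) ^ T.card) β = N β := fun β hβ => by
    have hpow : (-1 : ZMod 8) ^ weight β = (-1) ^ T.card := by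
      rw [neg_one_pow_eq_pow_mod_two, neg_one_pow_eq_pow_mod_two (n := T.card)]
      congr 1
      unfold Nat.ModEq at hβ
      omega
    have hne : (-1 : ZMod 8) ^ T.card ≠ 5 * (-1) ^ T.card := by
      rcases neg_one_pow_eq_or (ZMod 8) T.card with h | h <;> rw [h] <;> decide
    -- The bits fix the determinant up to the factor 5, and adding 4 times a suitable `evenSeq`
    -- exchanges the two possible values. Each therefore occurs for half of the fibre.
    have hdet : ∀ t : Fin (2 * n) → ZMod 8, redTwo ∘ t = t' → diagBits P t = β →
        ((hankel t).det ≠ (-1) ^ T.card ↔ (hankel t).det = 5 * (-1) ^ T.card) := by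
      intro t ht hb
      have hs : (Pᵀ * hankel t * P).IsSymm := by
        simp only [Matrix.IsSymm, Matrix.transpose_mul, Matrix.transpose_transpose,
          (hankel_isSymm t).eq, Matrix.mul_assoc]
      have hPu : IsUnit P.det := by
        have h2 := (isUnit_det_iff_redTwo (Pᵀ * hankel t * P)).2
          (by rw [hP t ht, Matrix.det_one])
        rw [Matrix.det_mul] at h2
        exact isUnit_of_mul_isUnit_right h2
      have h1 := (det_and_congruent_of_map_redTwo _ hs (hP t ht)).1
      rw [← weight_diagBits, hb, hpow, Congruent.det_eq_of_zmod_eight ⟨P, hPu, rfl⟩] at h1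
      constructor
      · exact fun h => h1.resolve_left h
      · intro h h'; exact hne (h'.symm.trans h)
    rw [two_mul]
    conv_lhs => rw [hM β ((-1) ^ T.card)]
    rw [← hM β]
    nth_rewrite 2 [hM β]
    simp only [M, N]
    rw [← Finset.card_filter_add_card_filter_not (s := Finset.univ.filter
      fun t : Fin (2 * n) → ZMod 8 => redTwo ∘ t = t' ∧ diagBits P t = β)
      (fun t => (hankel t).det = (-1) ^ T.card), Finset.filter_filter, Finset.filter_filter]
    congr 2
    refine Finset.filter_congr fun t _ => ?_
    constructor
    · rintro ⟨⟨h1, h2⟩, h3⟩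
      exact ⟨⟨h1, h2⟩, (hdet t h1 h2).2 h3⟩
    · rintro ⟨⟨h1, h2⟩, h3⟩
      exact ⟨⟨h1, h2⟩, (hdet t h1 h2).1 h3⟩
  -- sum over the fibres
  have hsum : (Finset.univ.filter fun t : Fin (2 * n) → ZMod 8 =>
      redTwo ∘ t = t' ∧ Congruent (signForm T) (hankel t)).card
      = ∑ β with weight β ≡ T.card [MOD 4], M ((-1) ^ T.card) β := by
    rw [Finset.card_eq_sum_card_fiberwise (f := diagBits P)
      (t := Finset.univ.filter fun β => weight β ≡ T.card [MOD 4])]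
    · refine Finset.sum_congr rfl fun β hβ => ?_
      rw [Finset.filter_filter]
      congr 1
      refine Finset.filter_congr fun t _ => ?_
      constructor
      · rintro ⟨⟨h1, h2⟩, h3⟩
        exact ⟨⟨h1, h3⟩,
          ((signForm_congruent_iff_of_map_redTwo _ P (hankel_isSymm t) (hP t h1) T).1 h2).1⟩
      · rintro ⟨⟨h1, h2⟩, h3⟩
        refine ⟨⟨h1, (signForm_congruent_iff_of_map_redTwo _ P (hankel_isSymm t) (hP t h1) T).2
          ⟨h3, ?_⟩⟩, h2⟩
        rw [← weight_diagBits, h2]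
        exact (Finset.mem_filter.1 hβ).2
    · intro t ht
      obtain ⟨-, h1, h2⟩ := Finset.mem_filter.1 ht
      exact Finset.mem_filter.2 ⟨Finset.mem_univ _,
        ((signForm_congruent_iff_of_map_redTwo _ P (hankel_isSymm t) (hP t h1) T).1 h2).2⟩
  have hterm : ∀ β ∈ Finset.univ.filter fun β : Fin n → ZMod 2 => weight β ≡ T.card [MOD 4],
      2 * 2 ^ n * M ((-1) ^ T.card) β = 4 ^ (2 * n) := fun β hβ => by
    rw [← hNsum β, ← hMN β (Finset.mem_filter.1 hβ).2]
    ring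
  rw [hsum, Finset.mul_sum, Finset.sum_congr rfl hterm, Finset.sum_const, smul_eq_mul, mul_comm]
  rfl

end

end TwoAdicMass

/-! ### Linear recurrences: polynomials with a functional as Hankel sequences. -/

namespace TwoAdicMass

section

variable {n : ℕ} {R S : Type*} [CommRing R] [CommRing S]

/-- The sequence with initial values `s` annihilated by the monic polynomial
`x ^ n + ∑ i, a i x ^ i`. -/
def recSeq (a s : Fin n → R) : ℕ → R :=
  LinearRecurrence.mkSol (LinearRecurrence.mk n fun i => -a i) s

theorem recSeq_coe (a s : Fin n → R) (i : Fin n) : recSeq a s i = s i :=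
  LinearRecurrence.mkSol_eq_init (LinearRecurrence.mk n fun i => -a i) s i

theorem recSeq_add (a s : Fin n → R) (m : ℕ) :
    recSeq a s (m + n) = ∑ i, -a i * recSeq a s (m + i) :=
  LinearRecurrence.is_sol_mkSol (LinearRecurrence.mk n fun i => -a i) s m

theorem eq_recSeq {a s : Fin n → R} {u : ℕ → R} (h : ∀ m, u (m + n) = ∑ i, -a i * u (m + i))
    (h0 : ∀ i : Fin n, u i = s i) (m : ℕ) : u m = recSeq a s m :=
  LinearRecurrence.eq_mk_of_is_sol_of_eq_init (LinearRecurrence.mk n fun i => -a i) h h0 m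

theorem map_recSeq (φ : R →+* S) (a s : Fin n → R) (m : ℕ) :
    φ (recSeq a s m) = recSeq (φ ∘ a) (φ ∘ s) m := by
  refine eq_recSeq (u := fun m => φ (recSeq a s m)) (fun m => ?_) (fun i => ?_) m
  · simp [recSeq_add]
  · simp [recSeq_coe]

/-- The Gram matrix of the linear functional with values `s` on the powers of `x`, on the algebra
of the polynomial `x ^ n + ∑ i, a i x ^ i`. -/
def recGram (a s : Fin n → R) : Matrix (Fin n) (Fin n) R :=
  hankel fun m => recSeq a s m

theorem recGram_map (φ : R →+* S) (a s : Fin n → R) :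
    (recGram a s).map φ = recGram (φ ∘ a) (φ ∘ s) := by
  ext i j
  simp [recGram, hankel, map_recSeq]

/-- Read as a linear system for `a`, this recovers the polynomial from the first 2n terms of the
sequence whenever the Gram matrix is invertible. -/
theorem recGram_mulVec (a s : Fin n → R) (m : Fin n) :
    (recGram a s *ᵥ a) m = -recSeq a s (m + n) := by
  simp only [recSeq_add, Matrix.mulVec, dotProduct, recGram, hankel, Matrix.of_apply]
  simp [mul_comm]

end

section

variable {n : ℕ}

open Classical in
/-- The functionals with nonsingular Gram matrix over `𝔽₂`. -/
noncomputable def nonsingularTwo (a : Fin n → ZMod 2) : Finset (Fin n → ZMod 2) :=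
  Finset.univ.filter fun s => (recGram a s).det ≠ 0

open Classical in
/-- The functionals with unimodular Gram matrix over `ℤ/8`. -/
noncomputable def unimodularEight (a : Fin n → ZMod 8) : Finset (Fin n → ZMod 8) :=
  Finset.univ.filter fun s => IsUnit (recGram a s).det

open Classical in
/-- The functionals over `ℤ/8` whose Gram matrix lies in the class of `A`. -/
noncomputable def gramClass (A : Matrix (Fin n) (Fin n) (ZMod 8)) (a : Fin n → ZMod 8) :
    Finset (Fin n → ZMod 8) :=
  Finset.univ.filter fun s => Congruent A (recGram a s)

theorem det_recGram_redTwo (a s : Fin n → ZMod 8) :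
    (recGram (redTwo ∘ a) (redTwo ∘ s)).det = redTwo (recGram a s).det := by
  rw [← recGram_map, RingHom.map_det, RingHom.mapMatrix_apply]

theorem isUnit_det_recGram_iff (a s : Fin n → ZMod 8) :
    IsUnit (recGram a s).det ↔ redTwo ∘ s ∈ nonsingularTwo (redTwo ∘ a) := by
  simp only [nonsingularTwo, Finset.mem_filter, Finset.mem_univ, true_and, det_recGram_redTwo,
    isUnit_iff_redTwo]
  exact ⟨fun h => by rw [h]; decide, zmod_two_eq_one_of_ne_zero _⟩

/-- Unimodularity is a condition modulo 2. The count thus depends on the polynomial only modulo 2,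
so the denominator of the mass is constant on residue classes. -/
theorem card_unimodularEight (a : Fin n → ZMod 8) :
    (unimodularEight a).card = 4 ^ n * (nonsingularTwo (redTwo ∘ a)).card := by
  classical
  rw [Finset.card_eq_sum_card_fiberwise (f := fun s => redTwo ∘ s)
    (t := nonsingularTwo (redTwo ∘ a))]
  · rw [Finset.sum_congr rfl (g := fun _ => 4 ^ n), Finset.sum_const, smul_eq_mul, mul_comm]
    intro s' hs'
    rw [← card_redTwo_fibre s']
    congr 1
    ext s
    simp only [unimodularEight, Finset.mem_filter, Finset.mem_univ, true_and,
      isUnit_det_recGram_iff]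
    exact ⟨And.right, fun h => ⟨h ▸ hs', h⟩⟩
  · intro s hs
    simp only [unimodularEight, Finset.coe_filter, Finset.mem_univ, true_and,
      Set.mem_ofPred_eq] at hs
    exact (isUnit_det_recGram_iff a s).1 hs

open Classical in
/-- Counting pairs of a polynomial and a functional amounts to counting Hankel matrices. -/
theorem card_pairs_eq_card_hankel (a' s' : Fin n → ZMod 2) (hdet : (recGram a' s').det ≠ 0)
    (p : Matrix (Fin n) (Fin n) (ZMod 8) → Prop) :
    (Finset.univ.filter fun x : (Fin n → ZMod 8) × (Fin n → ZMod 8) =>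
      (redTwo ∘ x.1 = a' ∧ redTwo ∘ x.2 = s') ∧ p (recGram x.1 x.2)).card
      = (Finset.univ.filter fun t : Fin (2 * n) → ZMod 8 =>
        (redTwo ∘ t = fun m : Fin (2 * n) => recSeq a' s' m) ∧ p (hankel t)).card := by
  let Ψ : (Fin n → ZMod 8) × (Fin n → ZMod 8) → Fin (2 * n) → ZMod 8 :=
    fun x m => recSeq x.1 x.2 m
  let X := Finset.univ.filter fun x : (Fin n → ZMod 8) × (Fin n → ZMod 8) =>
    redTwo ∘ x.1 = a' ∧ redTwo ∘ x.2 = s'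
  let Y := Finset.univ.filter fun t : Fin (2 * n) → ZMod 8 =>
    redTwo ∘ t = fun m : Fin (2 * n) => recSeq a' s' m
  -- The first n terms give `s`. The term of index 2n - 1 does not occur in the Hankel matrix, but
  -- it enters the last equation of the system for `a`.
  have hinj : Set.InjOn Ψ X := by
    rintro ⟨a, s⟩ hx ⟨b, r⟩ hy h
    simp only [X, Finset.coe_filter, Finset.mem_univ, true_and, Set.mem_ofPred_eq] at hx hy
    have hm : ∀ m < 2 * n, recSeq a s m = recSeq b r m := fun m hm => congrFun h ⟨m, hm⟩
    have hsr : s = r := by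
      ext i
      rw [← recSeq_coe a s i, ← recSeq_coe b r i, hm i (by omega)]
    have hG : recGram a s = recGram b r := congrArg hankel h
    have hu : IsUnit (recGram a s).det := by
      rw [isUnit_det_recGram_iff, hx.1, hx.2]
      simpa [nonsingularTwo] using hdet
    have hv : recGram a s *ᵥ a = recGram a s *ᵥ b := by
      conv_rhs => rw [hG]
      ext m
      rw [recGram_mulVec, recGram_mulVec, hm _ (by omega)]
    have hab := Matrix.mulVec_injective_of_isUnit ((Matrix.isUnit_iff_isUnit_det _).2 hu) hv
    rw [hab, hsr]
  have hmaps : ∀ x ∈ X, Ψ x ∈ Y := by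
    rintro ⟨a, s⟩ hx
    simp only [X, Y, Finset.mem_filter, Finset.mem_univ, true_and] at hx ⊢
    ext m
    simp only [Ψ, Function.comp_apply, map_recSeq, ← hx.1, ← hx.2]
  have hX : X.card = 4 ^ (2 * n) := by
    have : X = (Finset.univ.filter fun a : Fin n → ZMod 8 => redTwo ∘ a = a') ×ˢ
        (Finset.univ.filter fun a : Fin n → ZMod 8 => redTwo ∘ a = s') := by
      ext; simp [X]
    rw [this, Finset.card_product, card_redTwo_fibre, card_redTwo_fibre]
    ring
  have hY : Y.card = 4 ^ (2 * n) := card_redTwo_fibre _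
  -- Surjectivity comes from counting: both sides have 4^(2n) elements.
  have himg : X.image Ψ = Y := by
    refine Finset.eq_of_subset_of_card_le (Finset.image_subset_iff.2 hmaps) ?_
    rw [Finset.card_image_of_injOn hinj, hX, hY]
  have h1 : ∀ q : Matrix (Fin n) (Fin n) (ZMod 8) → Prop,
      ((X.filter fun x => q (recGram x.1 x.2)).image Ψ) = Y.filter fun t => q (hankel t) := by
    intro q
    rw [← himg, Finset.filter_image]
    rfl
  have h2 := congrArg Finset.card (h1 p)
  rw [Finset.card_image_of_injOn (hinj.mono fun x hx => (Finset.mem_filter.1 hx).1)] at h2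
  simpa only [X, Y, Finset.filter_filter] using h2

/-- The total number of functionals in a given class, over all polynomials over `ℤ/8` in a residue
class modulo `2`. -/
theorem sum_card_gramClass (hodd : Odd n) (T : Finset (Fin n)) (a' : Fin n → ZMod 2) :
    2 * 2 ^ n * ∑ a with redTwo ∘ a = a', (gramClass (signForm T) a).card
      = 4 ^ (2 * n) * weightCount n T.card * (nonsingularTwo a').card := by
  classical
  have h1 : ∑ a with redTwo ∘ a = a', (gramClass (signForm T) a).card
      = (Finset.univ.filter fun x : (Fin n → ZMod 8) × (Fin n → ZMod 8) =>
        redTwo ∘ x.1 = a' ∧ Congruent (signForm T) (recGram x.1 x.2)).card := by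
    rw [Finset.card_eq_sum_card_fiberwise (f := Prod.fst)
      (t := Finset.univ.filter fun a : Fin n → ZMod 8 => redTwo ∘ a = a')]
    · refine Finset.sum_congr rfl fun a ha => ?_
      refine Finset.card_bij (fun s _ => (a, s)) ?_ ?_ ?_
      · intro s hs
        simp only [gramClass, Finset.mem_filter, Finset.mem_univ, true_and] at hs ha ⊢
        exact ⟨⟨ha, hs⟩, trivial⟩
      · intro s _ r _ h; exact congrArg Prod.snd h
      · rintro ⟨b, s⟩ h
        simp only [gramClass, Finset.mem_filter, Finset.mem_univ, true_and] at h ⊢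
        obtain ⟨⟨-, h2⟩, rfl⟩ := h
        exact ⟨s, h2, rfl⟩
    · rintro ⟨a, s⟩ h
      simp only [Finset.coe_filter, Finset.mem_univ, true_and, Set.mem_ofPred_eq] at h ⊢
      exact h.1
  have h2 : ∀ s' ∈ nonsingularTwo a', 2 * 2 ^ n *
      (Finset.univ.filter fun x : (Fin n → ZMod 8) × (Fin n → ZMod 8) =>
      (redTwo ∘ x.1 = a' ∧ redTwo ∘ x.2 = s') ∧ Congruent (signForm T) (recGram x.1 x.2)).card
      = 4 ^ (2 * n) * weightCount n T.card := by
    intro s' hs'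
    have hdet : (recGram a' s').det ≠ 0 := by simpa [nonsingularTwo] using hs'
    rw [card_pairs_eq_card_hankel a' s' hdet]
    exact card_hankel_congruent_signForm hodd _ hdet T
  rw [h1, Finset.card_eq_sum_card_fiberwise (f := fun x => redTwo ∘ x.2)
    (t := nonsingularTwo a'), Finset.mul_sum]
  · rw [Finset.sum_congr rfl (g := fun _ => 4 ^ (2 * n) * weightCount n T.card), Finset.sum_const,
      smul_eq_mul, mul_comm]
    intro s' hs'
    rw [← h2 s' hs', Finset.filter_filter]
    congr 2
    refine Finset.filter_congr fun x _ => ?_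
    tauto
  · rintro ⟨a, s⟩ h
    simp only [Finset.coe_filter, Finset.mem_univ, true_and, Set.mem_ofPred_eq] at h
    obtain ⟨rfl, h⟩ := h
    refine (isUnit_det_recGram_iff a s).1 ?_
    rw [h.det_eq_of_zmod_eight, det_signForm]
    exact (isUnit_one.neg).pow _

end

end TwoAdicMass

/-! ### Passage from ℤ_2 to ℤ/8. -/

namespace TwoAdicMass

/-- Reduction from `ℤ_2` to `ℤ/8`. -/
noncomputable def redEight : ℤ_[2] →+* ZMod 8 := PadicInt.toZModPow 3

theorem redEight_surjective : Function.Surjective redEight := ZMod.ringHom_surjective redEight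

theorem redEight_eq_zero_iff (z : ℤ_[2]) : redEight z = 0 ↔ ∃ y, z = 8 * y := by
  have h := PadicInt.ker_toZModPow (p := 2) 3
  have h2 : z ∈ RingHom.ker (PadicInt.toZModPow (p := 2) 3) ↔ z ∈ Ideal.span {((2 : ℕ) : ℤ_[2]) ^ 3} := by
    rw [h]
  rw [RingHom.mem_ker, Ideal.mem_span_singleton] at h2
  have h8 : ((2 : ℕ) : ℤ_[2]) ^ 3 = 8 := by norm_num
  rw [h8] at h2
  exact h2

theorem redEight_eq_iff (z w : ℤ_[2]) : redEight z = redEight w ↔ ∃ y, z - w = 8 * y := by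
  rw [← redEight_eq_zero_iff, map_sub, sub_eq_zero]

theorem isUnit_redEight_iff (z : ℤ_[2]) : IsUnit (redEight z) ↔ IsUnit z := by
  have : Nontrivial (ZMod 8) := ⟨0, 1, by decide⟩
  have : IsLocalHom redEight := IsLocalHom.of_surjective _ redEight_surjective
  exact isUnit_map_iff redEight z

theorem isUnit_det_redEight_iff {ι : Type*} [Fintype ι] [DecidableEq ι] (K : Matrix ι ι ℤ_[2]) :
    IsUnit (K.map redEight).det ↔ IsUnit K.det := by
  rw [← isUnit_redEight_iff, RingHom.map_det, RingHom.mapMatrix_apply]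

/-- In a finite free commutative `ℤ_2`-algebra, `1 + 8 r` is the square of some `1 + 4 z`. -/
theorem exists_add_two_mul_sq {n : ℕ} {R : Type*} [CommRing R] [Algebra ℤ_[2] R]
    (b : Module.Basis (Fin n) ℤ_[2] R) (r : R) : ∃ z : R, z + 2 * z ^ 2 = r := by
  let g : (Fin n → ℤ_[2]) ≃ₗ[ℤ_[2]] R := b.equivFun.symm
  -- Linear maps over ℤ_2 do not increase the sup norm. Since y² - w² = (y + w)(y - w), the map y ↦
  -- r - 2y² is then a contraction with constant 1/2, and its fixed point is the required element.
  have hlin : ∀ (L : (Fin n → ℤ_[2]) →ₗ[ℤ_[2]] (Fin n → ℤ_[2])) (v : Fin n → ℤ_[2]),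
      ‖L v‖ ≤ ‖v‖ := by
    intro L v
    rw [pi_norm_le_iff_of_nonneg (norm_nonneg _)]
    intro i
    rw [LinearMap.pi_apply_eq_sum_univ L v, Finset.sum_apply]
    refine IsUltrametricDist.norm_sum_le_of_forall_le_of_nonneg (norm_nonneg _) fun j _ => ?_
    rw [Pi.smul_apply, smul_eq_mul, norm_mul]
    calc ‖v j‖ * _ ≤ ‖v j‖ * 1 := by gcongr; exact PadicInt.norm_le_one _
      _ ≤ ‖v‖ := by rw [mul_one]; exact norm_le_pi_norm v j
  have h2 : ‖(2 : ℤ_[2])‖ = 2⁻¹ := by simpa using PadicInt.norm_p (p := 2)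
  let F : (Fin n → ℤ_[2]) → (Fin n → ℤ_[2]) := fun y => g.symm (r - 2 * (g y) ^ 2)
  have hF : ContractingWith (2⁻¹ : NNReal) F := by
    refine ⟨by rw [← NNReal.coe_lt_coe]; norm_num, LipschitzWith.of_dist_le_mul fun y w => ?_⟩
    let L : (Fin n → ℤ_[2]) →ₗ[ℤ_[2]] (Fin n → ℤ_[2]) :=
      g.symm.toLinearMap ∘ₗ LinearMap.mulLeft ℤ_[2] (-(g y + g w)) ∘ₗ g.toLinearMap
    have hd : F y - F w = (2 : ℤ_[2]) • L (y - w) := by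
      simp only [F, L, ← map_sub, LinearMap.comp_apply, LinearEquiv.coe_coe,
        LinearMap.mulLeft_apply, ← map_smul]
      congr 1
      rw [map_sub, Algebra.smul_def, map_ofNat]
      ring
    rw [dist_eq_norm, dist_eq_norm, hd]
    rw [pi_norm_le_iff_of_nonneg (by positivity)]
    intro i
    rw [Pi.smul_apply, smul_eq_mul, norm_mul, h2]
    have := (norm_le_pi_norm (L (y - w)) i).trans (hlin L (y - w))
    push_cast
    gcongr
  refine ⟨g (ContractingWith.fixedPoint F hF), ?_⟩
  have h := congrArg g (ContractingWith.fixedPoint_isFixedPt hF)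
  simp only [F, LinearEquiv.apply_symm_apply] at h
  nth_rewrite 1 [← h]
  ring

/-- The powers of the root as a basis of `AdjoinRoot f` indexed by `Fin n`. -/
theorem exists_basis_adjoinRoot {n : ℕ} {f : Polynomial ℤ_[2]} (hf : f.Monic)
    (hn : f.natDegree = n) :
    ∃ b : Module.Basis (Fin n) ℤ_[2] (AdjoinRoot f), ∀ i, b i = AdjoinRoot.root f ^ (i : ℕ) := by
  have hd : (AdjoinRoot.powerBasis' hf).dim = n := hn
  refine ⟨(AdjoinRoot.powerBasis' hf).basis.reindex (finCongr hd), fun i => ?_⟩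
  rw [Module.Basis.reindex_apply, PowerBasis.basis_eq_pow]
  rfl

theorem aeval_transpose_mul {ι : Type*} [Fintype ι] [DecidableEq ι] {A E : Matrix ι ι ℤ_[2]}
    (h : Eᵀ * A = A * E) (p : Polynomial ℤ_[2]) :
    (Polynomial.aeval E p)ᵀ * A = A * Polynomial.aeval E p := by
  induction p using Polynomial.induction_on' with
  | add p q hp hq =>
    rw [map_add, Matrix.transpose_add, Matrix.add_mul, hp, hq, Matrix.mul_add]
  | monomial k c =>
    have hk : (Eᵀ) ^ k * A = A * E ^ k := by
      induction k with
      | zero => simp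
      | succ k ih =>
        rw [pow_succ, Matrix.mul_assoc, h, ← Matrix.mul_assoc, ih, Matrix.mul_assoc, ← pow_succ]
    rw [Polynomial.aeval_monomial, ← Algebra.smul_def, Matrix.transpose_smul,
      Matrix.transpose_pow, Matrix.smul_mul, hk, Matrix.mul_smul]

/-- Congruence of unimodular symmetric matrices over `ℤ_2` can be tested modulo `8`. -/
theorem congruent_iff_map_redEight {n : ℕ} (A H : Matrix (Fin n) (Fin n) ℤ_[2])
    (hA : A.IsSymm) (hH : H.IsSymm) (hAu : IsUnit A.det) :
    Congruent A H ↔ Congruent (A.map redEight) (H.map redEight) := by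
  refine ⟨fun h => h.map redEight, ?_⟩
  rintro ⟨K', hK', hKH⟩
  obtain ⟨K, rfl⟩ : ∃ K : Matrix (Fin n) (Fin n) ℤ_[2], K.map redEight = K' := by
    choose K hK using fun i j => redEight_surjective (K' i j)
    exact ⟨Matrix.of K, by ext i j; simp [hK]⟩
  rw [isUnit_det_redEight_iff] at hK'
  set B := Kᵀ * A * K with hB
  have hAB : Congruent A B := ⟨K, hK', rfl⟩
  refine hAB.trans ?_
  have hBu : IsUnit B.det := by
    rw [hB, Matrix.det_mul, Matrix.det_mul, Matrix.det_transpose]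
    exact (hK'.mul hAu).mul hK'
  have hBs : B.IsSymm := by
    simp only [hB, Matrix.IsSymm, Matrix.transpose_mul, Matrix.transpose_transpose, hA.eq,
      Matrix.mul_assoc]
  obtain ⟨E, hE⟩ : ∃ E : Matrix (Fin n) (Fin n) ℤ_[2], H = B + (8 : ℤ_[2]) • E := by
    have : ∀ i j, ∃ y, H i j - B i j = 8 * y := fun i j => by
      rw [← redEight_eq_iff]
      have := congrFun (congrFun hKH i) j
      rw [← Matrix.transpose_map, ← Matrix.map_mul, ← Matrix.map_mul, ← hB] at this
      exact this.symm
    choose E hE using this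
    exact ⟨Matrix.of E, by ext i j; simp [← hE]⟩
  have hEs : E.IsSymm := by
    have h8 : (8 : ℤ_[2]) ≠ 0 := by norm_num
    have : (8 : ℤ_[2]) • E = H - B := by rw [hE]; simp
    ext i j
    have h1 := congrFun (congrFun this j) i
    have h2 := congrFun (congrFun this i) j
    simp only [Matrix.smul_apply, Matrix.sub_apply, smul_eq_mul] at h1 h2
    rw [hH.apply i j, hBs.apply i j, ← h2] at h1
    exact mul_left_cancel₀ h8 h1
  -- Now H = B(1 + 8M) with `M` self-adjoint for `B`. A root of Z + 2Z² = M that is a polynomial in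
  -- `M` is self-adjoint too, so (1 + 4Z)ᵀB(1 + 4Z) = B(1 + 4Z)² = H. The root is found in the
  -- commutative algebra ℤ_2[x]/(charpoly M).
  set M := B⁻¹ * E with hM
  have hBM : B * M = E := by rw [hM, ← Matrix.mul_assoc, Matrix.mul_nonsing_inv _ hBu, Matrix.one_mul]
  have hMt : Mᵀ * B = B * M := by
    have := congrArg Matrix.transpose hBM
    rw [Matrix.transpose_mul, hBs.eq, hEs.eq] at this
    rw [this, hBM]
  obtain ⟨b, -⟩ := exists_basis_adjoinRoot (Matrix.charpoly_monic M) rfl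
  obtain ⟨z, hz⟩ := exists_add_two_mul_sq b (AdjoinRoot.root M.charpoly)
  obtain ⟨p, rfl⟩ := AdjoinRoot.mk_surjective z
  set Z := Polynomial.aeval M p with hZ
  have hZM : Z + (2 : ℤ_[2]) • (Z * Z) = M := by
    have h1 : AdjoinRoot.mk M.charpoly (p + 2 * p ^ 2 - Polynomial.X) = 0 := by
      rw [map_sub, map_add, map_mul, map_pow, AdjoinRoot.mk_X, ← hz, map_ofNat, sub_self]
    obtain ⟨q, hq⟩ := AdjoinRoot.mk_eq_zero.1 h1
    have h2 := congrArg (Polynomial.aeval M) hq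
    rw [map_mul, Matrix.aeval_self_charpoly, zero_mul, map_sub, map_add, map_mul, map_pow,
      Polynomial.aeval_X, map_ofNat, sub_eq_zero] at h2
    rw [← h2, ← hZ, pow_two, ofNat_smul_eq_nsmul, nsmul_eq_mul]
    rfl
  have hZt : Zᵀ * B = B * Z := aeval_transpose_mul hMt p
  have key : (1 + (4 : ℤ_[2]) • Z)ᵀ * B * (1 + (4 : ℤ_[2]) • Z) = H := by
    have h16 : (4 : ℤ_[2]) * 4 = 8 * 2 := by norm_num
    have h44 : (4 : ℤ_[2]) + 4 = 8 := by norm_num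
    calc _ = B + (4 : ℤ_[2]) • (Zᵀ * B) + (4 : ℤ_[2]) • (B * Z)
          + ((4 : ℤ_[2]) * 4) • ((Zᵀ * B) * Z) := by
          simp only [Matrix.transpose_add, Matrix.transpose_smul, Matrix.transpose_one,
            Matrix.add_mul, Matrix.mul_add, Matrix.smul_mul, Matrix.mul_smul, Matrix.one_mul,
            Matrix.mul_one, mul_smul, smul_add]
          abel
      _ = B + (8 : ℤ_[2]) • (B * (Z + (2 : ℤ_[2]) • (Z * Z))) := by
          have h4 : (4 : ℤ_[2]) • (B * Z) + (4 : ℤ_[2]) • (B * Z) = (8 : ℤ_[2]) • (B * Z) := by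
            rw [← add_smul, h44]
          rw [hZt, h16, Matrix.mul_assoc B Z Z, add_assoc B, h4, Matrix.mul_add, Matrix.mul_smul,
            smul_add, mul_smul, add_assoc]
      _ = H := by rw [hZM, hBM, hE]
  refine ⟨_, ?_, key⟩
  have hHu : IsUnit H.det := by
    rw [← isUnit_det_redEight_iff, ← hKH, ← Matrix.transpose_map, ← Matrix.map_mul,
      ← Matrix.map_mul, isUnit_det_redEight_iff]
    exact hBu
  rw [← key, Matrix.det_mul] at hHu
  exact isUnit_of_mul_isUnit_right hHu

end TwoAdicMass

/-! ### Functionals on a finite free algebra, and frames of a pair. -/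

namespace TwoAdicMass

open Polynomial MeasureTheory

section

variable {n : ℕ} {R : Type*} [CommRing R] [Algebra ℤ_[2] R]

/-- The functional `r ↦ φ (u r)`. -/
noncomputable def twist (φ : R →ₗ[ℤ_[2]] ℤ_[2]) (u : R) : R →ₗ[ℤ_[2]] ℤ_[2] :=
  φ ∘ₗ LinearMap.mulLeft ℤ_[2] u

@[simp]
theorem twist_apply (φ : R →ₗ[ℤ_[2]] ℤ_[2]) (u r : R) : twist φ u r = φ (u * r) := rfl

theorem twist_twist (φ : R →ₗ[ℤ_[2]] ℤ_[2]) (u v : R) : twist (twist φ u) v = twist φ (u * v) := by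
  ext r; simp [mul_assoc]

theorem twist_one (φ : R →ₗ[ℤ_[2]] ℤ_[2]) : twist φ 1 = φ := by
  ext r; simp

variable (b : Module.Basis (Fin n) ℤ_[2] R)

/-- The Gram matrix of the bilinear form `(r, s) ↦ φ (r s)`. -/
noncomputable def gramOf (φ : R →ₗ[ℤ_[2]] ℤ_[2]) : Matrix (Fin n) (Fin n) ℤ_[2] :=
  Matrix.of fun i j => φ (b i * b j)

theorem gramOf_isSymm (φ : R →ₗ[ℤ_[2]] ℤ_[2]) : (gramOf b φ).IsSymm := by
  ext i j
  simp [gramOf, mul_comm]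

theorem gramOf_twist (φ : R →ₗ[ℤ_[2]] ℤ_[2]) (u : R) :
    gramOf b (twist φ u) = gramOf b φ * Algebra.leftMulMatrix b u := by
  ext i j
  rw [Matrix.mul_apply]
  simp only [gramOf, Matrix.of_apply, twist_apply, Algebra.leftMulMatrix_eq_repr_mul]
  have h : u * (b i * b j) = ∑ k, b.repr (u * b j) k • (b i * b k) := by
    conv_lhs => rw [mul_left_comm, ← b.sum_repr (u * b j), Finset.mul_sum]
    simp only [mul_smul_comm]
  rw [h, map_sum]
  simp [mul_comm]

theorem transpose_leftMulMatrix_mul_gramOf (φ : R →ₗ[ℤ_[2]] ℤ_[2]) (u : R) :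
    (Algebra.leftMulMatrix b u)ᵀ * gramOf b φ = gramOf b φ * Algebra.leftMulMatrix b u := by
  have h := gramOf_isSymm b (twist φ u)
  rw [gramOf_twist, Matrix.IsSymm, Matrix.transpose_mul, (gramOf_isSymm b φ).eq] at h
  exact h

theorem gramOf_twist_sq (φ : R →ₗ[ℤ_[2]] ℤ_[2]) (u : R) :
    gramOf b (twist φ (u * u))
      = (Algebra.leftMulMatrix b u)ᵀ * gramOf b φ * Algebra.leftMulMatrix b u := by
  rw [transpose_leftMulMatrix_mul_gramOf, gramOf_twist, map_mul, Matrix.mul_assoc]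

theorem gramOf_injective : Function.Injective (gramOf b) := by
  intro φ ψ h
  refine b.ext fun j => ?_
  have h1 : b j = ∑ i, b.repr 1 i • (b i * b j) := by
    conv_lhs => rw [← one_mul (b j), ← b.sum_repr 1, Finset.sum_mul]
    simp only [smul_mul_assoc]
  rw [h1, map_sum, map_sum]
  refine Finset.sum_congr rfl fun i _ => ?_
  rw [map_smul, map_smul]
  congr 1
  exact congrFun (congrFun h i) j

theorem isUnit_det_leftMulMatrix_iff (u : R) :
    IsUnit (Algebra.leftMulMatrix b u).det ↔ IsUnit u := by
  constructor
  · intro h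
    have h1 : Algebra.leftMulMatrix b u *ᵥ ((Algebra.leftMulMatrix b u)⁻¹ *ᵥ b.repr 1)
        = b.repr 1 := by
      rw [Matrix.mulVec_mulVec, Matrix.mul_nonsing_inv _ h, Matrix.one_mulVec]
    set w := (Algebra.leftMulMatrix b u)⁻¹ *ᵥ b.repr 1
    have h2 : w = b.repr (b.equivFun.symm w) := by
      ext i
      rw [← b.equivFun_apply, LinearEquiv.apply_symm_apply]
    rw [h2, Algebra.leftMulMatrix_mulVec_repr] at h1
    exact IsUnit.of_mul_eq_one _ (b.repr.injective (DFunLike.coe_injective h1))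
  · intro h
    have := h.map (Algebra.leftMulMatrix b)
    exact (Matrix.isUnit_iff_isUnit_det _).1 this

variable {b} in
theorem twist_injective {φ : R →ₗ[ℤ_[2]] ℤ_[2]} (hφ : IsUnit (gramOf b φ).det) :
    Function.Injective (twist φ) := by
  intro u v h
  have h1 : gramOf b φ * Algebra.leftMulMatrix b u = gramOf b φ * Algebra.leftMulMatrix b v := by
    rw [← gramOf_twist, ← gramOf_twist, h]
  have h2 := congrArg ((gramOf b φ)⁻¹ * ·) h1
  simp only [← Matrix.mul_assoc, Matrix.nonsing_inv_mul _ hφ, Matrix.one_mul] at h2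
  exact Algebra.leftMulMatrix_injective b h2

-- With `twist_injective`: the dual of R is free of rank one over R, generated by any unimodular
-- functional. The coordinates of the multiplier solve a linear system with the Gram matrix.
variable {b} in
theorem twist_surjective {φ : R →ₗ[ℤ_[2]] ℤ_[2]} (hφ : IsUnit (gramOf b φ).det) :
    Function.Surjective (twist φ) := by
  intro ψ
  let c := (gramOf b φ)⁻¹ *ᵥ fun i => ψ (b i)
  have hc : gramOf b φ *ᵥ c = fun i => ψ (b i) := by
    rw [Matrix.mulVec_mulVec, Matrix.mul_nonsing_inv _ hφ, Matrix.one_mulVec]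
  refine ⟨∑ k, c k • b k, b.ext fun i => ?_⟩
  rw [← congrFun hc i, twist_apply, Finset.sum_mul, map_sum]
  simp only [Matrix.mulVec, dotProduct, gramOf, Matrix.of_apply]
  refine Finset.sum_congr rfl fun k _ => ?_
  rw [smul_mul_assoc, map_smul, smul_eq_mul, mul_comm, mul_comm (b k)]

variable {b} in
theorem isUnit_det_gramOf_twist_iff {φ : R →ₗ[ℤ_[2]] ℤ_[2]} (hφ : IsUnit (gramOf b φ).det) (u : R) :
    IsUnit (gramOf b (twist φ u)).det ↔ IsUnit u := by
  rw [gramOf_twist, Matrix.det_mul, ← isUnit_det_leftMulMatrix_iff b]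
  exact ⟨fun h => isUnit_of_mul_isUnit_right h, fun h => hφ.mul h⟩

theorem leftMulMatrix_pow_mulVec_repr_one {x : R} (hb : ∀ i, b i = x ^ (i : ℕ)) (i : Fin n) :
    Algebra.leftMulMatrix b x ^ (i : ℕ) *ᵥ b.repr 1 = Pi.single i 1 := by
  rw [← map_pow, Algebra.leftMulMatrix_mulVec_repr, mul_one, ← hb, b.repr_self]
  ext j
  rw [Finsupp.single_apply, Pi.single_apply]
  simp [eq_comm]

/-- The matrices that commute with multiplication by a generator are the multiplications. -/
theorem exists_leftMulMatrix_of_commute {x : R} (hb : ∀ i, b i = x ^ (i : ℕ))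
    {L : Matrix (Fin n) (Fin n) ℤ_[2]}
    (hL : L * Algebra.leftMulMatrix b x = Algebra.leftMulMatrix b x * L) :
    ∃ u, L = Algebra.leftMulMatrix b u := by
  let u := b.equivFun.symm (L *ᵥ b.repr 1)
  have hu : L *ᵥ b.repr 1 = Algebra.leftMulMatrix b u *ᵥ b.repr 1 := by
    rw [Algebra.leftMulMatrix_mulVec_repr, mul_one]
    exact (b.equivFun.apply_symm_apply _).symm
  refine ⟨u, ?_⟩
  ext i j
  have h1 : ∀ M : Matrix (Fin n) (Fin n) ℤ_[2], M i j = (M *ᵥ Pi.single j 1) i := fun M => by simp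
  have hcomm : Commute L (Algebra.leftMulMatrix b x) := hL
  have hcomm' : Commute (Algebra.leftMulMatrix b u) (Algebra.leftMulMatrix b x) := by
    rw [commute_iff_eq, ← map_mul, ← map_mul, mul_comm]
  rw [h1 L, h1 (Algebra.leftMulMatrix b u), ← leftMulMatrix_pow_mulVec_repr_one b hb,
    Matrix.mulVec_mulVec, Matrix.mulVec_mulVec, (hcomm.pow_right _).eq, (hcomm'.pow_right _).eq,
    ← Matrix.mulVec_mulVec, hu, Matrix.mulVec_mulVec]

/-- If x is self-adjoint for `H`, powers of x can be moved across, so H(r, s) = H(1, rs). The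
functional is H(1, ·). -/
theorem exists_eq_gramOf {x : R} (hb : ∀ i, b i = x ^ (i : ℕ)) {H : Matrix (Fin n) (Fin n) ℤ_[2]}
    (hHX : (Algebra.leftMulMatrix b x)ᵀ * H = H * Algebra.leftMulMatrix b x) :
    ∃ ψ, H = gramOf b ψ := by
  let ψ : R →ₗ[ℤ_[2]] ℤ_[2] :=
    { toFun := fun r => b.repr 1 ⬝ᵥ H *ᵥ b.repr r
      map_add' := fun r s => by simp [Matrix.mulVec_add]
      map_smul' := fun c r => by simp [Matrix.mulVec_smul] }
  refine ⟨ψ, ?_⟩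
  have hpow : ∀ k : ℕ, ((Algebra.leftMulMatrix b x)ᵀ) ^ k * H
      = H * (Algebra.leftMulMatrix b x) ^ k := by
    intro k
    induction k with
    | zero => simp
    | succ k ih =>
      rw [pow_succ, Matrix.mul_assoc, hHX, ← Matrix.mul_assoc, ih, Matrix.mul_assoc, ← pow_succ]
  ext i j
  have h1 : H i j = Pi.single i 1 ⬝ᵥ H *ᵥ Pi.single j 1 := by simp
  rw [h1, ← leftMulMatrix_pow_mulVec_repr_one b hb i, ← leftMulMatrix_pow_mulVec_repr_one b hb j,
    ← Matrix.vecMul_transpose, ← Matrix.dotProduct_mulVec, Matrix.mulVec_mulVec,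
    Matrix.mulVec_mulVec, Matrix.transpose_pow, hpow, Matrix.mul_assoc, ← pow_add,
    ← Matrix.mulVec_mulVec]
  simp only [gramOf, Matrix.of_apply, hb, ← pow_add, ψ, LinearMap.coe_mk, AddHom.coe_mk]
  rw [← map_pow, Algebra.leftMulMatrix_mulVec_repr, mul_one]

/-- A basis of `ℤ_2 ^ n` in which the pair `(A, B)` is the pair of forms `φ (r s)`, `φ (x r s)`. -/
structure IsFrame (x : R) (A B : Matrix (Fin n) (Fin n) ℤ_[2]) (φ : R →ₗ[ℤ_[2]] ℤ_[2])
    (K : Matrix (Fin n) (Fin n) ℤ_[2]) : Prop where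
  isUnit_det : IsUnit K.det
  left : Kᵀ * A * K = gramOf b φ
  right : Kᵀ * B * K = gramOf b φ * Algebra.leftMulMatrix b x

theorem transpose_mul_mul_cancel {K Y Z : Matrix (Fin n) (Fin n) ℤ_[2]} (hK : IsUnit K.det)
    (h : Kᵀ * Y * K = Kᵀ * Z * K) : Y = Z := by
  have hKt : IsUnit Kᵀ.det := by rwa [Matrix.det_transpose]
  have h1 := congrArg (· * K⁻¹) h
  simp only [Matrix.mul_assoc, Matrix.mul_nonsing_inv _ hK, Matrix.mul_one] at h1
  have h2 := congrArg ((Kᵀ)⁻¹ * ·) h1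
  simpa only [← Matrix.mul_assoc, Matrix.nonsing_inv_mul _ hKt, Matrix.one_mul] using h2

variable {b} {x : R} {A B B' K K' : Matrix (Fin n) (Fin n) ℤ_[2]} {φ ψ : R →ₗ[ℤ_[2]] ℤ_[2]}

theorem IsFrame.isUnit_det_gramOf (h : IsFrame b x A B φ K) (hA : IsUnit A.det) :
    IsUnit (gramOf b φ).det := by
  rw [← h.left, Matrix.det_mul, Matrix.det_mul, Matrix.det_transpose]
  exact (h.isUnit_det.mul hA).mul h.isUnit_det

theorem IsFrame.conj (h : IsFrame b x A B φ K) {g : Matrix.SpecialLinearGroup (Fin n) ℤ_[2]}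
    (hg : g ∈ specialOrthogonal A) (hB : g.1ᵀ * B * g.1 = B') :
    IsFrame b x A B' φ ((g⁻¹).1 * K) := by
  have key : ∀ Y, ((g⁻¹).1 * K)ᵀ * Y * ((g⁻¹).1 * K) = Kᵀ * ((g⁻¹).1ᵀ * Y * (g⁻¹).1) * K := by
    intro Y
    simp only [Matrix.transpose_mul, Matrix.mul_assoc]
  refine ⟨?_, ?_, ?_⟩
  · rw [Matrix.det_mul, (g⁻¹).2, one_mul]; exact h.isUnit_det
  · rw [key, inv_congr g hg, h.left]
  · rw [key, inv_congr g hB, h.right]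

theorem IsFrame.mul_leftMulMatrix (h : IsFrame b x A B φ K) {u : R} (hu : IsUnit u) :
    IsFrame b x A B (twist φ (u * u)) (K * Algebra.leftMulMatrix b u) := by
  have key : ∀ Y, (K * Algebra.leftMulMatrix b u)ᵀ * Y * (K * Algebra.leftMulMatrix b u)
      = (Algebra.leftMulMatrix b u)ᵀ * (Kᵀ * Y * K) * Algebra.leftMulMatrix b u := by
    intro Y
    simp only [Matrix.transpose_mul, Matrix.mul_assoc]
  refine ⟨?_, ?_, ?_⟩
  · rw [Matrix.det_mul]
    exact h.isUnit_det.mul ((isUnit_det_leftMulMatrix_iff b u).2 hu)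
  · rw [key, h.left, gramOf_twist_sq]
  · rw [key, h.right, gramOf_twist_sq]
    simp only [Matrix.mul_assoc, ← map_mul, mul_comm x]

/-- Two frames of the same pair differ by a unit. -/
theorem IsFrame.exists_unit (hb : ∀ i, b i = x ^ (i : ℕ)) (hA : IsUnit A.det)
    (h : IsFrame b x A B φ K) (h' : IsFrame b x A B ψ K') :
    ∃ u : R, IsUnit u ∧ φ = twist ψ (u * u) ∧ K = K' * Algebra.leftMulMatrix b u := by
  set L := K'⁻¹ * K with hL
  have hKL : K = K' * L := by
    rw [hL, ← Matrix.mul_assoc, Matrix.mul_nonsing_inv _ h'.isUnit_det, Matrix.one_mul]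
  have hLu : IsUnit L.det := by
    have := h.isUnit_det
    rw [hKL, Matrix.det_mul] at this
    exact isUnit_of_mul_isUnit_right this
  have key : ∀ Y, Kᵀ * Y * K = Lᵀ * (K'ᵀ * Y * K') * L := by
    intro Y
    conv_lhs => rw [hKL]
    simp only [Matrix.transpose_mul, Matrix.mul_assoc]
  have h1 := h.left
  have h2 := h.right
  rw [key, h'.left] at h1
  rw [key, h'.right, ← h1] at h2
  have hGu := h'.isUnit_det_gramOf hA
  -- `L` matches both forms of the two frames, hence also their quotient, which is multiplication by
  -- x. Since x generates R, `L` is then itself a multiplication.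
  have hcomm : L * Algebra.leftMulMatrix b x = Algebra.leftMulMatrix b x * L := by
    have hu : IsUnit (Lᵀ * gramOf b ψ).det := by
      rw [Matrix.det_mul, Matrix.det_transpose]; exact hLu.mul hGu
    have hcancel : ∀ Y Z : Matrix (Fin n) (Fin n) ℤ_[2],
        (Lᵀ * gramOf b ψ) * Y = (Lᵀ * gramOf b ψ) * Z → Y = Z := fun Y Z h =>
      ((Matrix.isUnit_iff_isUnit_det _).2 hu).mul_left_cancel h
    refine (hcancel _ _ ?_).symm
    simpa only [Matrix.mul_assoc] using h2
  obtain ⟨u, hu⟩ := exists_leftMulMatrix_of_commute b hb hcomm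
  rw [hu] at h1 hLu hKL
  exact ⟨u, (isUnit_det_leftMulMatrix_iff b u).1 hLu,
    gramOf_injective b (by rw [gramOf_twist_sq, h1]), hKL⟩

/-- Pairs with the same functional are equivalent. -/
theorem IsFrame.exists_specialOrthogonal (hn : Odd n) (hA : IsUnit A.det)
    (h : IsFrame b x A B φ K) (h' : IsFrame b x A B' φ K') :
    ∃ g ∈ specialOrthogonal A, g.1ᵀ * B * g.1 = B' := by
  set g := K * K'⁻¹ with hg
  have hgK : g * K' = K := by
    rw [hg, Matrix.mul_assoc, Matrix.nonsing_inv_mul _ h'.isUnit_det, Matrix.mul_one]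
  have key : ∀ Y, K'ᵀ * (gᵀ * Y * g) * K' = Kᵀ * Y * K := by
    intro Y
    rw [← hgK]
    simp only [Matrix.transpose_mul, Matrix.mul_assoc]
  have h1 : gᵀ * A * g = A :=
    transpose_mul_mul_cancel h'.isUnit_det (by rw [key, h.left, h'.left])
  have h2 : gᵀ * B * g = B' :=
    transpose_mul_mul_cancel h'.isUnit_det (by rw [key, h.right, h'.right])
  have hdet : g.det = 1 ∨ g.det = -1 := by
    have := congrArg Matrix.det h1
    rw [Matrix.det_mul, Matrix.det_mul, Matrix.det_transpose, mul_right_comm] at this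
    have h3 : g.det * g.det = 1 := hA.mul_right_cancel (by rw [this, one_mul])
    exact mul_self_eq_one_iff.1 h3
  rcases hdet with hd | hd
  · exact ⟨⟨g, hd⟩, h1, h2⟩
  -- In odd dimension -1 has determinant -1 and acts trivially on symmetric matrices.
  · refine ⟨⟨-g, by rw [Matrix.det_neg, hd, Fintype.card_fin, hn.neg_one_pow]; ring⟩, ?_, ?_⟩
    · change (-g)ᵀ * A * (-g) = A
      simp only [Matrix.transpose_neg, Matrix.neg_mul, Matrix.mul_neg, neg_neg, h1]
    · change (-g)ᵀ * B * (-g) = B'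
      simp only [Matrix.transpose_neg, Matrix.neg_mul, Matrix.mul_neg, neg_neg, h2]

/-- The stabiliser of a pair consists of the square roots of unity of norm one. -/
theorem IsFrame.nonempty_stab_equiv (hb : ∀ i, b i = x ^ (i : ℕ)) (hA : IsUnit A.det)
    (h : IsFrame b x A B φ K) :
    Nonempty ({u : R // u * u = 1 ∧ (Algebra.leftMulMatrix b u).det = 1} ≃ Stab A B) := by
  have hKK : K * K⁻¹ = 1 := Matrix.mul_nonsing_inv _ h.isUnit_det
  have hKK' : K⁻¹ * K = 1 := Matrix.nonsing_inv_mul _ h.isUnit_det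
  let g : R → Matrix (Fin n) (Fin n) ℤ_[2] := fun u => K * Algebra.leftMulMatrix b u * K⁻¹
  have hgK : ∀ u, g u * K = K * Algebra.leftMulMatrix b u := fun u => by
    simp only [g, Matrix.mul_assoc, hKK', Matrix.mul_one]
  have hgdet : ∀ u, (g u).det = (Algebra.leftMulMatrix b u).det := fun u => by
    have h1 := congrArg Matrix.det (hgK u)
    rw [Matrix.det_mul (g u), Matrix.det_mul K, mul_comm K.det] at h1
    exact h.isUnit_det.mul_right_cancel h1
  have key : ∀ u Y, Kᵀ * ((g u)ᵀ * Y * g u) * K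
      = (Algebra.leftMulMatrix b u)ᵀ * (Kᵀ * Y * K) * Algebra.leftMulMatrix b u := by
    intro u Y
    calc _ = (g u * K)ᵀ * Y * (g u * K) := by simp only [Matrix.transpose_mul, Matrix.mul_assoc]
      _ = _ := by rw [hgK]; simp only [Matrix.transpose_mul, Matrix.mul_assoc]
  have hgA : ∀ u, u * u = 1 → (g u)ᵀ * A * g u = A := fun u hu =>
    transpose_mul_mul_cancel h.isUnit_det (by
      rw [key, h.left, ← gramOf_twist_sq, hu, twist_one])
  have hgB : ∀ u, u * u = 1 → (g u)ᵀ * B * g u = B := fun u hu =>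
    transpose_mul_mul_cancel h.isUnit_det (by
      have hc : Algebra.leftMulMatrix b x * Algebra.leftMulMatrix b u
          = Algebra.leftMulMatrix b u * Algebra.leftMulMatrix b x := by
        rw [← map_mul, mul_comm, map_mul]
      rw [key, h.right, Matrix.mul_assoc, Matrix.mul_assoc, hc, ← Matrix.mul_assoc,
        ← Matrix.mul_assoc, ← gramOf_twist_sq, hu, twist_one])
  refine ⟨Equiv.ofBijective (fun u => ⟨⟨⟨g u.1, by rw [hgdet, u.2.2]⟩, hgA _ u.2.1⟩,
    hgB _ u.2.1⟩) ⟨?_, ?_⟩⟩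
  · rintro ⟨u, hu⟩ ⟨v, hv⟩ huv
    have h1 : g u = g v :=
      congrArg (fun s : Stab A B => ((s.1 : Matrix.SpecialLinearGroup (Fin n) ℤ_[2]) :
        Matrix (Fin n) (Fin n) ℤ_[2])) huv
    have h2 := congrArg (fun M => K⁻¹ * (M * K)) h1
    simp only [hgK, ← Matrix.mul_assoc, hKK', Matrix.one_mul] at h2
    exact Subtype.ext (Algebra.leftMulMatrix_injective b h2)
  · rintro ⟨⟨s, hsA⟩, hsB⟩
    -- A stabilising element carries the frame `K` to another frame of the same pair with the same
    -- functional φ. The two differ by a unit u with u²φ = φ, so u² = 1.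
    have hframe := h.conj (inv_mem hsA) (inv_congr s hsB)
    rw [inv_inv] at hframe
    obtain ⟨u, -, hφ, hKu⟩ := hframe.exists_unit hb hA h
    have hu : u * u = 1 := by
      refine twist_injective (h.isUnit_det_gramOf hA) ?_
      rw [← hφ, twist_one]
    have hs : g u = s.1 := by
      have h1 := congrArg (· * K⁻¹) ((hgK u).trans hKu.symm)
      simpa only [Matrix.mul_assoc, hKK, Matrix.mul_one] using h1
    exact ⟨⟨u, hu, by rw [← hgdet, hs]; exact s.2⟩,
      Subtype.ext (Subtype.ext (Subtype.ext hs))⟩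

end

end TwoAdicMass

/-! ### Units modulo 8 and their square classes. -/

namespace TwoAdicMass

open Polynomial MeasureTheory

section

variable {n : ℕ} {R : Type*} [CommRing R] [Algebra ℤ_[2] R] (b : Module.Basis (Fin n) ℤ_[2] R)

theorem redEight_eq_two_mul (z : ℤ_[2]) (h : redTwo (redEight z) = 0) : ∃ y, z = 2 * y := by
  have hdec : ∀ v : ZMod 8, redTwo v = 0 → ∃ w, v = 2 * w := by decide
  obtain ⟨w, hw⟩ := hdec _ h
  obtain ⟨y, rfl⟩ := redEight_surjective w
  have h2 : redEight z = redEight (2 * y) := by rw [hw, map_mul, map_ofNat]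
  obtain ⟨y', hy'⟩ := (redEight_eq_iff _ _).1 h2
  exact ⟨y + 4 * y', by linear_combination hy'⟩

theorem exists_sub_eq_eight_mul_iff (r s : R) :
    (∃ y, r - s = 8 * y) ↔ ∀ i, redEight (b.repr r i) = redEight (b.repr s i) := by
  have h8 : ∀ y : R, 8 * y = (8 : ℤ_[2]) • y := fun y => by rw [Algebra.smul_def, map_ofNat]
  constructor
  · rintro ⟨y, hy⟩ i
    rw [redEight_eq_iff]
    refine ⟨b.repr y i, ?_⟩
    rw [← Finsupp.sub_apply, ← map_sub, hy, h8, map_smul, Finsupp.smul_apply, smul_eq_mul]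
  · intro h
    choose y hy using fun i => (redEight_eq_iff _ _).1 (h i)
    refine ⟨b.equivFun.symm y, b.repr.injective (Finsupp.ext fun i => ?_)⟩
    rw [h8, map_smul, map_sub, Finsupp.sub_apply, hy, Finsupp.smul_apply, smul_eq_mul,
      ← b.equivFun_apply, LinearEquiv.apply_symm_apply]

/-- The reduction modulo `2` of the coordinates. -/
noncomputable def coordTwo (r : R) : Fin n → ZMod 2 := fun i => redTwo (redEight (b.repr r i))

theorem coordTwo_eq_iff (r s : R) : coordTwo b r = coordTwo b s ↔ ∃ y, r - s = 2 * y := by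
  have h2 : ∀ y : R, 2 * y = (2 : ℤ_[2]) • y := fun y => by rw [Algebra.smul_def, map_ofNat]
  constructor
  · intro h
    have h1 : ∀ i, ∃ y, b.repr r i - b.repr s i = 2 * y := fun i => by
      refine redEight_eq_two_mul _ ?_
      rw [map_sub, map_sub, sub_eq_zero]
      exact congrFun h i
    choose y hy using h1
    refine ⟨b.equivFun.symm y, b.repr.injective (Finsupp.ext fun i => ?_)⟩
    rw [h2, map_smul, map_sub, Finsupp.sub_apply, hy, Finsupp.smul_apply, smul_eq_mul,
      ← b.equivFun_apply, LinearEquiv.apply_symm_apply]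
  · rintro ⟨y, hy⟩
    ext i
    rw [coordTwo, coordTwo, ← sub_eq_zero, ← map_sub, ← map_sub, ← Finsupp.sub_apply, ← map_sub,
      hy, h2, map_smul, Finsupp.smul_apply, smul_eq_mul, map_mul, map_mul, map_ofNat, map_ofNat]
    have : (2 : ZMod 2) = 0 := by decide
    rw [this, zero_mul]

theorem coordTwo_surjective : Function.Surjective (coordTwo b) := by
  intro c
  have h : ∀ z : ZMod 2, ∃ y, redTwo (redEight y) = z := fun z => by
    obtain ⟨y, hy⟩ := redEight_surjective (z.val : ZMod 8)
    exact ⟨y, by rw [hy, redTwo_natCast_val]⟩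
  choose y hy using fun i => h (c i)
  refine ⟨b.equivFun.symm y, ?_⟩
  ext i
  rw [coordTwo, ← b.equivFun_apply, LinearEquiv.apply_symm_apply, hy]

include b in
theorem eq_zero_of_two_mul (y : R) (h : 2 * y = 0) : y = 0 := by
  refine b.repr.injective (Finsupp.ext fun i => ?_)
  have h2 : 2 * y = (2 : ℤ_[2]) • y := by rw [Algebra.smul_def, map_ofNat]
  have h1 := DFunLike.congr_fun (congrArg b.repr h) i
  rw [h2, map_smul, Finsupp.smul_apply, smul_eq_mul, map_zero] at h1
  rw [map_zero]
  exact (mul_eq_zero.1 h1).resolve_left two_ne_zero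

include b in
theorem isUnit_one_add_two_mul (r : R) : IsUnit (1 + 2 * r) := by
  rw [← isUnit_det_leftMulMatrix_iff b, ← isUnit_det_redEight_iff]
  have h : (Algebra.leftMulMatrix b (1 + 2 * r)).map redEight
      = 1 + (2 : ZMod 8) • (Algebra.leftMulMatrix b r).map redEight := by
    have h2 : 2 * r = (2 : ℤ_[2]) • r := by rw [Algebra.smul_def, map_ofNat]
    rw [h2, map_add, map_one, map_smul]
    ext i j
    by_cases hij : i = j
    · subst hij; simp [map_ofNat redEight 2]
    · simp [hij, map_ofNat redEight 2]
  rw [h]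
  exact isUnit_det_one_add_two_smul _

variable (R) in
/-- The units that are `1` modulo `8`. -/
def unitsOneModEight : Subgroup Rˣ :=
  (Units.map (Ideal.Quotient.mk (Ideal.span {(8 : R)})).toMonoidHom).ker

omit [Algebra ℤ_[2] R] in
theorem mem_unitsOneModEight {u : Rˣ} : u ∈ unitsOneModEight R ↔ ∃ r, (u : R) = 1 + 8 * r := by
  rw [unitsOneModEight, MonoidHom.mem_ker, Units.ext_iff]
  change Ideal.Quotient.mk _ (u : R) = 1 ↔ _
  rw [← map_one (Ideal.Quotient.mk _), Ideal.Quotient.eq, Ideal.mem_span_singleton]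
  refine exists_congr fun r => ?_
  rw [sub_eq_iff_eq_add']

omit [Algebra ℤ_[2] R] in
theorem unitsOneModEight_mk_eq_iff (u v : Rˣ) :
    (QuotientGroup.mk u : Rˣ ⧸ unitsOneModEight R) = QuotientGroup.mk v ↔
      ∃ r, (v : R) = u * (1 + 8 * r) := by
  rw [QuotientGroup.eq, mem_unitsOneModEight]
  refine exists_congr fun r => ?_
  rw [Units.val_mul, Units.inv_mul_eq_iff_eq_mul]

omit [Algebra ℤ_[2] R] in
theorem unitsOneModEight_mk_eq_iff_sub (u v : Rˣ) :
    (QuotientGroup.mk u : Rˣ ⧸ unitsOneModEight R) = QuotientGroup.mk v ↔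
      ∃ r, (u : R) - v = 8 * r := by
  rw [unitsOneModEight_mk_eq_iff]
  constructor
  · rintro ⟨r, hr⟩
    exact ⟨-(u * r), by rw [hr]; ring⟩
  · rintro ⟨r, hr⟩
    refine ⟨-(↑u⁻¹ * r), ?_⟩
    have h1 : (u : R) * ↑u⁻¹ = 1 := u.mul_inv
    linear_combination (-1 : R) * hr + 8 * r * h1

include b in
theorem finite_quotient_unitsOneModEight : Finite (Rˣ ⧸ unitsOneModEight R) := by
  let F : Rˣ ⧸ unitsOneModEight R → Fin n → ZMod 8 := fun q i => redEight (b.repr (q.out : R) i)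
  refine Finite.of_injective F fun p q h => ?_
  rw [← QuotientGroup.out_eq' p, ← QuotientGroup.out_eq' q, unitsOneModEight_mk_eq_iff_sub,
    exists_sub_eq_eight_mul_iff b]
  exact fun i => congrFun h i

variable (R) in
/-- The squaring map on the units modulo `8`. -/
def sqModEight : (Rˣ ⧸ unitsOneModEight R) →* (Rˣ ⧸ unitsOneModEight R) :=
  MonoidHom.mk' (fun q => q * q) fun p q => by
    induction p using QuotientGroup.induction_on with | H u => ?_
    induction q using QuotientGroup.induction_on with | H v => ?_
    exact congrArg QuotientGroup.mk (mul_mul_mul_comm u v u v)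

-- Since 1 + 8r = (1 + 4z)² with r = z + 2z², the subgroup 1 + 8R consists of squares, so square
-- classes of units can be computed in the finite quotient.
include b in
theorem mk_div_mem_squares_iff (u v : Rˣ) :
    (QuotientGroup.mk (QuotientGroup.mk u : Rˣ ⧸ unitsOneModEight R) :
      (Rˣ ⧸ unitsOneModEight R) ⧸ (sqModEight R).range)
        = QuotientGroup.mk (QuotientGroup.mk v : Rˣ ⧸ unitsOneModEight R) ↔
      ∃ w : Rˣ, v = u * (w * w) := by
  rw [QuotientGroup.eq]
  constructor
  · rintro ⟨w, hw⟩
    induction w using QuotientGroup.induction_on with | H w => ?_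
    have h1 : (QuotientGroup.mk (u * (w * w)) : Rˣ ⧸ unitsOneModEight R) = QuotientGroup.mk v := by
      rw [eq_inv_mul_iff_mul_eq] at hw
      exact hw
    obtain ⟨r, hr⟩ := (unitsOneModEight_mk_eq_iff _ _).1 h1
    obtain ⟨z, hz⟩ := exists_add_two_mul_sq b r
    obtain ⟨y, hy⟩ := isUnit_one_add_two_mul b (2 * z)
    refine ⟨w * y, Units.ext ?_⟩
    rw [hr, ← hz]
    simp only [Units.val_mul, hy]
    ring
  · rintro ⟨w, rfl⟩
    refine ⟨QuotientGroup.mk w, ?_⟩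
    rw [eq_inv_mul_iff_mul_eq]
    rfl

-- The hypothesis reads 8y(1 + 2y) = 0, where R has no 2-torsion and 1 + 2y is a unit. So 1 + 4R
-- contains no square root of unity other than 1.
include b in
theorem eq_zero_of_one_add_four_mul_sq (y : R) (h : (1 + 4 * y) * (1 + 4 * y) = 1) : y = 0 := by
  have h1 : 2 * (2 * (2 * (y * (1 + 2 * y)))) = 0 := by linear_combination h
  have h2 := eq_zero_of_two_mul b _ (eq_zero_of_two_mul b _ (eq_zero_of_two_mul b _ h1))
  exact (isUnit_one_add_two_mul b y).mul_left_eq_zero.1 h2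

include b in
/-- The two-torsion of the units modulo `8`. -/
theorem card_ker_sq_and_finite :
    Nat.card (sqModEight R).ker
      = Nat.card {u : R // u * u = 1} * 2 ^ n ∧ Finite {u : R // u * u = 1} := by
  have hfin := finite_quotient_unitsOneModEight b
  choose lift hlift using coordTwo_surjective b
  choose h hh using fun c => isUnit_one_add_two_mul b (2 * lift c)
  have hh4 : ∀ c, (h c : R) = 1 + 4 * lift c := fun c => by rw [hh]; ring
  let τ : {u : R // u * u = 1} → Rˣ := fun t => ⟨t.1, t.1, t.2, t.2⟩
  -- The kernel of squaring is the product of the square roots of unity in R and (1 + 4R)/(1 + 8R),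
  -- and the latter is R/2R with 2^n elements.
  let F : {u : R // u * u = 1} × (Fin n → ZMod 2) →
      (sqModEight R).ker := fun p =>
    ⟨QuotientGroup.mk (τ p.1 * h p.2), by
      change (QuotientGroup.mk _ : Rˣ ⧸ unitsOneModEight R) = QuotientGroup.mk 1
      rw [unitsOneModEight_mk_eq_iff_sub]
      refine ⟨lift p.2 + 2 * lift p.2 ^ 2, ?_⟩
      simp only [Units.val_mul, hh4, Units.val_one, τ]
      linear_combination (1 + 4 * lift p.2) ^ 2 * p.1.2⟩
  have hF : Function.Bijective F := by
    constructor
    · rintro ⟨⟨t, ht⟩, c⟩ ⟨⟨t', ht'⟩, c'⟩ heq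
      have h1 : (QuotientGroup.mk (τ ⟨t, ht⟩ * h c) : Rˣ ⧸ unitsOneModEight R)
          = QuotientGroup.mk (τ ⟨t', ht'⟩ * h c') := congrArg Subtype.val heq
      rw [unitsOneModEight_mk_eq_iff_sub] at h1
      obtain ⟨r, hr⟩ := h1
      simp only [Units.val_mul, hh4, τ] at hr
      -- The equality of classes puts t t' in 1 + 4R. As a square root of unity there, it is 1.
      have hy : t * t' = 1 + 4 * (2 * t' * r + lift c' - t * t' * lift c) := by
        linear_combination t' * hr + (1 + 4 * lift c') * ht'
      have hz := eq_zero_of_one_add_four_mul_sq b _ (by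
        rw [← hy]
        linear_combination t' * t' * ht + ht')
      rw [hz, mul_zero, add_zero] at hy
      have htt : t = t' := by linear_combination t' * hy - t * ht'
      subst htt
      have h2 : 2 * (2 * (lift c - lift c' - 2 * (t * r))) = 0 := by
        linear_combination t * hr - 4 * (lift c - lift c') * ht
      have h3 := eq_zero_of_two_mul b _ (eq_zero_of_two_mul b _ h2)
      have h4 := (coordTwo_eq_iff b (lift c) (lift c')).2 ⟨t * r, by linear_combination h3⟩
      rw [hlift, hlift] at h4
      rw [h4]
    · rintro ⟨q, hq⟩
      induction q using QuotientGroup.induction_on with | H u => ?_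
      change (QuotientGroup.mk (u * u) : Rˣ ⧸ unitsOneModEight R) = QuotientGroup.mk 1 at hq
      rw [unitsOneModEight_mk_eq_iff_sub] at hq
      obtain ⟨r, hr⟩ := hq
      rw [Units.val_mul, Units.val_one] at hr
      -- Here u² = 1 + 8r = (1 + 4z)², so u / (1 + 4z) is a square root of unity.
      obtain ⟨z, rfl⟩ := exists_add_two_mul_sq b r
      obtain ⟨y, hy⟩ := isUnit_one_add_two_mul b (2 * z)
      have hinv : (y : R) * ↑y⁻¹ = 1 := y.mul_inv
      let t : {u : R // u * u = 1} := ⟨u * ↑y⁻¹, by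
        have : (u : R) * u = y * y := by rw [hy]; linear_combination hr
        linear_combination (↑y⁻¹ * ↑y⁻¹) * this + (y * ↑y⁻¹ + 1) * hinv⟩
      obtain ⟨s, hs⟩ := (coordTwo_eq_iff b z (lift (coordTwo b z))).1 (by rw [hlift])
      refine ⟨(t, coordTwo b z), Subtype.ext ?_⟩
      change (QuotientGroup.mk (τ t * h (coordTwo b z)) : Rˣ ⧸ unitsOneModEight R)
        = QuotientGroup.mk u
      rw [unitsOneModEight_mk_eq_iff_sub]
      refine ⟨-(u * ↑y⁻¹ * s), ?_⟩
      simp only [Units.val_mul, hh4, τ, t]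
      linear_combination (-4 * (u : R) * ↑y⁻¹) * hs - u * ↑y⁻¹ * hy + u * hinv
  refine ⟨?_, ?_⟩
  · rw [← Nat.card_congr (Equiv.ofBijective F hF), Nat.card_prod]
    simp
  · have : Finite ({u : R // u * u = 1} × (Fin n → ZMod 2)) := Finite.of_injective F hF.1
    exact Finite.of_injective (fun t => (t, (0 : Fin n → ZMod 2))) fun _ _ h => congrArg Prod.fst h

include b in
/-- Counting the classes modulo squares in a set of units that is stable under squares. -/
theorem card_classes_mul_card (D : Set Rˣ) (hD : ∀ δ ∈ D, ∀ w : Rˣ, δ * (w * w) ∈ D)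
    {F : Type*} (s : Setoid F) (Rel : F → Rˣ → Prop) (h1 : ∀ x, ∃ δ ∈ D, Rel x δ)
    (h2 : ∀ δ ∈ D, ∃ x, Rel x δ)
    (h3 : ∀ x y δ ε, Rel x δ → Rel y ε → (s x y ↔ ∃ w : Rˣ, ε = δ * (w * w))) :
    Finite (Quotient s) ∧ Nat.card (Quotient s) * Nat.card (Rˣ ⧸ unitsOneModEight R)
      = 2 ^ n * Nat.card {u : R // u * u = 1} *
        Nat.card ((fun δ : Rˣ => (QuotientGroup.mk δ : Rˣ ⧸ unitsOneModEight R)) '' D) := by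
  have hfin := finite_quotient_unitsOneModEight b
  choose δ hδD hδ using h1
  let m : Rˣ → (Rˣ ⧸ unitsOneModEight R) ⧸ (sqModEight R).range := fun δ =>
    QuotientGroup.mk (QuotientGroup.mk δ : Rˣ ⧸ unitsOneModEight R)
  have hm : ∀ u v, m u = m v ↔ ∃ w : Rˣ, v = u * (w * w) := mk_div_mem_squares_iff b
  let f : Quotient s → m '' D := fun q => ⟨m (δ q.out), _, hδD _, rfl⟩
  have hf : Function.Bijective f := by
    constructor
    · intro p q hpq
      have h := congrArg Subtype.val hpq
      have h' := (hm _ _).1 h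
      rw [← h3 _ _ _ _ (hδ _) (hδ _)] at h'
      rw [← Quotient.out_eq p, ← Quotient.out_eq q]
      exact Quotient.sound h'
    · rintro ⟨-, ε, hε, rfl⟩
      obtain ⟨x, hx⟩ := h2 ε hε
      refine ⟨Quotient.mk s x, Subtype.ext ?_⟩
      change m (δ (Quotient.mk s x).out) = m ε
      rw [hm, ← h3 _ _ _ _ (hδ _) hx]
      exact Quotient.mk_out x
  have hcard : Nat.card (Quotient s) = Nat.card (m '' D) :=
    Nat.card_congr (Equiv.ofBijective f hf)
  refine ⟨Finite.of_injective f hf.1, ?_⟩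
  -- Stability under squares makes the image of `D` a union of cosets of the group of squares. Its
  -- size is the number of classes times the number of squares, and the latter is the order of the
  -- unit group modulo 8 divided by that of the kernel of squaring.
  have hpre : (fun δ : Rˣ => (QuotientGroup.mk δ : Rˣ ⧸ unitsOneModEight R)) '' D
      = QuotientGroup.mk ⁻¹' (m '' D) := by
    ext q
    constructor
    · rintro ⟨ε, hε, rfl⟩
      exact ⟨ε, hε, rfl⟩
    · induction q using QuotientGroup.induction_on with | H u => ?_
      rintro ⟨ε, hε, h⟩
      obtain ⟨w, rfl⟩ := (hm _ _).1 h
      exact ⟨_, hD _ hε w, rfl⟩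
  rw [hpre, Nat.card_congr (QuotientGroup.preimageMkEquivSubgroupProdSet _ _), Nat.card_prod,
    ← hcard]
  have hker := (sqModEight R).ker.card_eq_card_quotient_mul_card_subgroup
  rw [Nat.card_congr (QuotientGroup.quotientKerEquivRange _).toEquiv,
    (card_ker_sq_and_finite b).1] at hker
  rw [hker]
  change _ = _ * (Nat.card (sqModEight R).range * _)
  ring

include b in
/-- Half of the square roots of unity have norm one. -/
theorem card_sq_eq_one_of_odd (hn : Odd n) :
    Nat.card {u : R // u * u = 1}
      = Nat.card {u : R // u * u = 1 ∧ (Algebra.leftMulMatrix b u).det = 1} * 2 := by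
  have hneg : ∀ u : R, (Algebra.leftMulMatrix b (-u)).det = -(Algebra.leftMulMatrix b u).det := by
    intro u
    rw [map_neg, Matrix.det_neg, Fintype.card_fin, hn.neg_one_pow, neg_one_mul]
  -- The norm of a square root of unity is ±1, and u ↦ -u changes its sign because the rank is odd.
  let F : {u : R // u * u = 1 ∧ (Algebra.leftMulMatrix b u).det = 1} × Bool →
      {u : R // u * u = 1} := fun p =>
    if p.2 then ⟨p.1.1, p.1.2.1⟩ else ⟨-p.1.1, by rw [neg_mul_neg]; exact p.1.2.1⟩
  have hF : Function.Bijective F := by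
    constructor
    · rintro ⟨⟨u, hu, hu'⟩, p⟩ ⟨⟨v, hv, hv'⟩, q⟩ h
      have h1 := congrArg Subtype.val h
      have h11 : (1 : ℤ_[2]) ≠ -1 := by
        intro h
        have : (2 : ℤ_[2]) = 0 := by linear_combination h
        exact two_ne_zero this
      cases p <;> cases q <;> simp only [F, if_true, Bool.false_eq_true, if_false, neg_inj] at h1
      · subst h1; rfl
      · rw [← h1, hneg, hu'] at hv'; exact absurd hv'.symm h11
      · rw [h1, hneg, hv'] at hu'; exact absurd hu'.symm h11
      · subst h1; rfl
    · rintro ⟨u, hu⟩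
      have h1 : (Algebra.leftMulMatrix b u).det * (Algebra.leftMulMatrix b u).det = 1 := by
        rw [← Matrix.det_mul, ← map_mul, hu, map_one, Matrix.det_one]
      rcases mul_self_eq_one_iff.1 h1 with h | h
      · exact ⟨⟨⟨u, hu, h⟩, true⟩, by simp [F]⟩
      · exact ⟨⟨⟨-u, by rwa [neg_mul_neg], by rw [hneg, h, neg_neg]⟩, false⟩, by simp [F]⟩
  rw [← Nat.card_congr (Equiv.ofBijective F hF), Nat.card_prod]
  simp

end

end TwoAdicMass

/-! ### Projective pairs and cyclic vectors. -/

namespace TwoAdicMass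

open Polynomial MeasureTheory

noncomputable section

/-- A projective module over a semilocal ring with nonzero fibres has a functional that takes a
unit value. -/
theorem exists_isUnit_functional {R V : Type*} [CommRing R] [AddCommGroup V] [Module R V]
    [Module.Projective R V] [Finite (MaximalSpectrum R)]
    (h : ∀ m : MaximalSpectrum R, ∃ θ : V →ₗ[R] R ⧸ m.asIdeal, θ ≠ 0) :
    ∃ (φ : V →ₗ[R] R) (v : V), IsUnit (φ v) := by
  classical
  have := Fintype.ofFinite (MaximalSpectrum R)
  obtain ⟨s, hs⟩ := Module.projective_def'.1 (inferInstance : Module.Projective R V)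
  have hs' : ∀ v, (s v).sum (fun w r => r • w) = v := fun v => by
    have := LinearMap.congr_fun hs v
    simpa [Finsupp.linearCombination_apply] using this
  have h1 : ∀ m : MaximalSpectrum R, ∃ (φ : V →ₗ[R] R) (v : V), φ v ∉ m.asIdeal := fun m => by
    obtain ⟨θ, hθ⟩ := h m
    obtain ⟨v, hv⟩ : ∃ v, θ v ≠ 0 := by
      by_contra hc
      push Not at hc
      exact hθ (LinearMap.ext hc)
    by_contra hc
    push Not at hc
    apply hv
    rw [← hs' v, Finsupp.sum, map_sum]
    refine Finset.sum_eq_zero fun w _ => ?_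
    have hw := hc (Finsupp.lapply w ∘ₗ s) v
    rw [LinearMap.comp_apply, Finsupp.lapply_apply] at hw
    obtain ⟨r, hr⟩ := Ideal.Quotient.mk_surjective (θ w)
    rw [map_smul, ← hr, Algebra.smul_def, Ideal.Quotient.algebraMap_eq, ← map_mul,
      Ideal.Quotient.eq_zero_iff_mem]
    exact Ideal.mul_mem_right _ _ hw
  choose φ v hφ using h1
  have h2 : ∀ m m' : MaximalSpectrum R, ∃ c, c ∉ m.asIdeal ∧ (m' ≠ m → c ∈ m'.asIdeal) := by
    intro m m'
    by_cases hmm : m' = m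
    · exact ⟨1, (Ideal.ne_top_iff_one _).1 m.isMaximal.ne_top, fun h => absurd hmm h⟩
    · have : ¬ m'.asIdeal ≤ m.asIdeal := fun hle =>
        hmm (MaximalSpectrum.ext (m'.isMaximal.eq_of_le m.isMaximal.ne_top hle))
      obtain ⟨c, hc, hc'⟩ := SetLike.not_le_iff_exists.1 this
      exact ⟨c, hc', fun _ => hc⟩
  choose c hc hc' using h2
  -- Approximate idempotents: `e m` lies outside `m` and inside every other maximal ideal. They glue
  -- the local choices, since modulo each `m` only one term of either sum survives.
  let e : MaximalSpectrum R → R := fun m => ∏ m', c m m'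
  have he : ∀ m, e m ∉ m.asIdeal := fun m hm => by
    obtain ⟨m', -, hm'⟩ := (m.isMaximal.isPrime.prod_mem_iff (s := Finset.univ)).1 hm
    exact hc m m' hm'
  have he' : ∀ m m', m' ≠ m → e m ∈ m'.asIdeal := fun m m' hmm =>
    Ideal.mem_of_dvd _ (Finset.dvd_prod_of_mem (c m) (Finset.mem_univ m')) (hc' m m' hmm)
  refine ⟨∑ m, e m • φ m, ∑ m, e m • v m, ?_⟩
  by_contra hnu
  obtain ⟨I, hI, hmem⟩ := exists_max_ideal_of_mem_nonunits hnu
  let m₀ : MaximalSpectrum R := ⟨I, hI⟩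
  have key : (∑ m, e m • φ m) (∑ m, e m • v m) - e m₀ * (e m₀ * φ m₀ (v m₀)) ∈ m₀.asIdeal := by
    have hz : ∀ m, m ≠ m₀ → Ideal.Quotient.mk m₀.asIdeal (e m) = 0 := fun m hm =>
      Ideal.Quotient.eq_zero_iff_mem.2 (he' m m₀ hm.symm)
    rw [← Ideal.Quotient.eq_zero_iff_mem, map_sub, LinearMap.sum_apply, map_sum]
    rw [Finset.sum_eq_single m₀ (by
      intro m _ hm
      rw [LinearMap.smul_apply, smul_eq_mul, map_mul, hz m hm, zero_mul]) (by simp)]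
    rw [LinearMap.smul_apply, map_sum, smul_eq_mul, map_mul, map_sum]
    rw [Finset.sum_eq_single m₀ (by
      intro m _ hm
      rw [map_smul, smul_eq_mul, map_mul, hz m hm, zero_mul]) (by simp)]
    rw [map_smul, smul_eq_mul, map_mul, map_mul, map_mul, sub_self]
  have h3 : e m₀ * (e m₀ * φ m₀ (v m₀)) ∈ m₀.asIdeal := by
    have := Ideal.sub_mem _ hmem key
    rwa [sub_sub_cancel] at this
  rcases m₀.isMaximal.isPrime.mem_or_mem h3 with h4 | h4
  · exact he _ h4
  · rcases m₀.isMaximal.isPrime.mem_or_mem h4 with h5 | h5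
    · exact he _ h5
    · exact hφ _ h5

/-- As 2 lies in the Jacobson radical, a maximal ideal is determined by its image in the finite ring
R/2R. -/
theorem finite_maximalSpectrum {n : ℕ} {R : Type*} [CommRing R] [Algebra ℤ_[2] R]
    (b : Module.Basis (Fin n) ℤ_[2] R) : Finite (MaximalSpectrum R) := by
  have h2 : ∀ (m : MaximalSpectrum R) (y : R), 2 * y ∈ m.asIdeal := fun m y => by
    have h : (2 : R) ∈ Ideal.jacobson (⊥ : Ideal R) :=
      Ideal.mem_jacobson_bot.2 fun y => by
        rw [add_comm]
        exact isUnit_one_add_two_mul b y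
    have hm : (2 : R) ∈ m.asIdeal :=
      Ideal.mem_sInf.1 h ⟨bot_le, m.isMaximal⟩
    exact Ideal.mul_mem_right _ _ hm
  have hle : ∀ m m' : MaximalSpectrum R, coordTwo b '' m.asIdeal = coordTwo b '' m'.asIdeal →
      m.asIdeal ≤ m'.asIdeal := fun m m' h r hr => by
    obtain ⟨s, hs, hsr⟩ := h ▸ Set.mem_image_of_mem (coordTwo b) hr
    obtain ⟨y, hy⟩ := (coordTwo_eq_iff b s r).1 hsr
    have : r = s - 2 * y := by rw [← hy]; ring
    rw [this]
    exact Ideal.sub_mem _ hs (h2 m' y)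
  refine Finite.of_injective
    (fun m : MaximalSpectrum R => coordTwo b '' (m.asIdeal : Set R)) fun m m' h => ?_
  exact MaximalSpectrum.ext (le_antisymm (hle _ _ h) (hle _ _ h.symm))

variable {n : ℕ}

theorem vecMul_aeval {κ : Type*} [CommRing κ] [Algebra ℤ_[2] κ] (M : Matrix (Fin n) (Fin n) ℤ_[2])
    (w : Fin n → κ) (ξ : κ) (hw : w ᵥ* M.map (algebraMap ℤ_[2] κ) = ξ • w) (p : ℤ_[2][X]) :
    w ᵥ* (aeval M p).map (algebraMap ℤ_[2] κ) = (aeval ξ p) • w := by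
  induction p using Polynomial.induction_on' with
  | add p q hp hq =>
    rw [map_add, map_add, Matrix.map_add _ (map_add _), Matrix.vecMul_add, hp, hq, add_smul]
  | monomial k c =>
    have hk : w ᵥ* (M ^ k).map (algebraMap ℤ_[2] κ) = ξ ^ k • w := by
      induction k with
      | zero => simp
      | succ k ih =>
        rw [pow_succ, Matrix.map_mul, ← Matrix.vecMul_vecMul, ih, Matrix.smul_vecMul, hw, smul_smul,
          pow_succ]
    rw [aeval_monomial, aeval_monomial, ← Algebra.smul_def]
    have : (c • M ^ k).map (algebraMap ℤ_[2] κ)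
        = algebraMap ℤ_[2] κ c • (M ^ k).map (algebraMap ℤ_[2] κ) := by
      ext i j; simp
    rw [this, Matrix.vecMul_smul, hk, smul_smul]

/-- The vector `v` generates `ℤ_2 ^ n` under the action of `M`. -/
def IsCyclicVector (M : Matrix (Fin n) (Fin n) ℤ_[2]) (v : Fin n → ℤ_[2]) : Prop :=
  ∀ w, ∃ p : ℤ_[2][X], w = aeval M p *ᵥ v

/-- All fibres of the module are nonzero: over the residue field at `m` the class of x is an
eigenvalue of `M`, and a left eigenvector gives a nonzero functional. Semilocality then yields a
functional to R with a unit value at some v. It is onto, hence bijective by comparing ranks, so v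
generates. -/
theorem exists_isCyclicVector_of_isProjectivePair {A B : Matrix (Fin n) (Fin n) ℤ_[2]}
    (h : IsProjectivePair A B) : ∃ v, IsCyclicVector (A⁻¹ * B) v := by
  unfold IsProjectivePair at h
  generalize A⁻¹ * B = M at h ⊢
  obtain ⟨b, -⟩ := exists_basis_adjoinRoot (Matrix.charpoly_monic M) (n := n) (by
    rw [Matrix.charpoly_natDegree_eq_dim, Fintype.card_fin])
  change Module.Basis (Fin n) ℤ_[2] (ℤ_[2][X] ⧸ Ideal.span {M.charpoly}) at b
  let : Module (ℤ_[2][X] ⧸ Ideal.span {M.charpoly}) (Fin n → ℤ_[2]) :=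
    Module.compHom (Fin n → ℤ_[2]) (quotientAction M)
  have hproj : Module.Projective (ℤ_[2][X] ⧸ Ideal.span {M.charpoly}) (Fin n → ℤ_[2]) := h
  have hsmul : ∀ (p : ℤ_[2][X]) (w : Fin n → ℤ_[2]),
      (Ideal.Quotient.mk (Ideal.span {M.charpoly}) p) • w = aeval M p *ᵥ w := fun p w => rfl
  have hfin := finite_maximalSpectrum b
  obtain ⟨φ, v, hφv⟩ := exists_isUnit_functional (R := ℤ_[2][X] ⧸ Ideal.span {M.charpoly})
    (V := Fin n → ℤ_[2]) (fun m => by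
      let κ := (ℤ_[2][X] ⧸ Ideal.span {M.charpoly}) ⧸ m.asIdeal
      let : Field κ := @Ideal.Quotient.field _ _ m.asIdeal m.isMaximal
      let ξ : κ := Ideal.Quotient.mk m.asIdeal (Ideal.Quotient.mk _ X)
      have hξ : ∀ p : ℤ_[2][X], aeval ξ p
          = Ideal.Quotient.mk m.asIdeal (Ideal.Quotient.mk (Ideal.span {M.charpoly}) p) := by
        intro p
        have h1 := aeval_algHom_apply (Ideal.Quotient.mkₐ ℤ_[2] (Ideal.span {M.charpoly})) X p
        rw [aeval_X_left_apply] at h1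
        have h2 := aeval_algHom_apply (Ideal.Quotient.mkₐ ℤ_[2] m.asIdeal)
          (Ideal.Quotient.mkₐ ℤ_[2] (Ideal.span {M.charpoly}) X) p
        rw [h1] at h2
        exact h2
      have hdet : (Matrix.scalar (Fin n) ξ - M.map (algebraMap ℤ_[2] κ)).det = 0 := by
        rw [← Matrix.eval_charpoly, Matrix.charpoly_map, eval_map_algebraMap, hξ]
        rw [Ideal.Quotient.eq_zero_iff_mem.2 (Ideal.mem_span_singleton_self _), map_zero]
      obtain ⟨w, hw0, hw⟩ := Matrix.exists_vecMul_eq_zero_iff.2 hdet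
      have hw' : w ᵥ* M.map (algebraMap ℤ_[2] κ) = ξ • w := by
        rw [Matrix.vecMul_sub, sub_eq_zero] at hw
        rw [← hw, Matrix.scalar_apply]
        ext i
        simp [Matrix.vecMul_diagonal, mul_comm]
      let θ : (Fin n → ℤ_[2]) →ₗ[ℤ_[2][X] ⧸ Ideal.span {M.charpoly}] κ :=
        { toFun := fun u => w ⬝ᵥ fun i => algebraMap ℤ_[2] κ (u i)
          map_add' := fun u u' => by
            simp only [Pi.add_apply, map_add]
            exact dotProduct_add w _ _
          map_smul' := fun r u => by
            obtain ⟨p, rfl⟩ := Ideal.Quotient.mk_surjective r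
            have h1 : (fun i => algebraMap ℤ_[2] κ ((aeval M p *ᵥ u) i))
                = (aeval M p).map (algebraMap ℤ_[2] κ) *ᵥ fun i => algebraMap ℤ_[2] κ (u i) := by
              ext i; simp [Matrix.mulVec, dotProduct]
            rw [hsmul, h1, Matrix.dotProduct_mulVec, vecMul_aeval M w ξ hw' p, smul_dotProduct, hξ]
            rfl }
      refine ⟨θ, fun h0 => hw0 ?_⟩
      ext i
      have h1 := LinearMap.congr_fun h0 (Pi.single i 1)
      have h2 : (fun j => algebraMap ℤ_[2] κ ((Pi.single i 1 : Fin n → ℤ_[2]) j))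
          = Pi.single i 1 := by
        ext j
        by_cases hij : j = i
        · subst hij; simp
        · simp [hij]
      change w ⬝ᵥ (fun j => algebraMap ℤ_[2] κ ((Pi.single i 1 : Fin n → ℤ_[2]) j)) = 0 at h1
      rw [h2, dotProduct_single, mul_one] at h1
      exact h1)
  refine ⟨v, fun w => ?_⟩
  obtain ⟨u, hu⟩ := hφv
  let φ' : (Fin n → ℤ_[2]) →ₗ[ℤ_[2]] (ℤ_[2][X] ⧸ Ideal.span {M.charpoly}) :=
    { toFun := φ
      map_add' := map_add φ
      map_smul' := fun c w => by
        have : c • w = (Ideal.Quotient.mk (Ideal.span {M.charpoly}) (C c)) • w := by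
          rw [hsmul, aeval_C, Algebra.algebraMap_eq_smul_one, Matrix.smul_mulVec, Matrix.one_mulVec]
        rw [this, map_smul, RingHom.id_apply]
        obtain ⟨q, hq⟩ := Ideal.Quotient.mk_surjective (φ w)
        rw [← hq, smul_eq_mul, ← map_mul, ← smul_eq_C_mul]
        rfl }
  have hsurj : Function.Surjective φ' := fun r =>
    ⟨(r * ↑u⁻¹) • v, by
      change φ _ = r
      rw [map_smul, smul_eq_mul, ← hu, mul_assoc, Units.inv_mul, mul_one]⟩
  have := Module.Free.of_basis b
  have := Module.Finite.of_basis b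
  have hbij := OrzechProperty.bijective_of_surjective_of_finrank_le φ' hsurj (by
    rw [Module.finrank_eq_card_basis b]; simp)
  obtain ⟨p, hp⟩ := Ideal.Quotient.mk_surjective
    (φ w * ((u⁻¹ : (ℤ_[2][X] ⧸ Ideal.span {M.charpoly})ˣ) : ℤ_[2][X] ⧸ Ideal.span {M.charpoly}))
  refine ⟨p, ?_⟩
  rw [← hsmul]
  refine hbij.1 ?_
  change φ w = φ _
  rw [map_smul, hp, smul_eq_mul, ← hu, mul_assoc, Units.inv_mul, mul_one]

/-- The matrix with columns `v, M v, M² v, …`. -/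
def krylov (M : Matrix (Fin n) (Fin n) ℤ_[2]) (v : Fin n → ℤ_[2]) : Matrix (Fin n) (Fin n) ℤ_[2] :=
  Matrix.of fun i j => (M ^ (j : ℕ) *ᵥ v) i

/-- In the basis of powers of x, the Krylov matrix is the map r ↦ r · v from R to ℤ_2^n.
Cayley–Hamilton reduces to polynomials of degree below n. -/
theorem krylov_mulVec_repr_mk {M : Matrix (Fin n) (Fin n) ℤ_[2]} {f : ℤ_[2][X]}
    (hM : M.charpoly = f) (v : Fin n → ℤ_[2]) (b : Module.Basis (Fin n) ℤ_[2] (AdjoinRoot f))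
    (hb : ∀ i, b i = AdjoinRoot.root f ^ (i : ℕ)) (p : ℤ_[2][X]) :
    krylov M v *ᵥ b.repr (AdjoinRoot.mk f p) = aeval M p *ᵥ v := by
  subst hM
  have hmod : AdjoinRoot.mk M.charpoly p = AdjoinRoot.mk M.charpoly (p %ₘ M.charpoly) := by
    rw [AdjoinRoot.mk_eq_mk]
    exact ⟨p /ₘ M.charpoly, by
      rw [sub_eq_iff_eq_add, add_comm, Polynomial.modByMonic_add_div p]⟩
  rw [Matrix.aeval_eq_aeval_mod_charpoly, hmod]
  have hdeg : (p %ₘ M.charpoly).degree < n := by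
    have := degree_modByMonic_lt p (Matrix.charpoly_monic M)
    rwa [Matrix.charpoly_degree_eq_dim, Fintype.card_fin] at this
  generalize p %ₘ M.charpoly = q at hdeg
  have hq : q = ∑ i : Fin n, C (q.coeff i) * X ^ (i : ℕ) := by
    rw [Fin.sum_univ_eq_sum_range (fun i => C (q.coeff i) * X ^ i)]
    by_cases h0 : q = 0
    · simp [h0]
    · exact q.as_sum_range_C_mul_X_pow' ((natDegree_lt_iff_degree_lt h0).2 hdeg)
  have hrepr : (b.repr (AdjoinRoot.mk M.charpoly q) : Fin n → ℤ_[2]) = fun i : Fin n => q.coeff i := by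
    have : AdjoinRoot.mk M.charpoly q = ∑ i : Fin n, q.coeff i • b i := by
      conv_lhs => rw [hq]
      rw [map_sum]
      refine Finset.sum_congr rfl fun i _ => ?_
      rw [hb, map_mul, map_pow, AdjoinRoot.mk_X, AdjoinRoot.mk_C, Algebra.smul_def]
      rfl
    rw [this]
    ext i
    rw [b.repr_sum_self]
  rw [hrepr]
  conv_rhs => rw [hq]
  rw [map_sum, Matrix.sum_mulVec]
  ext i
  rw [Finset.sum_apply]
  simp only [Matrix.mulVec, dotProduct, krylov, Matrix.of_apply]
  refine Finset.sum_congr rfl fun j _ => ?_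
  rw [map_mul, aeval_C, map_pow, aeval_X, ← Algebra.smul_def]
  simp only [Matrix.smul_apply, smul_eq_mul, Finset.sum_mul]
  refine Finset.sum_congr rfl fun k _ => ?_
  ring

theorem isUnit_det_krylov {M : Matrix (Fin n) (Fin n) ℤ_[2]} {v : Fin n → ℤ_[2]}
    (hv : IsCyclicVector M v) : IsUnit (krylov M v).det := by
  obtain ⟨b, hb⟩ := exists_basis_adjoinRoot (Matrix.charpoly_monic M) (n := n) (by
    rw [Matrix.charpoly_natDegree_eq_dim, Fintype.card_fin])
  rw [← Matrix.isUnit_iff_isUnit_det, ← Matrix.mulVec_surjective_iff_isUnit]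
  intro w
  obtain ⟨p, rfl⟩ := hv w
  exact ⟨_, krylov_mulVec_repr_mk rfl v b hb p⟩

theorem mul_krylov {M : Matrix (Fin n) (Fin n) ℤ_[2]} {f : ℤ_[2][X]}
    (hM : M.charpoly = f) (v : Fin n → ℤ_[2]) (b : Module.Basis (Fin n) ℤ_[2] (AdjoinRoot f))
    (hb : ∀ i, b i = AdjoinRoot.root f ^ (i : ℕ)) :
    M * krylov M v = krylov M v * Algebra.leftMulMatrix b (AdjoinRoot.root f) := by
  refine Matrix.ext_of_mulVec_single fun j => ?_
  have hs : (Pi.single j 1 : Fin n → ℤ_[2]) = b.repr (AdjoinRoot.mk f (X ^ (j : ℕ))) := by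
    rw [map_pow, AdjoinRoot.mk_X, ← hb, b.repr_self]
    ext i
    rw [Finsupp.single_apply, Pi.single_apply]
    simp [eq_comm]
  rw [hs, ← Matrix.mulVec_mulVec, ← Matrix.mulVec_mulVec, krylov_mulVec_repr_mk hM v b hb,
    Algebra.leftMulMatrix_mulVec_repr, ← AdjoinRoot.mk_X, ← map_mul,
    krylov_mulVec_repr_mk hM v b hb, map_mul, aeval_X, ← Matrix.mulVec_mulVec]

theorem isProjectivePair_of_isCyclicVector {A B : Matrix (Fin n) (Fin n) ℤ_[2]} {v : Fin n → ℤ_[2]}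
    (hv : IsCyclicVector (A⁻¹ * B) v) : IsProjectivePair A B := by
  unfold IsProjectivePair
  generalize A⁻¹ * B = M at hv ⊢
  let : Module (ℤ_[2][X] ⧸ Ideal.span {M.charpoly}) (Fin n → ℤ_[2]) :=
    Module.compHom (Fin n → ℤ_[2]) (quotientAction M)
  change Module.Projective (ℤ_[2][X] ⧸ Ideal.span {M.charpoly}) (Fin n → ℤ_[2])
  have hsmul : ∀ (p : ℤ_[2][X]) (w : Fin n → ℤ_[2]),
      (Ideal.Quotient.mk (Ideal.span {M.charpoly}) p) • w = aeval M p *ᵥ w := fun p w => rfl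
  obtain ⟨b, hb⟩ := exists_basis_adjoinRoot (Matrix.charpoly_monic M) (n := n) (by
    rw [Matrix.charpoly_natDegree_eq_dim, Fintype.card_fin])
  have hbij : Function.Bijective
      (LinearMap.toSpanSingleton (ℤ_[2][X] ⧸ Ideal.span {M.charpoly}) (Fin n → ℤ_[2]) v) := by
    refine ⟨(injective_iff_map_eq_zero _).2 fun r hr => ?_, fun w => ?_⟩
    · obtain ⟨p, rfl⟩ := Ideal.Quotient.mk_surjective r
      rw [LinearMap.toSpanSingleton_apply, hsmul, ← krylov_mulVec_repr_mk rfl v b hb] at hr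
      have h0 := Matrix.eq_zero_of_mulVec_eq_zero (isUnit_det_krylov hv).ne_zero hr
      exact b.repr.map_eq_zero_iff.1 (DFunLike.coe_injective h0)
    · obtain ⟨p, rfl⟩ := hv w
      exact ⟨Ideal.Quotient.mk _ p, hsmul p v⟩
  exact Module.Projective.of_equiv (LinearEquiv.ofBijective _ hbij)

theorem aeval_mul_of_mul_eq {M N K : Matrix (Fin n) (Fin n) ℤ_[2]} (h : M * K = K * N)
    (p : ℤ_[2][X]) : aeval M p * K = K * aeval N p := by
  induction p using Polynomial.induction_on' with
  | add p q hp hq => rw [map_add, map_add, Matrix.add_mul, Matrix.mul_add, hp, hq]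
  | monomial k c =>
    have hk : M ^ k * K = K * N ^ k := by
      induction k with
      | zero => simp
      | succ k ih => rw [pow_succ', Matrix.mul_assoc, ih, ← Matrix.mul_assoc, h, Matrix.mul_assoc,
          ← pow_succ']
    rw [aeval_monomial, aeval_monomial, ← Algebra.smul_def, ← Algebra.smul_def, Matrix.smul_mul,
      Matrix.mul_smul, hk]

/-- M and M - c generate the same algebra of matrices, so projectivity survives translations. -/
theorem isCyclicVector_comp {M : Matrix (Fin n) (Fin n) ℤ_[2]} {v : Fin n → ℤ_[2]}
    (hv : IsCyclicVector M v) (c : ℤ_[2]) : IsCyclicVector (M - c • 1) v := fun w => by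
  obtain ⟨p, rfl⟩ := hv w
  refine ⟨p.comp (X + C c), ?_⟩
  rw [aeval_comp, map_add, aeval_X, aeval_C, Algebra.algebraMap_eq_smul_one, sub_add_cancel]

/-- A pair is projective exactly when `ℤ_2 ^ n` has a cyclic vector. -/
theorem isProjectivePair_iff {A B : Matrix (Fin n) (Fin n) ℤ_[2]} :
    IsProjectivePair A B ↔ ∃ v, IsCyclicVector (A⁻¹ * B) v :=
  ⟨exists_isCyclicVector_of_isProjectivePair, fun ⟨_, hv⟩ => isProjectivePair_of_isCyclicVector hv⟩

variable {f : ℤ_[2][X]} (b : Module.Basis (Fin n) ℤ_[2] (AdjoinRoot f))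

/-- In the Krylov basis of a cyclic vector, A⁻¹B becomes multiplication by x. Symmetry of `A` and
`B` makes x self-adjoint for the transported `A`, which is therefore the Gram matrix of a
functional. -/
theorem exists_isFrame (hb : ∀ i, b i = AdjoinRoot.root f ^ (i : ℕ))
    {A B : Matrix (Fin n) (Fin n) ℤ_[2]} (hA : IsUnit A.det) (hAs : A.IsSymm) (hBs : B.IsSymm)
    (hf : (A⁻¹ * B).charpoly = f) (hp : IsProjectivePair A B) :
    ∃ φ K, IsFrame b (AdjoinRoot.root f) A B φ K := by
  obtain ⟨v, hv⟩ := isProjectivePair_iff.1 hp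
  have h1 := mul_krylov hf v b hb
  have hdet := isUnit_det_krylov hv
  generalize krylov (A⁻¹ * B) v = K at h1 hdet
  have h2 : B * K = A * K * Algebra.leftMulMatrix b (AdjoinRoot.root f) := by
    rw [Matrix.mul_assoc, ← h1, ← Matrix.mul_assoc, ← Matrix.mul_assoc,
      Matrix.mul_nonsing_inv A hA, Matrix.one_mul]
  have h3 : Kᵀ * B * K = Kᵀ * A * K * Algebra.leftMulMatrix b (AdjoinRoot.root f) := by
    rw [Matrix.mul_assoc, h2]; simp only [Matrix.mul_assoc]
  obtain ⟨ψ, hψ⟩ := exists_eq_gramOf b hb (H := Kᵀ * A * K) (by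
    rw [← h3]
    have h4 := congrArg Matrix.transpose h3
    simp only [Matrix.transpose_mul, Matrix.transpose_transpose, hAs.eq, hBs.eq] at h4
    simp only [Matrix.mul_assoc] at h4 ⊢
    exact h4.symm)
  exact ⟨ψ, K, hdet, hψ, by rw [h3, hψ]⟩

theorem IsFrame.mul_eq {A B K : Matrix (Fin n) (Fin n) ℤ_[2]} {x : AdjoinRoot f}
    {φ : AdjoinRoot f →ₗ[ℤ_[2]] ℤ_[2]} (h : IsFrame b x A B φ K) (hA : IsUnit A.det) :
    A⁻¹ * B * K = K * Algebra.leftMulMatrix b x := by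
  have hKt : IsUnit (Kᵀ).det := by rw [Matrix.det_transpose]; exact h.isUnit_det
  have h1 := h.right
  rw [← h.left, Matrix.mul_assoc, Matrix.mul_assoc, Matrix.mul_assoc] at h1
  have h2 := congrArg ((Kᵀ)⁻¹ * ·) h1
  simp only [← Matrix.mul_assoc, Matrix.nonsing_inv_mul _ hKt, Matrix.one_mul] at h2
  rw [Matrix.mul_assoc, h2]
  simp only [← Matrix.mul_assoc, Matrix.nonsing_inv_mul _ hA, Matrix.one_mul]

theorem IsFrame.isProjectivePair {A B K : Matrix (Fin n) (Fin n) ℤ_[2]}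
    {φ : AdjoinRoot f →ₗ[ℤ_[2]] ℤ_[2]} (h : IsFrame b (AdjoinRoot.root f) A B φ K)
    (hA : IsUnit A.det) : IsProjectivePair A B := by
  refine isProjectivePair_iff.2 ⟨K *ᵥ b.repr 1, fun w => ?_⟩
  obtain ⟨p, hp⟩ := AdjoinRoot.mk_surjective (b.equivFun.symm (K⁻¹ *ᵥ w))
  refine ⟨p, ?_⟩
  have h1 : (b.repr (AdjoinRoot.mk f p) : Fin n → ℤ_[2]) = K⁻¹ *ᵥ w := by
    rw [hp]; exact b.equivFun.apply_symm_apply _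
  have h2 : aeval (Algebra.leftMulMatrix b (AdjoinRoot.root f)) p
      = Algebra.leftMulMatrix b (AdjoinRoot.mk f p) := by
    rw [aeval_algHom_apply, AdjoinRoot.aeval_eq]
  rw [Matrix.mulVec_mulVec, aeval_mul_of_mul_eq (h.mul_eq b hA), ← Matrix.mulVec_mulVec, h2,
    Algebra.leftMulMatrix_mulVec_repr, mul_one, h1, Matrix.mulVec_mulVec,
    Matrix.mul_nonsing_inv _ h.isUnit_det, Matrix.one_mulVec]

theorem charpoly_leftMulMatrix_root (hf : f.Monic) (hn : f.natDegree = n) :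
    (Algebra.leftMulMatrix b (AdjoinRoot.root f)).charpoly = f := by
  have h1 : f ∣ (Algebra.leftMulMatrix b (AdjoinRoot.root f)).charpoly := by
    have h2 := Matrix.aeval_self_charpoly (Algebra.leftMulMatrix b (AdjoinRoot.root f))
    rw [aeval_algHom_apply, AdjoinRoot.aeval_eq] at h2
    exact AdjoinRoot.mk_eq_zero.1 ((map_eq_zero_iff _ (Algebra.leftMulMatrix_injective b)).1 h2)
  refine (eq_of_monic_of_dvd_of_natDegree_le hf (Matrix.charpoly_monic _) h1 ?_)
  rw [Matrix.charpoly_natDegree_eq_dim, Fintype.card_fin, hn]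

end

end TwoAdicMass

/-! ### The local mass as a count modulo 8. -/

namespace TwoAdicMass

open Polynomial MeasureTheory

noncomputable section

/-- The monic polynomial `x ^ n + ∑ i, a i x ^ i`. -/
def monicOf {n : ℕ} {R : Type*} [CommRing R] (a : Fin n → R) : R[X] :=
  X ^ n + ∑ i, C (a i) * X ^ (i : ℕ)

variable {n : ℕ}

theorem degree_sum_C_mul_X_pow_lt {R : Type*} [CommRing R] (a : Fin n → R) :
    (∑ i, C (a i) * X ^ (i : ℕ)).degree < (n : WithBot ℕ) := by
  refine (degree_sum_le _ _).trans_lt ?_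
  rw [Finset.sup_lt_iff (WithBot.bot_lt_coe _)]
  intro i _
  exact (degree_C_mul_X_pow_le _ _).trans_lt (by exact_mod_cast i.2)

theorem monicOf_monic {R : Type*} [CommRing R] (a : Fin n → R) : (monicOf a).Monic :=
  monic_X_pow_add (degree_sum_C_mul_X_pow_lt a)

theorem natDegree_monicOf {R : Type*} [CommRing R] [Nontrivial R] (a : Fin n → R) :
    (monicOf a).natDegree = n := by
  rw [monicOf, natDegree_add_eq_left_of_degree_lt, natDegree_X_pow]
  rw [degree_X_pow]
  exact degree_sum_C_mul_X_pow_lt a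

theorem root_monicOf_pow (a : Fin n → ℤ_[2]) :
    AdjoinRoot.root (monicOf a) ^ n
      = ∑ i, (-a i) • AdjoinRoot.root (monicOf a) ^ (i : ℕ) := by
  have h : AdjoinRoot.mk (monicOf a) (X ^ n + ∑ i, C (a i) * X ^ (i : ℕ)) = 0 :=
    AdjoinRoot.mk_self
  rw [map_add, map_pow, AdjoinRoot.mk_X, map_sum] at h
  rw [eq_neg_of_add_eq_zero_left h, ← Finset.sum_neg_distrib]
  refine Finset.sum_congr rfl fun i _ => ?_
  rw [map_mul, map_pow, AdjoinRoot.mk_X, AdjoinRoot.mk_C, neg_smul, Algebra.smul_def]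
  rfl

variable {a : Fin n → ℤ_[2]} (b : Module.Basis (Fin n) ℤ_[2] (AdjoinRoot (monicOf a)))

theorem functional_root_pow (hb : ∀ i, b i = AdjoinRoot.root (monicOf a) ^ (i : ℕ))
    (ψ : AdjoinRoot (monicOf a) →ₗ[ℤ_[2]] ℤ_[2]) (m : ℕ) :
    ψ (AdjoinRoot.root (monicOf a) ^ m) = recSeq a (fun i => ψ (b i)) m := by
  refine eq_recSeq (u := fun m => ψ (AdjoinRoot.root (monicOf a) ^ m)) (fun m => ?_)
    (fun i => by rw [hb]) m
  rw [pow_add, root_monicOf_pow, Finset.mul_sum, map_sum]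
  refine Finset.sum_congr rfl fun i _ => ?_
  rw [mul_smul_comm, map_smul, pow_add, smul_eq_mul]

theorem gramOf_eq_recGram (hb : ∀ i, b i = AdjoinRoot.root (monicOf a) ^ (i : ℕ))
    (ψ : AdjoinRoot (monicOf a) →ₗ[ℤ_[2]] ℤ_[2]) :
    gramOf b ψ = recGram a fun i => ψ (b i) := by
  ext i j
  simp only [gramOf, recGram, hankel, Matrix.of_apply]
  rw [← functional_root_pow b hb, hb, hb, pow_add]

/-- The algebra of a monic polynomial carries a unimodular trace form. -/
theorem exists_isUnit_det_gramOf (hb : ∀ i, b i = AdjoinRoot.root (monicOf a) ^ (i : ℕ)) :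
    ∃ φ, IsUnit (gramOf b φ).det := by
  obtain _ | k := n
  · exact ⟨0, by simp⟩
  -- The coefficient of the top power of x vanishes on lower powers, so the Gram matrix is zero
  -- above the antidiagonal and 1 on it. Reversing the rows makes it upper unitriangular.
  refine ⟨b.coord (Fin.last k), ?_⟩
  have hval : ∀ m : ℕ, m ≤ k → b.coord (Fin.last k) (AdjoinRoot.root (monicOf a) ^ m)
      = if m = k then 1 else 0 := by
    intro m hm
    have := hb ⟨m, by omega⟩
    rw [← this, b.coord_apply, b.repr_self, Finsupp.single_apply]
    simp [Fin.ext_iff]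
  have hent : ∀ i j, (gramOf b (b.coord (Fin.last k))) i j
      = b.coord (Fin.last k) (AdjoinRoot.root (monicOf a) ^ ((i : ℕ) + j)) := by
    intro i j
    simp only [gramOf, Matrix.of_apply]
    rw [hb, hb, pow_add]
  have htri : ((gramOf b (b.coord (Fin.last k))).submatrix Fin.revPerm id).IsUpperTriangular := by
    intro i j hij
    have hij' : (j : ℕ) < i := hij
    have := i.2
    rw [Matrix.submatrix_apply, hent, hval, if_neg]
    all_goals
      simp only [Fin.revPerm_apply, Fin.val_rev, id]
      omega
  have hdet := Matrix.det_of_isUpperTriangular htri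
  rw [Matrix.det_permute, Finset.prod_eq_one] at hdet
  · exact IsUnit.of_mul_eq_one _ ((mul_comm _ _).trans hdet)
  · intro i _
    have := i.2
    rw [Matrix.submatrix_apply, hent, hval, if_pos]
    all_goals
      simp only [Fin.revPerm_apply, Fin.val_rev, id]
      omega

/-- Lets the quotient of the units by 1 + 8R be replaced by concrete data, here the values modulo 8
of a twisted functional. -/
theorem card_image_mk_eq {R : Type*} [CommRing R] {α : Type*} (T : Rˣ → α)
    (hT : ∀ u v : Rˣ, T u = T v ↔ ∃ r, (u : R) - v = 8 * r) (D : Set Rˣ) :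
    Nat.card ((fun δ : Rˣ => (QuotientGroup.mk δ : Rˣ ⧸ unitsOneModEight R)) '' D)
      = Nat.card (T '' D) := by
  let T' : Rˣ ⧸ unitsOneModEight R → α := fun q => T q.out
  have hT' : ∀ δ, T' (QuotientGroup.mk δ) = T δ := fun δ => by
    rw [hT, ← unitsOneModEight_mk_eq_iff_sub, QuotientGroup.out_eq']
  have hinj : Function.Injective T' := by
    intro p q h
    rw [← QuotientGroup.out_eq' p, ← QuotientGroup.out_eq' q]
    exact (unitsOneModEight_mk_eq_iff_sub _ _).2 ((hT _ _).1 h)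
  rw [← Nat.card_image_of_injective hinj, Set.image_image]
  simp only [hT']

/-- The values modulo 8 of a twisted functional on the basis. -/
def twistEight (φ : AdjoinRoot (monicOf a) →ₗ[ℤ_[2]] ℤ_[2]) (δ : (AdjoinRoot (monicOf a))ˣ) :
    Fin n → ZMod 8 :=
  redEight ∘ fun i => twist φ (δ : AdjoinRoot (monicOf a)) (b i)

variable {b} in
theorem map_gramOf_twist (hb : ∀ i, b i = AdjoinRoot.root (monicOf a) ^ (i : ℕ))
    (φ : AdjoinRoot (monicOf a) →ₗ[ℤ_[2]] ℤ_[2]) (δ : (AdjoinRoot (monicOf a))ˣ) :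
    (gramOf b (twist φ (δ : AdjoinRoot (monicOf a)))).map redEight
      = recGram (redEight ∘ a) (twistEight b φ δ) := by
  rw [gramOf_eq_recGram b hb, recGram_map]
  rfl

variable {b} in
theorem twistEight_eq_iff {φ : AdjoinRoot (monicOf a) →ₗ[ℤ_[2]] ℤ_[2]}
    (hφ : IsUnit (gramOf b φ).det) (δ ε : (AdjoinRoot (monicOf a))ˣ) :
    twistEight b φ δ = twistEight b φ ε
      ↔ ∃ r, (δ : AdjoinRoot (monicOf a)) - ε = 8 * r := by
  have h8 : ∀ y : AdjoinRoot (monicOf a), φ (8 * y) = 8 * φ y := fun y => by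
    have : (8 : AdjoinRoot (monicOf a)) * y = (8 : ℤ_[2]) • y := by
      rw [Algebra.smul_def, map_ofNat]
    rw [this, map_smul, smul_eq_mul]
  constructor
  · intro h
    have h1 : ∀ i, ∃ y, twist φ (δ : AdjoinRoot (monicOf a)) (b i)
        - twist φ (ε : AdjoinRoot (monicOf a)) (b i) = 8 * y := fun i =>
      (redEight_eq_iff _ _).1 (congrFun h i)
    choose y hy using h1
    obtain ⟨r, hr⟩ := twist_surjective hφ (b.constr ℤ_[2] y)
    refine ⟨r, twist_injective hφ (b.ext fun i => ?_)⟩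
    have h2 := LinearMap.congr_fun hr (b i)
    rw [b.constr_basis] at h2
    rw [twist_apply, twist_apply, mul_assoc, h8, ← twist_apply φ r, h2, ← hy]
    simp only [twist_apply, sub_mul, map_sub]
  · rintro ⟨r, hr⟩
    funext i
    refine (redEight_eq_iff _ _).2 ⟨φ (r * b i), ?_⟩
    change φ (δ * b i) - φ (ε * b i) = _
    rw [← map_sub, ← sub_mul, hr, mul_assoc, h8]

variable {b} in
theorem exists_twistEight_eq (hb : ∀ i, b i = AdjoinRoot.root (monicOf a) ^ (i : ℕ))
    {φ : AdjoinRoot (monicOf a) →ₗ[ℤ_[2]] ℤ_[2]}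
    (hφ : IsUnit (gramOf b φ).det) {s : Fin n → ZMod 8}
    (hs : IsUnit (recGram (redEight ∘ a) s).det) : ∃ δ, twistEight b φ δ = s := by
  choose s' hs' using fun i => redEight_surjective (s i)
  obtain ⟨u, hu⟩ := twist_surjective hφ (b.constr ℤ_[2] s')
  have h1 : (fun i => twist φ u (b i)) = s' := by
    funext i
    rw [hu, b.constr_basis]
  have h2 : redEight ∘ s' = s := funext hs'
  have h3 : IsUnit u := by
    rw [← isUnit_det_gramOf_twist_iff hφ, ← isUnit_det_redEight_iff, gramOf_eq_recGram b hb,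
      recGram_map, h1, h2]
    exact hs
  obtain ⟨δ, rfl⟩ := h3
  exact ⟨δ, by rw [twistEight, h1, h2]⟩

variable {b} in
/-- The units of the algebra modulo 8 are the unimodular functionals. -/
theorem card_quotient_unitsOneModEight (hb : ∀ i, b i = AdjoinRoot.root (monicOf a) ^ (i : ℕ)) :
    Nat.card ((AdjoinRoot (monicOf a))ˣ ⧸ unitsOneModEight (AdjoinRoot (monicOf a)))
      = (unimodularEight (redEight ∘ a)).card := by
  obtain ⟨φ, hφ⟩ := exists_isUnit_det_gramOf b hb
  have h := card_image_mk_eq (twistEight b φ) (twistEight_eq_iff hφ) Set.univ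
  rw [Set.image_univ, Set.range_eq_univ.2 QuotientGroup.mk_surjective, Nat.card_univ,
    Nat.card_coe_set_eq] at h
  rw [h, ← Set.ncard_coe_finset]
  congr 1
  ext s
  simp only [Set.image_univ, Set.mem_range, unimodularEight, Finset.coe_filter, Finset.mem_univ,
    true_and, Set.mem_ofPred_eq]
  refine ⟨?_, exists_twistEight_eq hb hφ⟩
  rintro ⟨δ, rfl⟩
  rw [← map_gramOf_twist hb, isUnit_det_redEight_iff, isUnit_det_gramOf_twist_iff hφ]
  exact δ.isUnit

variable {b} in
theorem card_image_mk_congruent (hb : ∀ i, b i = AdjoinRoot.root (monicOf a) ^ (i : ℕ))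
    {φ : AdjoinRoot (monicOf a) →ₗ[ℤ_[2]] ℤ_[2]} (hφ : IsUnit (gramOf b φ).det)
    {A : Matrix (Fin n) (Fin n) ℤ_[2]} (hA : IsUnit A.det) (hAs : A.IsSymm) :
    Nat.card ((fun δ : (AdjoinRoot (monicOf a))ˣ =>
        (QuotientGroup.mk δ : _ ⧸ unitsOneModEight (AdjoinRoot (monicOf a)))) ''
        {δ | Congruent A (gramOf b (twist φ (δ : AdjoinRoot (monicOf a))))})
      = (gramClass (A.map redEight) (redEight ∘ a)).card := by
  rw [card_image_mk_eq (twistEight b φ) (twistEight_eq_iff hφ), Nat.card_coe_set_eq,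
    ← Set.ncard_coe_finset]
  congr 1
  ext s
  simp only [Set.mem_image, gramClass, Finset.coe_filter, Finset.mem_univ,
    true_and, Set.mem_ofPred_eq]
  constructor
  · rintro ⟨δ, hδ, rfl⟩
    rw [← map_gramOf_twist hb]
    exact hδ.map redEight
  · intro h
    have hu : IsUnit (recGram (redEight ∘ a) s).det := by
      obtain ⟨K, hK, hKs⟩ := h
      rw [← hKs, Matrix.det_mul, Matrix.det_mul, Matrix.det_transpose]
      exact (hK.mul ((isUnit_det_redEight_iff A).2 hA)).mul hK
    obtain ⟨δ, rfl⟩ := exists_twistEight_eq hb hφ hu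
    rw [← map_gramOf_twist hb, ← congruent_iff_map_redEight _ _ hAs (gramOf_isSymm _ _) hA] at h
    exact ⟨δ, h, rfl⟩

variable {b} in
/-- The orbits of a fibre are the classes of units modulo squares whose form is congruent to `A`. -/
theorem card_orbits_mul_card (hn : Odd n)
    (hb : ∀ i, b i = AdjoinRoot.root (monicOf a) ^ (i : ℕ))
    {A : Matrix (Fin n) (Fin n) ℤ_[2]} (hA : A.det = (-1) ^ ((n - 1) / 2)) (hAs : A.IsSymm) :
    Finite (Quotient (orbitSetoid A (monicOf a))) ∧
    Nat.card (Quotient (orbitSetoid A (monicOf a))) * (unimodularEight (redEight ∘ a)).card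
      = 2 ^ n * Nat.card {u : AdjoinRoot (monicOf a) // u * u = 1} *
        (gramClass (A.map redEight) (redEight ∘ a)).card := by
  obtain ⟨φ, hφ⟩ := exists_isUnit_det_gramOf b hb
  have hAu : IsUnit A.det := by rw [hA]; exact isUnit_one.neg.pow _
  rw [← card_quotient_unitsOneModEight hb, ← card_image_mk_congruent hb hφ hAu hAs]
  refine card_classes_mul_card b _ ?_ _ (fun (B : Fibre A (monicOf a)) δ => ∃ K, IsFrame b
    (AdjoinRoot.root (monicOf a)) A B.1 (twist φ (δ : AdjoinRoot (monicOf a))) K) ?_ ?_ ?_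
  · intro δ hδ w
    refine Congruent.trans hδ ⟨Algebra.leftMulMatrix b (w : AdjoinRoot (monicOf a)),
      (isUnit_det_leftMulMatrix_iff b _).2 w.isUnit, ?_⟩
    rw [← gramOf_twist_sq, twist_twist, Units.val_mul, Units.val_mul]
  · rintro ⟨B, hBs, hB, hp⟩
    rw [resolvent_eq_charpoly A B hA] at hB
    obtain ⟨ψ, K, hK⟩ := exists_isFrame b hb hAu hAs hBs hB hp
    obtain ⟨u, rfl⟩ := twist_surjective hφ ψ
    obtain ⟨δ, rfl⟩ := (isUnit_det_gramOf_twist_iff hφ u).1 (hK.isUnit_det_gramOf hAu)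
    exact ⟨δ, ⟨K, hK.isUnit_det, hK.left⟩, K, hK⟩
  · rintro δ ⟨K, hK, hKA⟩
    -- Conversely, a change of basis from `A` to the Gram matrix of δφ transports multiplication by
    -- x back to A⁻¹B, and this defines `B`.
    set X := Algebra.leftMulMatrix b (AdjoinRoot.root (monicOf a)) with hX
    have hframe : IsFrame b (AdjoinRoot.root (monicOf a)) A (A * K * X * K⁻¹)
        (twist φ (δ : AdjoinRoot (monicOf a))) K := by
      refine ⟨hK, hKA, ?_⟩
      rw [← hKA]
      simp only [Matrix.mul_assoc, Matrix.nonsing_inv_mul _ hK, Matrix.mul_one]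
      rfl
    refine ⟨⟨A * K * X * K⁻¹, ?_, ?_, hframe.isProjectivePair b hAu⟩, K, hframe⟩
    · refine transpose_mul_mul_cancel hK ?_
      have h1 := congrArg Matrix.transpose hframe.right
      generalize A * K * X * K⁻¹ = B at h1 hframe ⊢
      rw [Matrix.transpose_mul, Matrix.transpose_mul, Matrix.transpose_transpose,
        Matrix.transpose_mul, (gramOf_isSymm b _).eq, transpose_leftMulMatrix_mul_gramOf,
        ← hframe.right, ← Matrix.mul_assoc] at h1
      exact h1
    · rw [resolvent_eq_charpoly _ _ hA]
      have h1 : A⁻¹ * (A * K * X * K⁻¹) = K * X * K⁻¹ := by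
        simp only [← Matrix.mul_assoc, Matrix.nonsing_inv_mul _ hAu, Matrix.one_mul]
      obtain ⟨K', rfl⟩ := (Matrix.isUnit_iff_isUnit_det _).2 hK
      rw [h1, Matrix.charpoly_units_conj, hX,
        charpoly_leftMulMatrix_root b (monicOf_monic a) (natDegree_monicOf a)]
  · rintro B B' δ ε ⟨K, hK⟩ ⟨K', hK'⟩
    constructor
    · rintro ⟨g, hg, hgB⟩
      obtain ⟨u, hu, hφu, -⟩ := hK'.exists_unit hb hAu (hK.conj hg hgB)
      obtain ⟨w, rfl⟩ := hu
      refine ⟨w, Units.ext (twist_injective hφ ?_)⟩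
      rw [hφu, twist_twist, Units.val_mul, Units.val_mul]
    · rintro ⟨w, rfl⟩
      have h1 := hK.mul_leftMulMatrix w.isUnit
      rw [twist_twist, ← Units.val_mul, ← Units.val_mul] at h1
      exact h1.exists_specialOrthogonal hn hAu hK'

-- The stabiliser order is the same for all points of the fibre, so the mass is the number of orbits
-- divided by one constant.
variable {b} in
theorem card_stab (hb : ∀ i, b i = AdjoinRoot.root (monicOf a) ^ (i : ℕ))
    {A : Matrix (Fin n) (Fin n) ℤ_[2]} (hA : A.det = (-1) ^ ((n - 1) / 2)) (hAs : A.IsSymm)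
    (B : Fibre A (monicOf a)) : ENat.card (Stab A B.1) = Nat.card
      {u : AdjoinRoot (monicOf a) // u * u = 1 ∧ (Algebra.leftMulMatrix b u).det = 1} := by
  have hAu : IsUnit A.det := by rw [hA]; exact isUnit_one.neg.pow _
  have hfin' : Finite {u : AdjoinRoot (monicOf a) // u * u = 1} := (card_ker_sq_and_finite b).2
  have hfin2 : Finite {u : AdjoinRoot (monicOf a) //
      u * u = 1 ∧ (Algebra.leftMulMatrix b u).det = 1} :=
    Finite.of_injective (fun u => (⟨u.1, u.2.1⟩ : {u : AdjoinRoot (monicOf a) // u * u = 1}))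
      fun u v h => Subtype.ext (congrArg (fun w => w.1) h)
  obtain ⟨B, hBs, hB, hp⟩ := B
  rw [resolvent_eq_charpoly A B hA] at hB
  obtain ⟨ψ, K, hK⟩ := exists_isFrame b hb hAu hAs hBs hB hp
  obtain ⟨e⟩ := hK.nonempty_stab_equiv hb hAu
  rw [← ENat.card_eq_coe_natCard]
  exact ENat.card_congr e.symm

/-- The local mass is a ratio of numbers of functionals modulo 8. -/
theorem localMass_mul_card (hn : Odd n) (a : Fin n → ℤ_[2])
    {A : Matrix (Fin n) (Fin n) ℤ_[2]} (hA : A.det = (-1) ^ ((n - 1) / 2)) (hAs : A.IsSymm) :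
    localMass A (monicOf a) * ((unimodularEight (redEight ∘ a)).card : ℝ≥0∞)
      = 2 ^ (n + 1) * ((gramClass (A.map redEight) (redEight ∘ a)).card : ℝ≥0∞) := by
  obtain ⟨b, hb⟩ := exists_basis_adjoinRoot (monicOf_monic a) (natDegree_monicOf a)
  have hAu : IsUnit A.det := by rw [hA]; exact isUnit_one.neg.pow _
  obtain ⟨hfin, hcard⟩ := card_orbits_mul_card hn hb hA hAs
  have hsq := card_sq_eq_one_of_odd b hn
  have hfin' : Finite {u : AdjoinRoot (monicOf a) // u * u = 1} := (card_ker_sq_and_finite b).2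
  have hfin2 : Finite {u : AdjoinRoot (monicOf a) //
      u * u = 1 ∧ (Algebra.leftMulMatrix b u).det = 1} :=
    Finite.of_injective (fun u => (⟨u.1, u.2.1⟩ : {u : AdjoinRoot (monicOf a) // u * u = 1}))
      fun u v h => Subtype.ext (congrArg (fun w => w.1) h)
  have hne : Nonempty {u : AdjoinRoot (monicOf a) //
      u * u = 1 ∧ (Algebra.leftMulMatrix b u).det = 1} := ⟨⟨1, by simp⟩⟩
  have hpos := Nat.card_pos (α := {u : AdjoinRoot (monicOf a) //
      u * u = 1 ∧ (Algebra.leftMulMatrix b u).det = 1})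
  have hstab := card_stab hb hA hAs
  rw [hsq] at hcard
  set τ := Nat.card {u : AdjoinRoot (monicOf a) //
      u * u = 1 ∧ (Algebra.leftMulMatrix b u).det = 1}
  have hτ : (τ : ℝ≥0∞) ≠ 0 := by exact_mod_cast hpos.ne'
  rw [localMass]
  simp only [hstab]
  rw [ENNReal.tsum_const, ENat.card_eq_coe_natCard]
  have hcard' : (Nat.card (Quotient (orbitSetoid A (monicOf a))) : ℝ≥0∞)
      * ((unimodularEight (redEight ∘ a)).card : ℝ≥0∞)
      = 2 ^ n * ((τ : ℝ≥0∞) * 2) * ((gramClass (A.map redEight) (redEight ∘ a)).card : ℝ≥0∞) := by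
    exact_mod_cast hcard
  simp only [ENat.toENNReal_coe]
  rw [mul_right_comm, hcard', pow_succ]
  calc _ = (τ : ℝ≥0∞) * (τ : ℝ≥0∞)⁻¹ * (2 ^ n * 2
        * ((gramClass (A.map redEight) (redEight ∘ a)).card : ℝ≥0∞)) := by ring
    _ = _ := by rw [ENNReal.mul_inv_cancel hτ (ENNReal.natCast_ne_top _), one_mul]

end

end TwoAdicMass

/-! ### Translation invariance and the total mass of a residue class. -/

namespace TwoAdicMass

open Polynomial MeasureTheory

noncomputable section

variable {n : ℕ}

theorem resolvent_sub_smul (A B : Matrix (Fin n) (Fin n) ℤ_[2]) (c : ℤ_[2]) :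
    resolvent A (B - c • A) = (resolvent A B).comp (X + C c) := by
  have h : (X : ℤ_[2][X]) • A.map C - (B - c • A).map C
      = (compRingHom (X + C c)).mapMatrix ((X : ℤ_[2][X]) • A.map C - B.map C) := by
    ext1 i j
    simp [sub_comp, mul_comp]
    ring
  rw [resolvent, h, ← RingHom.map_det, resolvent, mul_comp]
  simp

/-- The translation of a pair. -/
def Fibre.translate {A : Matrix (Fin n) (Fin n) ℤ_[2]} (hA : IsUnit A.det) (hAs : A.IsSymm)
    {f g : ℤ_[2][X]} (c : ℤ_[2]) (hfg : f.comp (X + C c) = g) (B : Fibre A f) : Fibre A g :=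
  ⟨B.1 - c • A, by
    obtain ⟨B, hBs, hB, hp⟩ := B
    refine ⟨hBs.sub (hAs.smul c), by rw [resolvent_sub_smul, hB, hfg], ?_⟩
    obtain ⟨v, hv⟩ := isProjectivePair_iff.1 hp
    refine isProjectivePair_iff.2 ⟨v, ?_⟩
    rw [Matrix.mul_sub, Matrix.mul_smul, Matrix.nonsing_inv_mul _ hA]
    exact isCyclicVector_comp hv c⟩

theorem conj_sub_smul_iff {A B B' g : Matrix (Fin n) (Fin n) ℤ_[2]} (hg : gᵀ * A * g = A)
    (c : ℤ_[2]) : gᵀ * (B - c • A) * g = B' - c • A ↔ gᵀ * B * g = B' := by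
  rw [Matrix.mul_sub, Matrix.sub_mul, Matrix.mul_smul, Matrix.smul_mul, hg, sub_left_inj]

theorem comp_comp_neg {R : Type*} [CommRing R] (f : R[X]) (c : R) :
    (f.comp (X + C c)).comp (X + C (-c)) = f := by
  rw [comp_assoc]
  simp

/-- The local mass is invariant under translations of the variable. -/
theorem localMass_eq_of_comp {A : Matrix (Fin n) (Fin n) ℤ_[2]}
    (hA : A.det = (-1) ^ ((n - 1) / 2)) (hAs : A.IsSymm) {a a' : Fin n → ℤ_[2]} (c : ℤ_[2])
    (h : (monicOf a).comp (X + C c) = monicOf a') :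
    localMass A (monicOf a') = localMass A (monicOf a) := by
  have hAu : IsUnit A.det := by rw [hA]; exact isUnit_one.neg.pow _
  have h' : (monicOf a').comp (X + C (-c)) = monicOf a := by rw [← h, comp_comp_neg]
  let e : Fibre A (monicOf a) ≃ Fibre A (monicOf a') :=
    { toFun := Fibre.translate hAu hAs c h
      invFun := Fibre.translate hAu hAs (-c) h'
      left_inv := fun B => Subtype.ext (by
        change B.1 - c • A - (-c) • A = B.1
        rw [neg_smul, sub_neg_eq_add, sub_add_cancel])
      right_inv := fun B => Subtype.ext (by
        change B.1 - (-c) • A - c • A = B.1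
        rw [neg_smul, sub_neg_eq_add, add_sub_cancel_right]) }
  obtain ⟨b, hb⟩ := exists_basis_adjoinRoot (monicOf_monic a) (natDegree_monicOf a)
  have hstab := card_stab hb hA hAs
  have hstab' : ∀ B : Fibre A (monicOf a'), ENat.card (Stab A B.1) = Nat.card
      {u : AdjoinRoot (monicOf a) // u * u = 1 ∧ (Algebra.leftMulMatrix b u).det = 1} := by
    intro B
    rw [← hstab (e.symm B)]
    obtain ⟨B, rfl⟩ := e.surjective B
    rw [Equiv.symm_apply_apply]
    exact ENat.card_congr (Equiv.subtypeEquivRight fun g => conj_sub_smul_iff g.2 c)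
  have hQ : ENat.card (Quotient (orbitSetoid A (monicOf a')))
      = ENat.card (Quotient (orbitSetoid A (monicOf a))) :=
    ENat.card_congr (Quotient.congr e fun B B' =>
      exists_congr fun g => and_congr_right fun hg => (conj_sub_smul_iff hg c).symm).symm
  rw [localMass, localMass]
  simp only [hstab, hstab']
  rw [ENNReal.tsum_const, ENNReal.tsum_const, hQ]

section

variable {R S : Type*} [CommRing R] [CommRing S]

/-- The coefficients of the translate by `c` of the monic polynomial with coefficients `a`. -/
def shift (c : R) (a : Fin n → R) : Fin n → R := fun i => ((monicOf a).comp (X + C c)).coeff i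

theorem monicOf_coeff (a : Fin n → R) (i : Fin n) : (monicOf a).coeff i = a i := by
  rw [monicOf, coeff_add, coeff_X_pow, if_neg i.2.ne, zero_add, finsetSum_coeff]
  simp only [coeff_C_mul_X_pow, Fin.val_inj]
  simp

theorem monicOf_shift [Nontrivial R] (c : R) (a : Fin n → R) :
    monicOf (shift c a) = (monicOf a).comp (X + C c) := by
  have hm : ((monicOf a).comp (X + C c)).Monic :=
    (monicOf_monic a).comp (monic_X_add_C c) (by simp)
  have hd : ((monicOf a).comp (X + C c)).natDegree = n := by
    rw [natDegree_comp_eq_of_mul_ne_zero (by simp [(monicOf_monic a).leadingCoeff]),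
      natDegree_X_add_C, mul_one, natDegree_monicOf]
  rw [hm.as_sum, hd, monicOf, ← Fin.sum_univ_eq_sum_range
    (fun i => C (((monicOf a).comp (X + C c)).coeff i) * X ^ i)]
  rfl

theorem monicOf_map (φ : R →+* S) (a : Fin n → R) : (monicOf a).map φ = monicOf (φ ∘ a) := by
  simp [monicOf, Polynomial.map_sum]

theorem shift_map (φ : R →+* S) (c : R) (a : Fin n → R) :
    φ ∘ shift c a = shift (φ c) (φ ∘ a) := by
  funext i
  simp only [shift, Function.comp_apply]
  rw [← coeff_map, map_comp, monicOf_map]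
  simp

theorem shift_zero (a : Fin n → R) : shift 0 a = a := by
  funext i
  simp [shift, monicOf_coeff]

theorem shift_shift_neg [Nontrivial R] (c : R) (a : Fin n → R) : shift (-c) (shift c a) = a := by
  funext i
  rw [shift, monicOf_shift, comp_comp_neg, monicOf_coeff]

theorem shift_last {k : ℕ} (c : R) (a : Fin (k + 1) → R) :
    shift c a (Fin.last k) = a (Fin.last k) + (k + 1) * c := by
  rw [shift, monicOf, add_comp, X_pow_comp, Fin.val_last, coeff_add, coeff_X_add_C_pow,
    Fin.sum_univ_castSucc, add_comp, coeff_add]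
  have h : ((∑ i : Fin k, C (a i.castSucc) * X ^ (i.castSucc : ℕ)).comp (X + C c)).coeff k = 0 := by
    rw [← coe_compRingHom_apply, map_sum, finsetSum_coeff]
    refine Finset.sum_eq_zero fun i _ => ?_
    rw [coe_compRingHom_apply, mul_comp, C_comp, X_pow_comp, coeff_C_mul, coeff_X_add_C_pow,
      Nat.choose_eq_zero_of_lt (by simp), Nat.cast_zero, mul_zero, mul_zero]
  rw [h, mul_comp, C_comp, X_pow_comp, coeff_C_mul, Fin.val_last, coeff_X_add_C_pow]
  simp
  ring

end

/-- The local mass as a function of the coefficients modulo 8. -/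
def massEight (A : Matrix (Fin n) (Fin n) (ZMod 8)) (a : Fin n → ZMod 8) : ℝ :=
  2 ^ (n + 1) * (gramClass A a).card / (unimodularEight a).card

theorem massEight_nonneg (A : Matrix (Fin n) (Fin n) (ZMod 8)) (a : Fin n → ZMod 8) :
    0 ≤ massEight A a := by
  unfold massEight
  positivity

theorem card_unimodularEight_pos (a : Fin n → ZMod 8) : 0 < (unimodularEight a).card := by
  choose a' ha' using fun i => redEight_surjective (a i)
  obtain rfl : redEight ∘ a' = a := funext ha'
  obtain ⟨b, hb⟩ := exists_basis_adjoinRoot (monicOf_monic a') (natDegree_monicOf a')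
  have := finite_quotient_unitsOneModEight b
  rw [← card_quotient_unitsOneModEight hb]
  exact Nat.card_pos

theorem localMass_eq_massEight (hn : Odd n) (a : Fin n → ℤ_[2])
    {A : Matrix (Fin n) (Fin n) ℤ_[2]} (hA : A.det = (-1) ^ ((n - 1) / 2)) (hAs : A.IsSymm) :
    localMass A (monicOf a) = ENNReal.ofReal (massEight (A.map redEight) (redEight ∘ a)) := by
  have h := localMass_mul_card hn a hA hAs
  have hpos := card_unimodularEight_pos (redEight ∘ a)
  rw [massEight, ENNReal.ofReal_div_of_pos (by exact_mod_cast hpos),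
    ENNReal.ofReal_mul (by positivity), ENNReal.ofReal_natCast, ENNReal.ofReal_natCast,
    ENNReal.ofReal_pow (by positivity), ENNReal.ofReal_ofNat,
    ENNReal.eq_div_iff (by exact_mod_cast hpos.ne') (ENNReal.natCast_ne_top _), ← h, mul_comm]

/-- The invariance is inherited from ℤ_2, by lifting both the polynomial and the translation. -/
theorem massEight_shift (hn : Odd n) {A : Matrix (Fin n) (Fin n) ℤ_[2]}
    (hA : A.det = (-1) ^ ((n - 1) / 2)) (hAs : A.IsSymm) (c : ZMod 8) (a : Fin n → ZMod 8) :
    massEight (A.map redEight) (shift c a) = massEight (A.map redEight) a := by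
  choose a' ha' using fun i => redEight_surjective (a i)
  obtain rfl : redEight ∘ a' = a := funext ha'
  obtain ⟨c, rfl⟩ := redEight_surjective c
  have h := localMass_eq_of_comp hA hAs c (monicOf_shift c a').symm
  rw [localMass_eq_massEight hn _ hA hAs, localMass_eq_massEight hn _ hA hAs,
    ENNReal.ofReal_eq_ofReal_iff (massEight_nonneg _ _) (massEight_nonneg _ _), shift_map] at h
  exact h

/-- The denominators are constant on the residue class, so the sum reduces to the count of pairs in
`sum_card_gramClass`. -/
theorem sum_massEight (hn : Odd n) (T : Finset (Fin n)) (a' : Fin n → ZMod 2) :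
    ∑ a with redTwo ∘ a = a', massEight (signForm T) a = 4 ^ n * weightCount n T.card := by
  have hN : (0 : ℝ) < (nonsingularTwo a').card := by
    choose a ha using fun i => (ZMod.ringHom_surjective redTwo) (a' i)
    obtain rfl : redTwo ∘ a = a' := funext ha
    have := card_unimodularEight_pos a
    rw [card_unimodularEight] at this
    exact_mod_cast Nat.pos_of_mul_pos_left this
  have h1 : ∀ a ∈ Finset.univ.filter (fun a : Fin n → ZMod 8 => redTwo ∘ a = a'),
      massEight (signForm T) a
        = 2 ^ (n + 1) / (4 ^ n * (nonsingularTwo a').card) * (gramClass (signForm T) a).card := by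
    intro a ha
    rw [massEight, card_unimodularEight, (Finset.mem_filter.1 ha).2]
    push_cast
    ring
  rw [Finset.sum_congr rfl h1, ← Finset.mul_sum]
  have h2 := sum_card_gramClass hn T a'
  have h3 : (2 : ℝ) * 2 ^ n * ∑ a with redTwo ∘ a = a', ((gramClass (signForm T) a).card : ℝ)
      = 4 ^ (2 * n) * weightCount n T.card * (nonsingularTwo a').card := by
    exact_mod_cast h2
  rw [div_mul_eq_mul_div, pow_succ, mul_comm ((2 : ℝ) ^ n), h3, div_eq_iff (by positivity)]
  ring

end

end TwoAdicMass

/-! ### Fixing the second coefficient, and integration. -/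

namespace TwoAdicMass

open Polynomial MeasureTheory

noncomputable section

variable {k : ℕ}

/-- The average of the mass over the polynomials with given second coefficient and given reduction
modulo 2. -/
theorem sum_massEight_snoc (hn : Odd (k + 1)) {A : Matrix (Fin (k + 1)) (Fin (k + 1)) ℤ_[2]}
    (hA : A.det = (-1) ^ ((k + 1 - 1) / 2)) (hAs : A.IsSymm) (T : Finset (Fin (k + 1)))
    (hT : A.map redEight = signForm T) (a' : Fin k → ZMod 2) (β : ZMod 8) :
    ∑ a : Fin k → ZMod 8 with redTwo ∘ a = a', massEight (A.map redEight) (Fin.snoc a β)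
      = 4 ^ k * weightCount (k + 1) T.card := by
  let x' : Fin (k + 1) → ZMod 2 := Fin.snoc a' (redTwo β)
  have hx'l : x' (Fin.last k) = redTwo β := Fin.snoc_last _ _
  have hx's : ∀ i : Fin k, x' i.castSucc = a' i := fun i => Fin.snoc_castSucc _ _ i
  have : Nontrivial (ZMod 8) := ⟨0, 1, by decide⟩
  let m := massEight (A.map redEight)
  let P : ZMod 8 → Finset (Fin (k + 1) → ZMod 8) := fun γ =>
    Finset.univ.filter fun x => redTwo ∘ x = x' ∧ x (Fin.last k) = γ
  have htotal : ∑ x with redTwo ∘ x = x', m x = ∑ γ with redTwo γ = redTwo β, ∑ x ∈ P γ, m x := by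
    rw [← Finset.sum_fiberwise_of_maps_to (s := Finset.univ.filter fun x => redTwo ∘ x = x')
      (t := Finset.univ.filter fun γ => redTwo γ = redTwo β) (g := fun x => x (Fin.last k))]
    · refine Finset.sum_congr rfl fun γ _ => ?_
      rw [Finset.filter_filter]
    · intro x hx
      have := congrFun (Finset.mem_filter.1 hx).2 (Fin.last k)
      rw [Function.comp_apply, hx'l] at this
      exact Finset.mem_filter.2 ⟨Finset.mem_univ _, this⟩
  -- Translation by c adds (k + 1)c to the second coefficient, and the odd number k + 1 is its own
  -- inverse modulo 8. Moving γ to δ thus needs c = (k + 1)(δ - γ). This c is even when γ and δ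
  -- agree modulo 2, so the residue class modulo 2 is preserved. The four values of the coefficient
  -- contribute equally.
  have hsq : ((k : ZMod 8) + 1) * ((k : ZMod 8) + 1) = 1 := by
    obtain ⟨j, hj⟩ := hn
    have h1 : (k : ZMod 8) + 1 = 2 * (j : ZMod 8) + 1 := by exact_mod_cast congrArg Nat.cast hj
    have h2 : ∀ j : ZMod 8, (2 * j + 1) * (2 * j + 1) = 1 := by decide
    rw [h1, h2]
  have hmaps : ∀ γ δ, redTwo γ = redTwo δ → ∀ x ∈ P γ, shift ((k + 1) * (δ - γ)) x ∈ P δ := by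
    intro γ δ hγ x hx
    obtain ⟨-, hx1, hx2⟩ := Finset.mem_filter.1 hx
    refine Finset.mem_filter.2 ⟨Finset.mem_univ _, ?_, ?_⟩
    · rw [shift_map, map_mul, map_sub, hγ, sub_self, mul_zero, shift_zero, hx1]
    · rw [shift_last, hx2, ← mul_assoc, hsq, one_mul, add_sub_cancel]
  have hconst : ∀ γ, redTwo γ = redTwo β → ∑ x ∈ P γ, m x = ∑ x ∈ P β, m x := by
    intro γ hγ
    refine Finset.sum_nbij' (shift ((k + 1) * (β - γ))) (shift ((k + 1) * (γ - β)))
      (hmaps γ β hγ) (hmaps β γ hγ.symm) (fun x _ => ?_) (fun x _ => ?_)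
      fun x _ => (massEight_shift hn hA hAs _ x).symm
    · rw [← neg_sub β γ, mul_neg, shift_shift_neg]
    · rw [← neg_sub γ β, mul_neg, shift_shift_neg]
  have hfour : (Finset.univ.filter fun γ : ZMod 8 => redTwo γ = redTwo β).card = 4 := by
    have h : ∀ β : ZMod 8, (Finset.univ.filter fun γ : ZMod 8 => redTwo γ = redTwo β).card = 4 := by
      decide
    exact h β
  have hlast : ∑ x ∈ P β, m x
      = ∑ a : Fin k → ZMod 8 with redTwo ∘ a = a', m (Fin.snoc a β : Fin (k + 1) → ZMod 8) := by
    refine Finset.sum_nbij' (fun x => Fin.init x) (fun a => Fin.snoc a β) ?_ ?_ ?_ ?_ ?_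
    · intro x hx
      obtain ⟨-, hx1, hx2⟩ := Finset.mem_filter.1 hx
      refine Finset.mem_filter.2 ⟨Finset.mem_univ _, funext fun i => ?_⟩
      have := congrFun hx1 i.castSucc
      rw [Function.comp_apply, hx's] at this
      exact this
    · intro a ha
      have ha1 := (Finset.mem_filter.1 ha).2
      refine Finset.mem_filter.2 ⟨Finset.mem_univ _, funext fun i => ?_, Fin.snoc_last _ _⟩
      refine Fin.lastCases ?_ (fun i => ?_) i
      · rw [Function.comp_apply, Fin.snoc_last, hx'l]
      · rw [Function.comp_apply, Fin.snoc_castSucc, hx's, ← ha1, Function.comp_apply]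
    · intro x hx
      rw [← (Finset.mem_filter.1 hx).2.2]
      exact Fin.snoc_init_self x
    · intro a _
      exact Fin.init_snoc _ _
    · intro x hx
      rw [← (Finset.mem_filter.1 hx).2.2, Fin.snoc_init_self]
  have h1 : ∑ x with redTwo ∘ x = x', m x = 4 ^ (k + 1) * weightCount (k + 1) T.card := by
    simp only [m, hT]
    exact sum_massEight hn T x'
  rw [htotal, Finset.sum_congr rfl fun γ hγ => hconst γ (Finset.mem_filter.1 hγ).2,
    Finset.sum_const, hfour, hlast, nsmul_eq_mul, pow_succ] at h1
  push_cast at h1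
  linarith

instance : IsProbabilityMeasure
    (Measure.addHaarMeasure (⊤ : TopologicalSpace.PositiveCompacts ℤ_[2])) :=
  ⟨by
    have h := Measure.addHaarMeasure_self (K₀ := (⊤ : TopologicalSpace.PositiveCompacts ℤ_[2]))
    rwa [TopologicalSpace.PositiveCompacts.coe_top] at h⟩

instance (n : ℕ) : IsProbabilityMeasure (coeffMeasure n) := by
  unfold coeffMeasure
  infer_instance

theorem measurableSet_preimage_redEight (z : ZMod 8) : MeasurableSet (redEight ⁻¹' {z}) := by
  obtain ⟨w, rfl⟩ := redEight_surjective z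
  have h : redEight ⁻¹' {redEight w} = Set.range fun y : ℤ_[2] => w + 8 * y := by
    ext v
    rw [Set.mem_preimage, Set.mem_singleton_iff, redEight_eq_iff, Set.mem_range]
    exact exists_congr fun y => by rw [sub_eq_iff_eq_add', eq_comm]
  rw [h]
  exact (isCompact_range (by fun_prop)).isClosed.measurableSet

theorem addHaarMeasure_preimage_redEight (z : ZMod 8) :
    Measure.addHaarMeasure (⊤ : TopologicalSpace.PositiveCompacts ℤ_[2]) (redEight ⁻¹' {z})
      = 8⁻¹ := by
  set μ := Measure.addHaarMeasure (⊤ : TopologicalSpace.PositiveCompacts ℤ_[2]) with hμ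
  have h1 : ∀ z, μ (redEight ⁻¹' {z}) = μ (redEight ⁻¹' {0}) := by
    intro z
    obtain ⟨w, rfl⟩ := redEight_surjective z
    rw [← measure_preimage_add μ w (redEight ⁻¹' {redEight w})]
    congr 1
    ext v
    simp
  have h2 := sum_measure_preimage_singleton (μ := μ) (f := redEight) Finset.univ
    fun y _ => measurableSet_preimage_redEight y
  rw [Finset.sum_congr rfl fun z _ => h1 z, Finset.sum_const, Finset.coe_univ, Set.preimage_univ,
    measure_univ, Finset.card_univ, ZMod.card, nsmul_eq_mul, mul_comm] at h2
  rw [h1]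
  exact ENNReal.eq_inv_of_mul_eq_one_left h2

theorem preimage_comp_redEight (x : Fin k → ZMod 8) :
    (fun a : Fin k → ℤ_[2] => redEight ∘ a) ⁻¹' {x} = Set.univ.pi fun i => redEight ⁻¹' {x i} := by
  ext a
  simp [funext_iff]

theorem measurableSet_preimage_comp_redEight (x : Fin k → ZMod 8) :
    MeasurableSet ((fun a : Fin k → ℤ_[2] => redEight ∘ a) ⁻¹' {x}) := by
  rw [preimage_comp_redEight]
  exact MeasurableSet.univ_pi fun i => measurableSet_preimage_redEight _

theorem coeffMeasure_preimage_comp_redEight (x : Fin k → ZMod 8) :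
    coeffMeasure (k + 1) ((fun a : Fin k → ℤ_[2] => redEight ∘ a) ⁻¹' {x}) = 8⁻¹ ^ k := by
  rw [preimage_comp_redEight, coeffMeasure]
  refine (Measure.pi_pi _ _).trans ?_
  simp only [addHaarMeasure_preimage_redEight, Finset.prod_const, Finset.card_univ, Fintype.card_fin]
  rfl

/-- A function of the reduction modulo 8 is measurable and its integral is a finite sum. -/
theorem measurable_and_lintegral_comp_redEight (g : (Fin k → ZMod 8) → ℝ≥0∞)
    (U : Finset (Fin k → ZMod 8)) :
    Measurable (fun a : Fin k → ℤ_[2] => g (redEight ∘ a)) ∧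
    ∫⁻ a in (fun a : Fin k → ℤ_[2] => redEight ∘ a) ⁻¹' U, g (redEight ∘ a) ∂coeffMeasure (k + 1)
      = (∑ x ∈ U, g x) * 8⁻¹ ^ k := by
  let : MeasurableSpace (Fin k → ZMod 8) := ⊤
  have : DiscreteMeasurableSpace (Fin k → ZMod 8) := ⟨fun _ => trivial⟩
  have hF : Measurable (fun a : Fin k → ℤ_[2] => redEight ∘ a) :=
    measurable_to_countable' measurableSet_preimage_comp_redEight
  have hg : Measurable g := measurable_of_finite g
  refine ⟨hg.comp hF, ?_⟩
  have h1 := setLIntegral_map (μ := coeffMeasure (k + 1)) (s := (U : Set (Fin k → ZMod 8)))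
    (MeasurableSet.of_discrete) hg hF
  refine h1.symm.trans ?_
  rw [lintegral_finset _ g, Finset.sum_mul]
  refine Finset.sum_congr rfl fun x _ => ?_
  rw [Measure.map_apply hF (MeasurableSet.of_discrete), coeffMeasure_preimage_comp_redEight]

theorem monicPoly_eq_monicOf (b : ℕ) (a : Fin k → ℤ_[2]) :
    monicPoly (k + 1) b a = monicOf (Fin.snoc a (b : ℤ_[2])) := by
  rw [monicPoly, monicOf, Fin.sum_univ_castSucc]
  simp only [Fin.snoc_castSucc, Fin.snoc_last, Fin.val_castSucc, Fin.val_last]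
  rw [add_assoc]
  congr 1
  exact add_comm _ _

theorem comp_snoc (a : Fin k → ℤ_[2]) (β : ℤ_[2]) :
    redEight ∘ (Fin.snoc a β : Fin (k + 1) → ℤ_[2])
      = (Fin.snoc (redEight ∘ a) (redEight β) : Fin (k + 1) → ZMod 8) :=
  Fin.comp_snoc _ _ _

/-- The mass is measurable, with integral a multiple of the volume. -/
theorem measurable_and_integratedMass_eq (hn : Odd (k + 1))
    {A : Matrix (Fin (k + 1)) (Fin (k + 1)) ℤ_[2]}
    (hA : A.det = (-1) ^ ((k + 1 - 1) / 2)) (hAs : A.IsSymm) (T : Finset (Fin (k + 1)))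
    (hT : A.map redEight = signForm T) (b : ℕ) (S : Set (Fin k → ℤ_[2]))
    (hS : DefinedModTwo (n := k + 1) S) :
    Measurable (fun a => localMass A (monicPoly (k + 1) b a)) ∧
    integratedMass (n := k + 1) b S A
      = weightCount (k + 1) T.card * coeffMeasure (k + 1) S := by
  classical
  let g : (Fin k → ZMod 8) → ℝ≥0∞ := fun x =>
    ENNReal.ofReal (massEight (A.map redEight) (Fin.snoc x (redEight b)))
  have hg : (fun a => localMass A (monicPoly (k + 1) b a)) = fun a => g (redEight ∘ a) := by
    funext a
    rw [monicPoly_eq_monicOf, localMass_eq_massEight hn _ hA hAs, comp_snoc]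
  let S' : Finset (Fin k → ZMod 2) := Finset.univ.filter fun a' =>
    ∃ a ∈ S, redTwo ∘ redEight ∘ a = a'
  let U : Finset (Fin k → ZMod 8) := Finset.univ.filter fun x => redTwo ∘ x ∈ S'
  have hSU : S = (fun a : Fin k → ℤ_[2] => redEight ∘ a) ⁻¹' U := by
    ext a
    simp only [U, S', Set.mem_preimage, Finset.mem_coe, Finset.mem_filter, Finset.mem_univ,
      true_and]
    refine ⟨fun h => ⟨a, h, rfl⟩, ?_⟩
    rintro ⟨a₀, ha₀, h⟩
    refine (hS a₀ a fun i => ?_).1 ha₀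
    have h1 := congrFun h i
    simp only [Function.comp_apply] at h1
    obtain ⟨y, hy⟩ := redEight_eq_two_mul (a₀ i - a i) (by rw [map_sub, map_sub, h1, sub_self])
    exact ⟨y, hy⟩
  have hcard : ∀ a' : Fin k → ZMod 2,
      (Finset.univ.filter fun x : Fin k → ZMod 8 => redTwo ∘ x = a').card = 4 ^ k :=
    fun a' => card_redTwo_fibre a'
  have hfib : ∀ h : (Fin k → ZMod 8) → ℝ≥0∞,
      ∑ x ∈ U, h x = ∑ a' ∈ S', ∑ x with redTwo ∘ x = a', h x := by
    intro h
    rw [← Finset.sum_fiberwise_of_maps_to (s := U) (t := S') (g := fun x => redTwo ∘ x)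
      fun x hx => (Finset.mem_filter.1 hx).2]
    refine Finset.sum_congr rfl fun a' ha' => Finset.sum_congr ?_ fun _ _ => rfl
    ext x
    simp only [U, Finset.mem_filter, Finset.mem_univ, true_and, and_iff_right_iff_imp]
    rintro rfl
    exact ha'
  have hvol : coeffMeasure (k + 1) S = (S'.card * 4 ^ k) * 8⁻¹ ^ k := by
    have h1 := (measurable_and_lintegral_comp_redEight (fun _ => 1) U).2
    rw [hfib, ← hSU, setLIntegral_one] at h1
    rw [h1]
    simp only [Finset.sum_const, hcard, nsmul_eq_mul]
    push_cast
    ring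
  refine ⟨by rw [hg]; exact (measurable_and_lintegral_comp_redEight g U).1, ?_⟩
  -- A residue class modulo 2 has 4^k lifts, so the mean of the mass over it is `weightCount`,
  -- whatever the class.
  have hsum : ∀ a', ∑ x with redTwo ∘ x = a', g x
      = 4 ^ k * (weightCount (k + 1) T.card : ℝ≥0∞) := by
    intro a'
    rw [← ENNReal.ofReal_sum_of_nonneg fun _ _ => massEight_nonneg _ _,
      sum_massEight_snoc hn hA hAs T hT, ENNReal.ofReal_mul (by positivity),
      ENNReal.ofReal_pow (by positivity), ENNReal.ofReal_ofNat, ENNReal.ofReal_natCast]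
  have h1 : integratedMass (n := k + 1) b S A
      = ∫⁻ a in S, g (redEight ∘ a) ∂coeffMeasure (k + 1) := by
    rw [integratedMass]
    exact congrArg (fun F : (Fin k → ℤ_[2]) → ℝ≥0∞ => ∫⁻ a in S, F a ∂coeffMeasure (k + 1)) hg
  rw [h1, hvol]
  conv_lhs => rw [hSU]
  rw [(measurable_and_lintegral_comp_redEight g U).2, hfib, Finset.sum_congr rfl fun a' _ => hsum a',
    Finset.sum_const, nsmul_eq_mul]
  ring

end

end TwoAdicMass

/-! ### Weights modulo 4 and the powers of 1 + i. -/

namespace TwoAdicMass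

open Polynomial MeasureTheory

noncomputable section

/-- Expanding the product of n factors 1 + g picks a subset of coordinates. The cases g = 1, -1, i
act as a root-of-unity filter for the weight modulo 4. -/
theorem sum_pow_weight (n : ℕ) {R : Type*} [CommRing R] (g : R) :
    ∑ β : Fin n → ZMod 2, g ^ weight β = (1 + g) ^ n := by
  have h1 : ∀ β : Fin n → ZMod 2, g ^ weight β = ∏ i, if β i = 1 then g else 1 := fun β => by
    rw [weight, ← Finset.prod_const, Finset.prod_filter]
  have h2 : ∑ t : ZMod 2, (if t = 1 then g else 1) = 1 + g := by
    refine (Fin.sum_univ_two _).trans ?_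
    congr 1
  rw [Finset.sum_congr rfl fun β _ => h1 β, ← h2, ← Fintype.card_fin n, ← Finset.card_univ,
    ← Finset.prod_const, Finset.prod_univ_sum, Fintype.piFinset_univ, Finset.card_univ,
    Fintype.card_fin]

theorem weightCount_eq_sum (n k : ℕ) :
    (weightCount n k : ℝ) = ∑ β : Fin n → ZMod 2, if weight β ≡ k [MOD 4] then 1 else 0 := by
  rw [weightCount, Finset.card_filter]
  push_cast
  rfl

theorem neg_one_pow_weight (w : ℕ) :
    (1 + (-1 : ℝ) ^ w = 2 * ((if w ≡ 0 [MOD 4] then 1 else 0) + if w ≡ 2 [MOD 4] then 1 else 0)) ∧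
    (1 - (-1 : ℝ) ^ w
      = 2 * ((if w ≡ 1 [MOD 4] then 1 else 0) + if w ≡ 3 [MOD 4] then 1 else 0)) := by
  have h1 : (-1 : ℝ) ^ w = (-1) ^ (w % 4) := by
    conv_lhs => rw [← Nat.div_add_mod w 4, pow_add, pow_mul]
    norm_num
  have h2 : w % 4 = 0 ∨ w % 4 = 1 ∨ w % 4 = 2 ∨ w % 4 = 3 := by omega
  rw [h1]
  simp only [Nat.ModEq]
  rcases h2 with h | h | h | h <;> norm_num [h]

theorem I_pow_weight (w : ℕ) :
    ((Complex.I ^ w).re = (if w ≡ 0 [MOD 4] then 1 else 0) - if w ≡ 2 [MOD 4] then 1 else 0) ∧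
    ((Complex.I ^ w).im = (if w ≡ 1 [MOD 4] then 1 else 0) - if w ≡ 3 [MOD 4] then 1 else 0) := by
  have h1 : Complex.I ^ w = Complex.I ^ (w % 4) := by
    conv_lhs => rw [← Nat.div_add_mod w 4, pow_add, pow_mul, Complex.I_pow_four, one_pow, one_mul]
  have h2 : w % 4 = 0 ∨ w % 4 = 1 ∨ w % 4 = 2 ∨ w % 4 = 3 := by omega
  rw [h1]
  simp only [Nat.ModEq]
  rcases h2 with h | h | h | h <;> norm_num [h, Complex.I_sq, pow_succ]

theorem weightCount_add (n : ℕ) (hn : n ≠ 0) :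
    (weightCount n 0 : ℝ) + weightCount n 2 = 2 ^ (n - 1) ∧
    (weightCount n 1 : ℝ) + weightCount n 3 = 2 ^ (n - 1) := by
  have h0 := sum_pow_weight n (-1 : ℝ)
  have h1 := sum_pow_weight n (1 : ℝ)
  obtain ⟨m, rfl⟩ := Nat.exists_eq_succ_of_ne_zero hn
  rw [add_neg_cancel, zero_pow hn] at h0
  simp only [one_pow, one_add_one_eq_two, pow_succ] at h1
  constructor
  · have h2 := Finset.sum_congr (rfl : (Finset.univ : Finset (Fin m.succ → ZMod 2)) = _)
      fun β _ => (neg_one_pow_weight (weight β)).1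
    rw [Finset.sum_add_distrib, h0, h1, ← Finset.mul_sum, Finset.sum_add_distrib,
      ← weightCount_eq_sum, ← weightCount_eq_sum] at h2
    simp only [Nat.succ_eq_add_one, Nat.add_sub_cancel] at h2 ⊢
    linarith
  · have h2 := Finset.sum_congr (rfl : (Finset.univ : Finset (Fin m.succ → ZMod 2)) = _)
      fun β _ => (neg_one_pow_weight (weight β)).2
    rw [Finset.sum_sub_distrib, h0, h1, ← Finset.mul_sum, Finset.sum_add_distrib,
      ← weightCount_eq_sum, ← weightCount_eq_sum] at h2
    simp only [Nat.succ_eq_add_one, Nat.add_sub_cancel] at h2 ⊢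
    linarith

theorem weightCount_sub (n : ℕ) :
    (weightCount n 0 : ℝ) - weightCount n 2 = ((1 + Complex.I) ^ n).re ∧
    (weightCount n 1 : ℝ) - weightCount n 3 = ((1 + Complex.I) ^ n).im := by
  rw [← sum_pow_weight, Complex.re_sum, Complex.im_sum]
  simp only [weightCount_eq_sum, ← Finset.sum_sub_distrib, (I_pow_weight _).1, (I_pow_weight _).2,
    and_self]

/-- Since (1 + i)² = 2i, the eighth power is 16, so signs depend only on `n` modulo 8: Re(1 + i) = 1
and Re(1 + i)^5 = -4, Im(1 + i)^3 = 2 and Im(1 + i)^7 = -8. -/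
theorem one_add_I_pow_eight_mul_add (q r : ℕ) :
    (1 + Complex.I) ^ (8 * q + r) = ((2 ^ (4 * q) : ℝ) : ℂ) * (1 + Complex.I) ^ r := by
  have h : (1 + Complex.I) ^ 8 = 16 := by
    have h2 : (1 + Complex.I) ^ 2 = 2 * Complex.I := by
      rw [add_sq, Complex.I_sq]; ring
    calc (1 + Complex.I) ^ 8 = ((1 + Complex.I) ^ 2) ^ 4 := by ring
      _ = 16 := by rw [h2, mul_pow, Complex.I_pow_four]; norm_num
  rw [pow_add, pow_mul, h, pow_mul]
  push_cast
  norm_num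

theorem weightCount_sub_of_mod_four_eq_one {n : ℕ} (h : n % 4 = 1) :
    (weightCount n 0 : ℝ) - weightCount n 2 = octantSign n * 2 ^ ((n - 1) / 2) := by
  rw [(weightCount_sub n).1, octantSign]
  rcases (by omega : n % 8 = 1 ∨ n % 8 = 5) with h8 | h8
  · obtain ⟨q, rfl⟩ : ∃ q, n = 8 * q + 1 := ⟨n / 8, by omega⟩
    rw [if_pos (Or.inl h8), one_add_I_pow_eight_mul_add, Complex.re_ofReal_mul,
      show (8 * q + 1 - 1) / 2 = 4 * q by omega]
    norm_num
  · obtain ⟨q, rfl⟩ : ∃ q, n = 8 * q + 5 := ⟨n / 8, by omega⟩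
    rw [if_neg (by omega), one_add_I_pow_eight_mul_add, Complex.re_ofReal_mul,
      show (8 * q + 5 - 1) / 2 = 4 * q + 2 by omega, pow_add]
    norm_num [pow_succ]

theorem weightCount_sub_of_mod_four_eq_three {n : ℕ} (h : n % 4 = 3) :
    (weightCount n 1 : ℝ) - weightCount n 3 = octantSign n * 2 ^ ((n - 1) / 2) := by
  rw [(weightCount_sub n).2, octantSign]
  rcases (by omega : n % 8 = 3 ∨ n % 8 = 7) with h8 | h8
  · obtain ⟨q, rfl⟩ : ∃ q, n = 8 * q + 3 := ⟨n / 8, by omega⟩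
    rw [if_pos (Or.inr h8), one_add_I_pow_eight_mul_add, Complex.im_ofReal_mul,
      show (8 * q + 3 - 1) / 2 = 4 * q + 1 by omega, pow_add]
    norm_num [pow_succ]
  · obtain ⟨q, rfl⟩ : ∃ q, n = 8 * q + 7 := ⟨n / 8, by omega⟩
    rw [if_neg (by omega), one_add_I_pow_eight_mul_add, Complex.im_ofReal_mul,
      show (8 * q + 7 - 1) / 2 = 4 * q + 3 by omega, pow_add]
    norm_num [pow_succ]

/-- The last `k` indices. -/
def lastIndices (n k : ℕ) : Finset (Fin n) := Finset.univ.filter fun i => ¬ ((i : ℕ) + k < n)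

theorem card_lastIndices {n k : ℕ} (hk : k ≤ n) : (lastIndices n k).card = k := by
  have h : (lastIndices n k).map Fin.valEmbedding = Finset.Ico (n - k) n := by
    ext i
    simp only [lastIndices, Finset.mem_map, Finset.mem_filter, Finset.mem_univ, true_and,
      Fin.valEmbedding_apply, Finset.mem_Ico]
    constructor
    · rintro ⟨j, hj, rfl⟩
      have := j.2
      omega
    · rintro ⟨h1, h2⟩
      exact ⟨⟨i, h2⟩, by simp only; omega, rfl⟩
  rw [← Finset.card_map Fin.valEmbedding, h, Nat.card_Ico]
  omega

theorem signDiagonal_map_redEight (n k : ℕ) :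
    (signDiagonal n k).map redEight = signForm (lastIndices n k) := by
  rw [signDiagonal, signForm, Matrix.diagonal_map (map_zero _)]
  congr 1
  funext i
  by_cases h : (i : ℕ) + k < n <;> simp [lastIndices, h]

theorem det_signDiagonal {n k : ℕ} (hk : k ≤ n) : (signDiagonal n k).det = (-1) ^ k := by
  rw [signDiagonal, Matrix.det_diagonal]
  conv_rhs => rw [← card_lastIndices hk]
  rw [lastIndices, ← Finset.prod_const, Finset.prod_filter]
  refine Finset.prod_congr rfl fun i _ => ?_
  by_cases h : (i : ℕ) + k < n <;> simp [h]

theorem measurable_and_integratedMass_signDiagonal {n k : ℕ} (hn : Odd n) (hk : k ≤ n)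
    (hdet : (-1 : ℤ_[2]) ^ k = (-1) ^ ((n - 1) / 2)) (b : ℕ) (S : Set (Fin (n - 1) → ℤ_[2]))
    (hS : DefinedModTwo S) :
    Measurable (fun a => localMass (signDiagonal n k) (monicPoly n b a)) ∧
    integratedMass b S (signDiagonal n k) = weightCount n k * coeffMeasure n S := by
  obtain ⟨m, rfl⟩ : ∃ m, n = m + 1 := ⟨n - 1, by have := hn.pos; omega⟩
  have h := measurable_and_integratedMass_eq hn ((det_signDiagonal hk).trans hdet)
    (Matrix.isSymm_diagonal _) (lastIndices (m + 1) k) (signDiagonal_map_redEight _ _) b S hS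
  rwa [card_lastIndices hk] at h

/-- The masses of the two forms, as multiples of the volume. -/
theorem exists_integratedMass_eq {n : ℕ} (hn : Odd n) (h3 : 3 ≤ n) (b : ℕ)
    (S : Set (Fin (n - 1) → ℤ_[2])) (hS : DefinedModTwo S) :
    ∃ p q : ℕ, (p : ℝ) + q = 2 ^ (n - 1) ∧ (p : ℝ) - q = octantSign n * 2 ^ ((n - 1) / 2) ∧
      (Measurable (fun a => localMass (formPos n) (monicPoly n b a)) ∧
        integratedMass b S (formPos n) = p * coeffMeasure n S) ∧
      (Measurable (fun a => localMass (formNeg n) (monicPoly n b a)) ∧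
        integratedMass b S (formNeg n) = q * coeffMeasure n S) := by
  rw [formPos, formNeg]
  rcases (by have := Nat.odd_iff.1 hn; omega : n % 4 = 1 ∨ n % 4 = 3) with h | h
  · have hpar : (-1 : ℤ_[2]) ^ ((n - 1) / 2) = 1 :=
      Even.neg_one_pow (Nat.even_iff.2 (by omega))
    simp only [h, if_true]
    exact ⟨_, _, (weightCount_add n (by omega)).1, weightCount_sub_of_mod_four_eq_one h,
      measurable_and_integratedMass_signDiagonal hn (by omega) (by rw [hpar]; norm_num) b S hS,
      measurable_and_integratedMass_signDiagonal hn (by omega) (by rw [hpar]; norm_num) b S hS⟩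
  · have hpar : (-1 : ℤ_[2]) ^ ((n - 1) / 2) = -1 :=
      Odd.neg_one_pow (Nat.odd_iff.2 (by omega))
    rw [if_neg (by omega), if_neg (by omega)]
    exact ⟨_, _, (weightCount_add n (by omega)).2, weightCount_sub_of_mod_four_eq_three h,
      measurable_and_integratedMass_signDiagonal hn (by omega) (by rw [hpar]; norm_num) b S hS,
      measurable_and_integratedMass_signDiagonal hn (by omega) (by rw [hpar]; norm_num) b S hS⟩

end

end TwoAdicMass

theorem mainTheorem5 (n : ℕ) (hodd : Odd n) (hn : 3 ≤ n) (b : ℕ) (hb : b < n)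
    (S : Set (Fin (n - 1) → ℤ_[2])) (hS : TwoAdicMass.DefinedModTwo S) :
    -- the masses are measurable functions with finite integrals over `S`
    (AEMeasurable (fun a => TwoAdicMass.localMass (TwoAdicMass.formPos n)
          (TwoAdicMass.monicPoly n b a)) ((TwoAdicMass.coeffMeasure n).restrict S) ∧
      AEMeasurable (fun a => TwoAdicMass.localMass (TwoAdicMass.formNeg n)
          (TwoAdicMass.monicPoly n b a)) ((TwoAdicMass.coeffMeasure n).restrict S) ∧
      TwoAdicMass.integratedMass b S (TwoAdicMass.formPos n) ≠ ∞ ∧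
      TwoAdicMass.integratedMass b S (TwoAdicMass.formNeg n) ≠ ∞) ∧
    (TwoAdicMass.integratedMass b S (TwoAdicMass.formPos n)).toReal
        + (TwoAdicMass.integratedMass b S (TwoAdicMass.formNeg n)).toReal
      = 2 ^ (n - 1) * (TwoAdicMass.coeffMeasure n).real S ∧
    (TwoAdicMass.integratedMass b S (TwoAdicMass.formPos n)).toReal
        - (TwoAdicMass.integratedMass b S (TwoAdicMass.formNeg n)).toReal
      = TwoAdicMass.octantSign n * 2 ^ ((n - 1) / 2) * (TwoAdicMass.coeffMeasure n).real S ∧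
    (TwoAdicMass.integratedMass b S (TwoAdicMass.formPos n)).toReal
      = 1 / 2 * (2 ^ (n - 1) + TwoAdicMass.octantSign n * 2 ^ ((n - 1) / 2))
          * (TwoAdicMass.coeffMeasure n).real S ∧
    (TwoAdicMass.integratedMass b S (TwoAdicMass.formNeg n)).toReal
      = 1 / 2 * (2 ^ (n - 1) - TwoAdicMass.octantSign n * 2 ^ ((n - 1) / 2))
          * (TwoAdicMass.coeffMeasure n).real S := by
  obtain ⟨p, q, hadd, hsub, ⟨hm, hp⟩, hm', hq⟩ :=
    TwoAdicMass.exists_integratedMass_eq hodd hn b S hS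
  have hfin : ∀ m : ℕ, (m : ℝ≥0∞) * TwoAdicMass.coeffMeasure n S ≠ ∞ := fun m =>
    ENNReal.mul_ne_top (ENNReal.natCast_ne_top m) (MeasureTheory.measure_ne_top _ _)
  rw [hp, hq, ENNReal.toReal_mul, ENNReal.toReal_mul, ENNReal.toReal_natCast,
    ENNReal.toReal_natCast, ← MeasureTheory.measureReal_def]
  refine ⟨⟨hm.aemeasurable, hm'.aemeasurable, hfin p, hfin q⟩, ?_, ?_, ?_, ?_⟩
  · rw [← hadd]; ring
  · rw [← hsub]; ring
  · rw [← hadd, ← hsub]; ring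
  · rw [← hadd, ← hsub]; ring
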